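/- Let $n\ge 1$, let $\mathbb{R}_n=\{\sum_A s_Ae_A : s_A\in\mathbb{R}\}$ be the real Clifford algebra with imaginary units $e_1,\dots,e_n$ ($e_i^2=-1$, $e_ie_j=-e_je_i$ for $i\neq j$; $e_A=e_{i_1}\cdots e_{i_r}$ for $A=(i_1<\dots<i_r)$), with conjugation $\overline{e_A}=(-1)^{|A|(|A|+1)/2}e_A$ and $|s|^2=\sum_As_A^2$. Let $\mathbb{R}^{n+1}=\{s_0+s_1e_1+\dots+s_ne_n\}\subseteq\mathbb{R}_n$ be the paravectors, $\mathbb{S}=\{J\in\mathbb{R}^{n+1}: J_0=0,\ |J|=1\}$, and $\mathbb{C}_J=\{x+Jy: x,y\in\mathbb{R}\}$ for $J\in\mathbb{S}$. For $\omega\in(0,\frac{\pi}{2})$ put $I_\omega=(-\omega,\omega)\cup(\pi-\omega,\pi+\omega)$ and $D_\omega=\{re^{J\phi}: r>0,\ J\in\mathbb{S},\ \phi\in I_\omega\}$. *Functions.* A function $f:D_\theta\to\mathbb{R}_n$ is left slice hyperholomorphic if there are continuously differentiable $f_0,f_1:\{(x,y)\in\mathbb{R}^2: x+\mathbb{S}y\subseteq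 D_\theta\}\to\mathbb{R}_n$ with $f(x+Jy)=f_0(x,y)+Jf_1(x,y)$ for all $J\in\mathbb{S}$, $f_0(x,-y)=f_0(x,y)$, $f_1(x,-y)=-f_1(x,y)$, $\partial_xf_0=\partial_yf_1$ and $\partial_yf_0=-\partial_xf_1$; it is intrinsic if $f_0,f_1$ can be taken real valued. $\mathcal{SH}_L^0(D_\theta)$ (resp. $\mathcal{N}^0(D_\theta)$) is the set of all left slice hyperholomorphic (resp. intrinsic) functions $f$ that are bounded on $D_\theta$ and satisfy $\int_0^\infty|f(te^{J\phi})|\frac{dt}{t}<\infty$ for all $J\in\mathbb{S}$, $\phi\in I_\theta$. *Operators.* Let $V=\{\sum_Av_A\otimes e_A: v_A\in V_\mathbb{R}\}$ be the two-sided Clifford module over a real Banach space $V_\mathbb{R}$, with $\|v\|^2=\sum_A\|v_A\|^2$. Let $\mathcal{B}(V)$ be the set of bounded everywhere defined right-linear operators on $V$, and $\mathcal{K}(V)$ the set of closed right-linear operators whose domain is a two-sided linear subspace of $V$. Products of operators with $s\in\mathbb{R}_n$ are $(Ts)v=T(sv)$ and $(sT)v=s(Tv)$. For $T\in\mathcal{K}(V)$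 and $s\in\mathbb{R}^{n+1}$ let $Q_s[T]=T^2-2s_0T+|s|^2$ on $\operatorname{dom}(T^2)$, $\rho_S(T)=\{s\in\mathbb{R}^{n+1}: Q_s[T]^{-1}\in\mathcal{B}(V)\}$, $\sigma_S(T)=\mathbb{R}^{n+1}\setminus\rho_S(T)$ and, for $s\in\rho_S(T)$, $S_L^{-1}(s,T)=Q_s[T]^{-1}\overline{s}-TQ_s[T]^{-1}$. The operator $T$ is bisectorial of angle $\omega\in(0,\frac{\pi}{2})$ if $\sigma_S(T)\subseteq\overline{D_\omega}$ and for every $\varphi\in(\omega,\frac{\pi}{2})$ there is $C_\varphi\ge0$ with $\|S_L^{-1}(s,T)\|\le C_\varphi/|s|$ for all $s\in\mathbb{R}^{n+1}\setminus(D_\varphi\cup\{0\})$. For $T$ bisectorial of angle $\omega$, $\theta\in(\omega,\frac{\pi}{2})$ and $f\in\mathcal{SH}_L^0(D_\theta)$, the $\omega$-functional calculus is $$f(T)=\frac{1}{2\pi}\int_{\partial D_\varphi\cap\mathbb{C}_J}S_L^{-1}(s,T)\,ds_J\,f(s)=\frac1{2\pi}\sum_\pm\int_{\mathbb{R}}S_L^{-1}(\gamma_\pm(t),T)\frac{\gamma_\pm'(t)}{J}f(\gamma_\pm(t))\,dt,\qquad\gamma_\pm(t)=\pm|t|e^{-\operatorname{sgn}(t)J\varphi},$$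 where $\varphi\in(\omega,\theta)$ and $J\in\mathbb{S}$ are arbitrary; the integrals converge absolutely and define an operator in $\mathcal{B}(V)$ that does not depend on the choice of $\varphi$ and $J$. **Theorem.** Let $T\in\mathcal{K}(V)$ be bisectorial of angle $\omega\in(0,\frac{\pi}{2})$, let $\theta\in(\omega,\frac{\pi}{2})$, $g\in\mathcal{N}^0(D_\theta)$ and $f\in\mathcal{SH}_L^0(D_\theta)$. Then $gf\in\mathcal{SH}_L^0(D_\theta)$, and $$(gf)(T)=g(T)f(T).$$ -/

import Mathlib

open Set MeasureTheory

noncomputable section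

namespace CliffordCalculus

/-! ### Clifford modules and the Clifford algebra -/

/-- The sign in `e_A e_B = sgn A B • e_{A ∆ B}`: one factor `-1` for every pair `i ∈ A`, `j ∈ B`
with `j < i` (interchange of `e_i` and `e_j`) and one for every common index (`e_i ^ 2 = -1`). -/
def sgn {n : ℕ} (A B : Finset (Fin n)) : ℝ := ∏ i ∈ A, ∏ j ∈ B, if j ≤ i then -1 else 1

/-- The Clifford module `V = {∑_A v_A ⊗ e_A}` over the real Banach space `VR`. The index
`A ⊆ {1, …, n}` stands for the ordered tuple of its elements, and `‖v‖² = ∑_A ‖v_A‖²`. -/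
def CMod (n : ℕ) (VR : Type*) : Type _ := PiLp 2 (fun _ : Finset (Fin n) => VR)

theorem CMod.continuous_mk {n : ℕ} {VR : Type*} [NormedAddCommGroup VR] :
    Continuous (fun v => WithLp.toLp 2 v :
      (Finset (Fin n) → VR) → PiLp 2 (fun _ : Finset (Fin n) => VR)) :=
  PiLp.continuous_toLp 2 _

section CMod

variable {n : ℕ} {VR : Type*} [NormedAddCommGroup VR] [NormedSpace ℝ VR]

instance : NormedAddCommGroup (CMod n VR) :=
  inferInstanceAs (NormedAddCommGroup (PiLp 2 (fun _ : Finset (Fin n) => VR)))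

instance : NormedSpace ℝ (CMod n VR) :=
  inferInstanceAs (NormedSpace ℝ (PiLp 2 (fun _ : Finset (Fin n) => VR)))

instance [CompleteSpace VR] : CompleteSpace (CMod n VR) :=
  inferInstanceAs (CompleteSpace (PiLp 2 (fun _ : Finset (Fin n) => VR)))

/-- The coefficient `v_A` of `v`. -/
def CMod.coeff (A : Finset (Fin n)) : CMod n VR →L[ℝ] VR :=
  PiLp.proj 2 (fun _ : Finset (Fin n) => VR) A

/-- The element `∑_A v_A ⊗ e_A`. -/
def CMod.mk (v : Finset (Fin n) → VR) : CMod n VR := WithLp.toLp 2 v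

@[simp] theorem CMod.coeff_mk (v : Finset (Fin n) → VR) (A : Finset (Fin n)) :
    CMod.coeff A (CMod.mk v) = v A := rfl

@[ext] theorem CMod.ext {v w : CMod n VR} (h : ∀ A, CMod.coeff A v = CMod.coeff A w) : v = w :=
  PiLp.ext h

theorem CMod.norm_sq (v : CMod n VR) : ‖v‖ ^ 2 = ∑ A, ‖CMod.coeff A v‖ ^ 2 :=
  PiLp.norm_sq_eq_of_L2 _ v

/-- The Clifford algebra `ℝ_n = {∑_A s_A e_A}` with the absolute value `|s|² = ∑_A s_A²`; as a
normed space it is the Clifford module over `ℝ`. -/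
abbrev Cl (n : ℕ) : Type := CMod n ℝ

/-- Left multiplication `v ↦ s v = ∑_{A,B} (s_B v_A) ⊗ (e_B e_A)`. The coefficient at `C`
collects the pairs with `A = B ∆ C`. -/
def lmul (s : Cl n) : CMod n VR →L[ℝ] CMod n VR where
  toFun v := CMod.mk fun C =>
    ∑ B, (sgn B (symmDiff B C) * CMod.coeff B s) • CMod.coeff (symmDiff B C) v
  map_add' v w := by
    ext C; simp [smul_add, Finset.sum_add_distrib]
  map_smul' c v := by
    ext C; simp [Finset.smul_sum, smul_comm c]
  cont := CMod.continuous_mk.comp (by fun_prop)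

/-- Right multiplication `v ↦ v s = ∑_{A,B} (v_A s_B) ⊗ (e_A e_B)`. The coefficient at `C`
collects the pairs with `A = C ∆ B`. -/
def rmul (s : Cl n) : CMod n VR →L[ℝ] CMod n VR where
  toFun v := CMod.mk fun C =>
    ∑ B, (sgn (symmDiff C B) B * CMod.coeff B s) • CMod.coeff (symmDiff C B) v
  map_add' v w := by
    ext C; simp [smul_add, Finset.sum_add_distrib]
  map_smul' c v := by
    ext C; simp [Finset.smul_sum, smul_comm c]
  cont := CMod.continuous_mk.comp (by fun_prop)

theorem coeff_lmul (s : Cl n) (v : CMod n VR) (C : Finset (Fin n)) :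
    CMod.coeff C (lmul s v) =
      ∑ B, (sgn B (symmDiff B C) * CMod.coeff B s) • CMod.coeff (symmDiff B C) v := rfl

theorem coeff_rmul (s : Cl n) (v : CMod n VR) (C : Finset (Fin n)) :
    CMod.coeff C (rmul s v) =
      ∑ B, (sgn (symmDiff C B) B * CMod.coeff B s) • CMod.coeff (symmDiff C B) v := rfl

theorem prod_symmDiff (h : Fin n → ℝ) (hh : ∀ i, h i * h i = 1) (A B : Finset (Fin n)) :
    ∏ i ∈ symmDiff A B, h i = (∏ i ∈ A, h i) * ∏ i ∈ B, h i := by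
  have key : ∀ D : Finset (Fin n), ∏ i ∈ D, h i = ∏ i, if i ∈ D then h i else 1 := by
    intro D; simp
  rw [key, key A, key B, ← Finset.prod_mul_distrib]
  refine Finset.prod_congr rfl fun i _ => ?_
  by_cases hA : i ∈ A <;> by_cases hB : i ∈ B <;> simp [Finset.mem_symmDiff, hA, hB, hh]

theorem sgn_symmDiff_left (A B C : Finset (Fin n)) :
    sgn (symmDiff A B) C = sgn A C * sgn B C := by
  refine prod_symmDiff _ (fun i => ?_) A B
  rw [← Finset.prod_mul_distrib]
  exact Finset.prod_eq_one fun j _ => by split_ifs <;> norm_num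

theorem sgn_symmDiff_right (A B C : Finset (Fin n)) :
    sgn A (symmDiff B C) = sgn A B * sgn A C := by
  unfold sgn
  rw [← Finset.prod_mul_distrib]
  exact Finset.prod_congr rfl fun i _ =>
    prod_symmDiff _ (fun j => by split_ifs <;> norm_num) B C

@[simp] theorem sgn_empty_left (A : Finset (Fin n)) : sgn ∅ A = 1 := by simp [sgn]

@[simp] theorem sgn_empty_right (A : Finset (Fin n)) : sgn A ∅ = 1 := by simp [sgn]

theorem lmul_lmul (s t : Cl n) (v : CMod n VR) : lmul (lmul s t) v = lmul s (lmul t v) := by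
  ext C
  simp only [coeff_lmul, smul_eq_mul, Finset.mul_sum, Finset.sum_smul, Finset.smul_sum]
  rw [Finset.sum_comm]
  refine Finset.sum_congr rfl fun B _ => ?_
  refine Finset.sum_nbij' (fun A => symmDiff B A) (fun A => symmDiff B A) (by simp) (by simp)
    (by simp) (by simp) fun A _ => ?_
  have h1 : symmDiff (symmDiff B A) (symmDiff B C) = symmDiff A C := by
    rw [symmDiff_comm B A, symmDiff_assoc, symmDiff_symmDiff_cancel_left]
  have h2 : sgn B (symmDiff B A) * sgn A (symmDiff A C)
      = sgn B (symmDiff B C) * sgn (symmDiff B A) (symmDiff A C) := by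
    have e : symmDiff B C = symmDiff (symmDiff B A) (symmDiff A C) := by
      rw [symmDiff_assoc, symmDiff_symmDiff_cancel_left]
    have e2 : ∀ X Y : Finset (Fin n), sgn X Y * sgn X Y = 1 := fun X Y => by
      rw [← sgn_symmDiff_right]; simp
    rw [e, sgn_symmDiff_right B (symmDiff B A), sgn_symmDiff_left B A (symmDiff A C)]
    linear_combination (-sgn B (symmDiff B A) * sgn A (symmDiff A C)) * e2 B (symmDiff A C)
  rw [h1, smul_smul]
  congr 1
  linear_combination (CMod.coeff B s * CMod.coeff (symmDiff B A) t) * h2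

/-- The basis vector `e_A`. -/
def basisVec (A : Finset (Fin n)) : Cl n := CMod.mk fun B => if B = A then 1 else 0

/-- The imaginary unit `e_i`. -/
def unitVec (i : Fin n) : Cl n := basisVec {i}

instance : One (Cl n) := ⟨basisVec ∅⟩

instance : Mul (Cl n) := ⟨fun s t => lmul s t⟩

theorem Cl.mul_def (s t : Cl n) : s * t = lmul s t := rfl

theorem Cl.coeff_mul (s t : Cl n) (C : Finset (Fin n)) : CMod.coeff C (s * t) =
    ∑ B, sgn B (symmDiff B C) * CMod.coeff B s * CMod.coeff (symmDiff B C) t := rfl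

theorem Cl.coeff_one (A : Finset (Fin n)) :
    CMod.coeff A (1 : Cl n) = if A = ∅ then 1 else 0 := rfl

theorem lmul_one (v : CMod n VR) : lmul (1 : Cl n) v = v := by
  ext C
  have h : symmDiff ∅ C = C := bot_symmDiff C
  simp [coeff_lmul, Cl.coeff_one, h]

theorem lmul_add_left (s t : Cl n) (v : CMod n VR) : lmul (s + t) v = lmul s v + lmul t v := by
  ext C; simp [coeff_lmul, mul_add, add_smul, Finset.sum_add_distrib]

theorem lmul_zero_left (v : CMod n VR) : lmul (0 : Cl n) v = 0 := by
  ext C; simp [coeff_lmul]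

instance : Ring (Cl n) where
  __ := (inferInstance : AddCommGroup (CMod n ℝ))
  left_distrib s t u := map_add (lmul s) t u
  right_distrib s t u := lmul_add_left s t u
  zero_mul s := lmul_zero_left s
  mul_zero s := map_zero (lmul s)
  mul_assoc s t u := lmul_lmul s t u
  one_mul s := lmul_one s
  mul_one s := by
    ext C
    rw [Cl.coeff_mul, Finset.sum_eq_single C]
    · simp [Cl.coeff_one]
    · intro B _ hB
      have : symmDiff B C ≠ ∅ := fun h => hB (symmDiff_eq_bot.1 h)
      simp [Cl.coeff_one, this]
    · simp

instance : Algebra ℝ (Cl n) := Algebra.ofModule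
  (fun c s t => by ext C; simp [Cl.coeff_mul, Finset.mul_sum, mul_assoc, mul_left_comm])
  (fun c s t => by ext C; simp [Cl.coeff_mul, Finset.mul_sum, mul_left_comm])

theorem basisVec_mul_basisVec (A B : Finset (Fin n)) :
    basisVec A * basisVec B = sgn A B • basisVec (symmDiff A B) := by
  ext C
  rw [Cl.coeff_mul, Finset.sum_eq_single A]
  · by_cases h : C = symmDiff A B
    · subst h; simp [basisVec]
    · have : symmDiff A C ≠ B := fun h' => h (by rw [← h']; simp)
      simp [basisVec, h, this]
  · intro D _ hD; simp [basisVec, hD]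
  · simp

theorem unitVec_mul_self (i : Fin n) : unitVec i * unitVec i = (-1 : Cl n) := by
  rw [unitVec, basisVec_mul_basisVec]
  have : basisVec (symmDiff {i} {i}) = (1 : Cl n) := by rw [symmDiff_self]; rfl
  rw [this]; simp [sgn]

theorem unitVec_mul_comm {i j : Fin n} (h : i ≠ j) :
    unitVec i * unitVec j = -(unitVec j * unitVec i) := by
  rw [unitVec, unitVec, basisVec_mul_basisVec, basisVec_mul_basisVec, 
    symmDiff_comm ({j} : Finset (Fin n)), ← neg_smul]
  congr 1
  rcases lt_or_gt_of_ne h with h | h <;> simp [sgn, h.le, h.not_ge]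

/-- `e_A` is the product of the imaginary units `e_i`, `i ∈ A`, in increasing order. -/
theorem unitVec_mul_basisVec {i : Fin n} {A : Finset (Fin n)} (h : ∀ j ∈ A, i < j) :
    unitVec i * basisVec A = basisVec (insert i A) := by
  have hi : i ∉ A := fun hA => lt_irrefl i (h i hA)
  have h1 : symmDiff {i} A = insert i A := by
    ext j; simp only [Finset.mem_symmDiff, Finset.mem_singleton, Finset.mem_insert]
    by_cases hj : j = i
    · subst hj; simp [hi]
    · simp [hj]
  have h2 : sgn {i} A = 1 := by
    simp only [sgn, Finset.prod_singleton]
    exact Finset.prod_eq_one fun j hj => if_neg (h j hj).not_ge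
  rw [unitVec, basisVec_mul_basisVec, h1, h2, one_smul]

/-! ### Paravectors -/

/-- The conjugate `∑_A (-1)^{|A|(|A|+1)/2} s_A e_A`. -/
def conj (s : Cl n) : Cl n :=
  CMod.mk fun A => (-1) ^ (A.card * (A.card + 1) / 2) * CMod.coeff A s

/-- The real part `s_0`. -/
def re (s : Cl n) : ℝ := CMod.coeff ∅ s

end CMod

/-- The paravectors `ℝ^{n+1} = {s_0 + s_1 e_1 + ⋯ + s_n e_n}` inside `ℝ_n`. -/
def paravectors (n : ℕ) : Set (Cl n) := {s | ∀ A : Finset (Fin n), 1 < A.card → CMod.coeff A s = 0}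

/-- The sphere `𝕊` of purely imaginary paravectors of modulus one. -/
def imagSphere (n : ℕ) : Set (Cl n) := {J | J ∈ paravectors n ∧ re J = 0 ∧ ‖J‖ = 1}

/-- `x + J y` for real `x`, `y`. -/
def slicePt {n : ℕ} (J : Cl n) (x y : ℝ) : Cl n := x • 1 + y • J

/-- `r e^{Jφ} = r (cos φ + J sin φ)`. -/
def polarPt {n : ℕ} (J : Cl n) (r φ : ℝ) : Cl n := slicePt J (r * Real.cos φ) (r * Real.sin φ)

/-- `I_ω = (-ω, ω) ∪ (π - ω, π + ω)`. -/
def angleSet (ω : ℝ) : Set ℝ := Ioo (-ω) ω ∪ Ioo (Real.pi - ω) (Real.pi + ω)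

/-- The double sector `D_ω` of nonzero paravectors with argument in `I_ω`. -/
def doubleSector (n : ℕ) (ω : ℝ) : Set (Cl n) :=
  {s | ∃ J ∈ imagSphere n, ∃ r > 0, ∃ φ ∈ angleSet ω, s = polarPt J r φ}

/-- The curve `t ↦ ± |t| e^{-sgn(t) J φ}`, `t ∈ ℝ`, for `ε = ±1`; the two curves together
parametrize the positively oriented boundary of `D_φ ∩ ℂ_J`. -/
def boundaryCurve {n : ℕ} (J : Cl n) (φ ε t : ℝ) : Cl n :=
  polarPt J (ε * |t|) (-Real.sign t * φ)

theorem unitVec_mem_imagSphere {n : ℕ} (i : Fin n) :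
    unitVec i ∈ imagSphere n := by
  refine ⟨fun A hA => ?_, ?_, ?_⟩
  · have : A ≠ {i} := by rintro rfl; simp at hA
    simp [unitVec, basisVec, this]
  · simp [re, unitVec, basisVec, (Finset.singleton_ne_empty i).symm]
  · have h : ‖unitVec i‖ ^ 2 = 1 := by
      rw [CMod.norm_sq, Finset.sum_eq_single {i}] <;> simp +contextual [unitVec, basisVec]
    exact (pow_eq_one_iff_of_nonneg (norm_nonneg _) two_ne_zero).1 h

/-! ### Slice hyperholomorphic functions

A function on an axially symmetric open set `U` of paravectors is represented by a function on
`ℝ_n` of which only the values on `U` matter. -/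

/-- `{(x, y) ∈ ℝ² | x + 𝕊 y ⊆ U}`. -/
def sliceDomain {n : ℕ} (U : Set (Cl n)) : Set (ℝ × ℝ) :=
  {p | ∀ J ∈ imagSphere n, slicePt J p.1 p.2 ∈ U}

/-- `f (x + J y) = f₀ (x, y) + J f₁ (x, y)` with `f₀`, `f₁` continuously differentiable, subject to
the compatibility conditions and to the Cauchy-Riemann equations. -/
structure IsLeftSliceDecomp {n : ℕ} (U : Set (Cl n)) (f : Cl n → Cl n) (f₀ f₁ : ℝ × ℝ → Cl n) :
    Prop where
  contDiffOn_zero : ContDiffOn ℝ 1 f₀ (sliceDomain U)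
  contDiffOn_one : ContDiffOn ℝ 1 f₁ (sliceDomain U)
  repr : ∀ p ∈ sliceDomain U, ∀ J ∈ imagSphere n, f (slicePt J p.1 p.2) = f₀ p + J * f₁ p
  even_zero : ∀ p ∈ sliceDomain U, f₀ (p.1, -p.2) = f₀ p
  odd_one : ∀ p ∈ sliceDomain U, f₁ (p.1, -p.2) = -f₁ p
  cauchyRiemann_x : ∀ p ∈ sliceDomain U,
    deriv (fun x => f₀ (x, p.2)) p.1 = deriv (fun y => f₁ (p.1, y)) p.2
  cauchyRiemann_y : ∀ p ∈ sliceDomain U,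
    deriv (fun y => f₀ (p.1, y)) p.2 = -deriv (fun x => f₁ (x, p.2)) p.1

/-- The left slice hyperholomorphic functions `SH_L(U)`. -/
def SHL {n : ℕ} (U : Set (Cl n)) : Set (Cl n → Cl n) :=
  {f | ∃ f₀ f₁ : ℝ × ℝ → Cl n, IsLeftSliceDecomp U f f₀ f₁}

/-- The intrinsic functions `N(U)`: `f₀` and `f₁` are real valued. -/
def Intrinsic {n : ℕ} (U : Set (Cl n)) : Set (Cl n → Cl n) :=
  {f | ∃ f₀ f₁ : ℝ × ℝ → ℝ, IsLeftSliceDecomp U f (fun p => f₀ p • 1) (fun p => f₁ p • 1)}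

/-- `f` is bounded on `D_θ`, and `∫₀^∞ |f(t e^{Jφ})| dt/t < ∞` for all `J ∈ 𝕊`, `φ ∈ I_θ`. -/
def BoundedWithDecay {n : ℕ} (θ : ℝ) (f : Cl n → Cl n) : Prop :=
  (∃ C : ℝ, ∀ s ∈ doubleSector n θ, ‖f s‖ ≤ C) ∧
    ∀ J ∈ imagSphere n, ∀ φ ∈ angleSet θ,
      IntegrableOn (fun t : ℝ => ‖f (polarPt J t φ)‖ / t) (Ioi 0)

/-- The space `SH_L^0(D_θ)`. -/
def SHL0 (n : ℕ) (θ : ℝ) : Set (Cl n → Cl n) :=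
  {f | f ∈ SHL (doubleSector n θ) ∧ BoundedWithDecay θ f}

/-- The space `N^0(D_θ)`. -/
def N0 (n : ℕ) (θ : ℝ) : Set (Cl n → Cl n) :=
  {g | g ∈ Intrinsic (doubleSector n θ) ∧ BoundedWithDecay θ g}

/-! ### Operators, `S`-spectrum and `S`-resolvent -/

variable {n : ℕ} {VR : Type*} [NormedAddCommGroup VR] [NormedSpace ℝ VR]

/-- Right-linearity of an everywhere defined bounded operator; `𝓑(V)` consists of the
`B : CMod n VR →L[ℝ] CMod n VR` with this property. -/
def IsRightLinear (B : CMod n VR →L[ℝ] CMod n VR) : Prop :=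
  ∀ (s : Cl n) (v : CMod n VR), B (rmul s v) = rmul s (B v)

/-- The closed right-linear operators `𝓚(V)` with two-sided linear domain. -/
structure ClosedOp (n : ℕ) (VR : Type*) [NormedAddCommGroup VR] [NormedSpace ℝ VR] where
  /-- the underlying real-linear operator with its domain -/
  op : CMod n VR →ₗ.[ℝ] CMod n VR
  lmul_mem : ∀ (s : Cl n), ∀ v ∈ op.domain, lmul s v ∈ op.domain
  rmul_mem : ∀ (s : Cl n), ∀ v ∈ op.domain, rmul s v ∈ op.domain
  map_rmul : ∀ (s : Cl n) (v : op.domain), op ⟨rmul s v, rmul_mem s v v.2⟩ = rmul s (op v)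
  closed : op.IsClosed

namespace ClosedOp

/-- `Q_s[T] v = T² v - 2 s₀ T v + |s|² v` for `v ∈ dom(T²)`, that is, `v ∈ dom T` and
`T v ∈ dom T`. -/
def Q (T : ClosedOp n VR) (s : Cl n) (v : T.op.domain) (hv : T.op v ∈ T.op.domain) : CMod n VR :=
  T.op ⟨T.op v, hv⟩ - (2 * re s) • T.op v + ‖s‖ ^ 2 • (v : CMod n VR)

/-- `R = Q_s[T]⁻¹ ∈ 𝓑(V)`: `R` is bounded, right-linear, and a two-sided inverse of
`Q_s[T] : dom(T²) → V`. -/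
structure IsQInv (T : ClosedOp n VR) (s : Cl n) (R : CMod n VR →L[ℝ] CMod n VR) : Prop where
  rightLinear : IsRightLinear R
  right_inv : ∀ w, ∃ (h₁ : R w ∈ T.op.domain) (h₂ : T.op ⟨R w, h₁⟩ ∈ T.op.domain),
    T.Q s ⟨R w, h₁⟩ h₂ = w
  left_inv : ∀ (v : T.op.domain) (hv : T.op v ∈ T.op.domain), R (T.Q s v hv) = v

/-- The `S`-resolvent set. -/
def resolventSet (T : ClosedOp n VR) : Set (Cl n) := {s | s ∈ paravectors n ∧ ∃ R, T.IsQInv s R}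

/-- The `S`-spectrum. -/
def spectrum (T : ClosedOp n VR) : Set (Cl n) := paravectors n \ T.resolventSet

/-- `Q_s[T]⁻¹` for `s ∈ ρ_S(T)`. -/
def Qinv (T : ClosedOp n VR) {s : Cl n} (hs : s ∈ T.resolventSet) : CMod n VR →L[ℝ] CMod n VR :=
  hs.2.choose

theorem isQInv_Qinv (T : ClosedOp n VR) {s : Cl n} (hs : s ∈ T.resolventSet) :
    T.IsQInv s (T.Qinv hs) := hs.2.choose_spec

theorem IsQInv.unique {T : ClosedOp n VR} {s : Cl n} {R R' : CMod n VR →L[ℝ] CMod n VR}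
    (h : T.IsQInv s R) (h' : T.IsQInv s R') : R = R' := by
  ext1 w
  obtain ⟨h₁, h₂, e⟩ := h'.right_inv w
  have := h.left_inv ⟨R' w, h₁⟩ h₂
  rwa [e] at this

theorem Qinv_mem (T : ClosedOp n VR) {s : Cl n} (hs : s ∈ T.resolventSet) (w : CMod n VR) :
    T.Qinv hs w ∈ T.op.domain := ((T.isQInv_Qinv hs).right_inv w).1

variable [CompleteSpace VR]

/-- The everywhere defined operator `T Q_s[T]⁻¹`, which is bounded by the closed graph theorem. -/
def TQinv (T : ClosedOp n VR) {s : Cl n} (hs : s ∈ T.resolventSet) :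
    CMod n VR →L[ℝ] CMod n VR :=
  ContinuousLinearMap.ofIsClosedGraph
    (g := T.op.toFun ∘ₗ (T.Qinv hs : CMod n VR →ₗ[ℝ] CMod n VR).codRestrict T.op.domain
      (T.Qinv_mem hs)) <| by
    have h : IsClosed ((fun p : CMod n VR × CMod n VR => (T.Qinv hs p.1, p.2)) ⁻¹'
        (T.op.graph : Set (CMod n VR × CMod n VR))) :=
      IsClosed.preimage (by fun_prop) T.closed
    convert h using 1
    ext ⟨v, w⟩
    simp only [SetLike.mem_coe, LinearMap.mem_graph_iff, mem_preimage, LinearPMap.mem_graph_iff]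
    constructor
    · intro e; exact ⟨⟨T.Qinv hs v, T.Qinv_mem hs v⟩, rfl, e.symm⟩
    · rintro ⟨y, hy, rfl⟩
      obtain rfl : y = ⟨T.Qinv hs v, T.Qinv_mem hs v⟩ := Subtype.ext hy
      rfl

theorem TQinv_apply (T : ClosedOp n VR) {s : Cl n} (hs : s ∈ T.resolventSet) (v : CMod n VR) :
    T.TQinv hs v = T.op ⟨T.Qinv hs v, T.Qinv_mem hs v⟩ := rfl

open Classical in
/-- The left `S`-resolvent operator `S_L⁻¹(s,T) = Q_s[T]⁻¹ s̄ - T Q_s[T]⁻¹` for `s ∈ ρ_S(T)`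
(and `0` by convention elsewhere). -/
def SL (T : ClosedOp n VR) (s : Cl n) : CMod n VR →L[ℝ] CMod n VR :=
  if hs : s ∈ T.resolventSet then T.Qinv hs ∘L lmul (conj s) - T.TQinv hs else 0

/-- Bisectorial operators of angle `ω`. -/
structure IsBisectorial (T : ClosedOp n VR) (ω : ℝ) : Prop where
  spectrum_subset : T.spectrum ⊆ closure (doubleSector n ω)
  norm_SL_le : ∀ φ ∈ Ioo ω (Real.pi / 2), ∃ C : ℝ, 0 ≤ C ∧
    ∀ s ∈ paravectors n \ (doubleSector n φ ∪ {0}), ‖T.SL s‖ ≤ C / ‖s‖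

/-! ### The `ω`-functional calculus -/

/-- The integrand `S_L⁻¹(γ(t),T) (γ'(t) / J) f(γ(t))` of a path integral
`∫_γ S_L⁻¹(s,T) ds_J f(s)`, where `1 / J = -J`. -/
def pathIntegrand (T : ClosedOp n VR) (J : Cl n) (γ : ℝ → Cl n) (f : Cl n → Cl n) (t : ℝ) :
    CMod n VR →L[ℝ] CMod n VR :=
  T.SL (γ t) ∘L lmul (deriv γ t * (-J) * f (γ t))

/-- `A = f(T)`, i.e. `A ∈ 𝓑(V)` and, for every `φ ∈ (ω,θ)` and `J ∈ 𝕊`, the integral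
`(1/2π) ∫_{∂D_φ ∩ ℂ_J} S_L⁻¹(s,T) ds_J f(s)` converges absolutely and has the value `A`. -/
structure IsOmegaCalculus (T : ClosedOp n VR) (ω θ : ℝ) (f : Cl n → Cl n)
    (A : CMod n VR →L[ℝ] CMod n VR) : Prop where
  rightLinear : IsRightLinear A
  integrable : ∀ φ ∈ Ioo ω θ, ∀ J ∈ imagSphere n, ∀ ε ∈ ({1, -1} : Set ℝ),
    Integrable (T.pathIntegrand J (boundaryCurve J φ ε) f)
  eq_integral : ∀ φ ∈ Ioo ω θ, ∀ J ∈ imagSphere n,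
    A = (1 / (2 * Real.pi)) •
      ((∫ t, T.pathIntegrand J (boundaryCurve J φ 1) f t) +
        ∫ t, T.pathIntegrand J (boundaryCurve J φ (-1)) f t)

/-- The operator `f(T)` is unique. -/
theorem IsOmegaCalculus.unique {T : ClosedOp n VR} {ω θ : ℝ} {f : Cl n → Cl n}
    {A B : CMod n VR →L[ℝ] CMod n VR} (hn : 1 ≤ n) (h : ω < θ)
    (hA : T.IsOmegaCalculus ω θ f A) (hB : T.IsOmegaCalculus ω θ f B) : A = B := by
  obtain ⟨φ, hφ⟩ := exists_between h
  have hJ := unitVec_mem_imagSphere (⟨0, hn⟩ : Fin n)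
  rw [hA.eq_integral φ hφ _ hJ, hB.eq_integral φ hφ _ hJ]

end ClosedOp

end CliffordCalculus

end

noncomputable section

namespace CliffordCalculus

/-! ### Contour integrals in logarithmic coordinates -/

open Complex (I exp sinh cosh)

/-! Write `s = x + J y` and `z = x + i y`. The operators `R = Q_s[T]⁻¹` and `P = T Q_s[T]⁻¹` depend
on `s` only through `x` and `|s|`, and those at different points commute. Formally `z̄ R - P` is the
resolvent `(z - T)⁻¹`, since `Q_s[T] = (z - T)(z̄ - T)`. To avoid complexifying `V`, this resolvent
is used only through its matrix coefficients `z̄ ℓ(R v) - ℓ(P v)` for real functionals `ℓ`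
(`resCoeff`). They satisfy the classical resolvent equation (`resCoeff_sub`), so they are
holomorphic off the closed double sector, and the bisectorial estimate makes them `O(1/|z|)` outside
larger sectors (`exists_norm_le`).

In the path integral the contributions of `s` and `s̄` combine so that `J` disappears
(`SL_comp_lmul_sub`). Let `f_A` be the coefficient of `f₀ + i f₁` at `e_A`, a holomorphic function
symmetric under conjugation. Then `f(T) = ∑_A f_A(T) e_A`, where `f_A(T)` is an ordinary holomorphic
calculus (`isOmegaCalculus`). An intrinsic `g` has a single component, and `(gf)_A = g f_A`. Since
`g(T)` stands on the left, no `e_A` has to be moved past an operator, and the theorem reduces to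
`g(T) f_A(T) = (g f_A)(T)`.

That identity is the usual double integral argument (`intrinsicCalc_comp`, `ctr_resolvent`). With
contours at angles `φ₁ < φ₂`, the resolvent equation splits the product of resolvents. The Cauchy
integral of `f_A` over the outer contour reproduces its value at an inner point. After Fubini, the
Cauchy integral of `g` over the inner contour vanishes at an outer point.

The contours are unbounded and run into `0`, and the functions are merely bounded, and integrable
along rays. Cauchy's theorem and formula are therefore proved in the coordinate `z = ± e^u`: the
double sector becomes two horizontal strips, `dz/z` becomes `du`, and the contour consists of the
edges of the strips (`integral_hline_eq`, `cauchy_formula_strip`, `ctr_div_eq`). -/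

theorem integral_exp_smul {E : Type*} [NormedAddCommGroup E] [NormedSpace ℝ E] (g : ℝ → E) :
    ∫ τ, Real.exp τ • g (Real.exp τ) = ∫ t in Ioi 0, g t := by
  have := integral_image_eq_integral_abs_deriv_smul (f := Real.exp) (f' := Real.exp) (s := univ)
    MeasurableSet.univ (fun x _ => (Real.hasDerivAt_exp x).hasDerivWithinAt)
    Real.exp_injective.injOn g
  rw [image_univ, Real.range_exp] at this
  simpa using this.symm

theorem integrable_exp_smul_iff {E : Type*} [NormedAddCommGroup E] [NormedSpace ℝ E] (g : ℝ → E) :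
    Integrable (fun τ => Real.exp τ • g (Real.exp τ)) ↔ IntegrableOn g (Ioi 0) := by
  have := integrableOn_image_iff_integrableOn_abs_deriv_smul (f := Real.exp) (f' := Real.exp)
    (s := univ) MeasurableSet.univ (fun x _ => (Real.hasDerivAt_exp x).hasDerivWithinAt)
    Real.exp_injective.injOn g
  rw [image_univ, Real.range_exp] at this
  simpa using this.symm

/-- Under `t = e^τ` the arctangent density `2 dt / (1 + t²)` turns into `dτ / cosh τ`; this is where
the total mass `π` comes from. -/
theorem exp_smul_inv_one_add_sq (τ : ℝ) :
    Real.exp τ • (2 * (1 + Real.exp τ ^ 2)⁻¹) = (Real.cosh τ)⁻¹ := by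
  have h := Real.exp_pos τ
  rw [Real.cosh_eq, Real.exp_neg, smul_eq_mul]
  field_simp
  ring

theorem integrable_inv_cosh : Integrable (fun τ : ℝ => (Real.cosh τ)⁻¹) := by
  simp_rw [← exp_smul_inv_one_add_sq]
  rw [integrable_exp_smul_iff (fun t : ℝ => 2 * (1 + t ^ 2)⁻¹)]
  exact (integrable_inv_one_add_sq.const_mul 2).integrableOn

theorem integral_inv_cosh : ∫ τ : ℝ, (Real.cosh τ)⁻¹ = Real.pi := by
  simp_rw [← exp_smul_inv_one_add_sq]
  rw [integral_exp_smul (fun t : ℝ => 2 * (1 + t ^ 2)⁻¹), integral_const_mul,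
    integral_Ioi_inv_one_add_sq]
  simp [mul_div_cancel₀]

/-- The horizontal line at height `b`. -/
def hline (b τ : ℝ) : ℂ := τ + b * I

@[simp] theorem hline_re (b τ : ℝ) : (hline b τ).re = τ := by simp [hline]
@[simp] theorem hline_im (b τ : ℝ) : (hline b τ).im = b := by simp [hline]

@[fun_prop] theorem continuous_hline (b : ℝ) : Continuous (hline b) := by
  unfold hline; fun_prop

/-- The closed horizontal strip between the heights `a` and `b`. -/
def strip (a b : ℝ) : Set ℂ := {u | u.im ∈ uIcc a b}

theorem hline_mem_strip_left (a b τ : ℝ) : hline a τ ∈ strip a b := by simp [strip]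
theorem hline_mem_strip_right (a b τ : ℝ) : hline b τ ∈ strip a b := by simp [strip]

theorem integrable_of_bound_hline {H : ℂ → ℂ} {a b C : ℝ} (hc : ContinuousOn H (strip a b))
    (g : ℝ → ℝ) (hg : Integrable g) (h : ∀ τ, ‖H (hline a τ)‖ ≤ C * g τ) :
    Integrable fun τ => H (hline a τ) := by
  refine (hg.const_mul C).mono' ?_ (Filter.Eventually.of_forall h)
  exact (hc.comp_continuous (continuous_hline a)
    (hline_mem_strip_left a b)).aestronglyMeasurable

theorem norm_exp_neg_mul_sq (ε : ℝ) (u : ℂ) :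
    ‖exp (-ε * u ^ 2)‖ = Real.exp (-ε * u.re ^ 2) * Real.exp (ε * u.im ^ 2) := by
  rw [Complex.norm_exp, ← Real.exp_add]
  congr 1
  simp [pow_two]
  ring

/-- Horizontal line integrals of a bounded holomorphic function on a strip do not depend on
the line, in the presence of a Gaussian factor. -/
theorem integral_hline_gaussian {H : ℂ → ℂ} {a b C ε : ℝ} (hε : 0 < ε)
    (hd : DifferentiableOn ℂ H (strip a b)) (hb : ∀ u ∈ strip a b, ‖H u‖ ≤ C) :
    ∫ τ, exp (-ε * hline a τ ^ 2) * H (hline a τ) =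
      ∫ τ, exp (-ε * hline b τ ^ 2) * H (hline b τ) := by
  set G : ℂ → ℂ := fun u => exp (-ε * u ^ 2) * H u with hG
  have hC : 0 ≤ C := (norm_nonneg _).trans (hb _ (hline_mem_strip_left a b 0))
  -- On the strip `|e^{-εu²}| = e^{-εx²} e^{εy²}`, and the second factor is at most its value at the
  -- larger edge height.
  set K : ℝ := C * Real.exp (ε * max |a| |b| ^ 2) with hK
  have hGd : DifferentiableOn ℂ G (strip a b) := DifferentiableOn.mul (by fun_prop) hd
  have him : ∀ y ∈ uIcc a b, y ^ 2 ≤ max |a| |b| ^ 2 := fun y hy => by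
    rw [← sq_abs]
    refine pow_le_pow_left₀ (abs_nonneg _) ?_ 2
    rcases le_total a b with h | h
    · rw [uIcc_of_le h] at hy; exact abs_le_max_abs_abs hy.1 hy.2
    · rw [uIcc_of_ge h] at hy; rw [max_comm]; exact abs_le_max_abs_abs hy.1 hy.2
  have hGb : ∀ u ∈ strip a b, ‖G u‖ ≤ K * Real.exp (-ε * u.re ^ 2) := fun u hu => by
    rw [hG, norm_mul, norm_exp_neg_mul_sq, hK]
    have h1 : Real.exp (ε * u.im ^ 2) ≤ Real.exp (ε * max |a| |b| ^ 2) := by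
      exact Real.exp_le_exp.2 (mul_le_mul_of_nonneg_left (him _ hu) hε.le)
    calc _ = Real.exp (-ε * u.re ^ 2) * (Real.exp (ε * u.im ^ 2) * ‖H u‖) := by ring
      _ ≤ Real.exp (-ε * u.re ^ 2) * (Real.exp (ε * max |a| |b| ^ 2) * C) := by
        gcongr; exact hb u hu
      _ = _ := by ring
  have hgi := integrable_exp_neg_mul_sq hε
  have hia : Integrable fun τ => G (hline a τ) :=
    integrable_of_bound_hline hGd.continuousOn _ hgi fun τ => by
      simpa using hGb _ (hline_mem_strip_left a b τ)
  have hib : Integrable fun τ => G (hline b τ) :=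
    integrable_of_bound_hline (b := a) (by
      have := hGd.continuousOn; rwa [strip, uIcc_comm] at this) _ hgi fun τ => by
        simpa using hGb _ (hline_mem_strip_right a b τ)
  -- `s = ± 1` selects the right or the left vertical side of the rectangle; the Gaussian kills both
  -- as `R → ∞`.
  have hdecay : ∀ s : ℝ, s ^ 2 = 1 → Filter.Tendsto
      (fun R : ℝ => ∫ y in a..b, G ((s * R : ℝ) + y * I)) Filter.atTop (nhds 0) := by
    intro s hs
    have h0 : Filter.Tendsto (fun R : ℝ => K * Real.exp (-ε * R ^ 2) * |b - a|) Filter.atTop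
        (nhds 0) := by
      have : Filter.Tendsto (fun R : ℝ => Real.exp (-ε * R ^ 2)) Filter.atTop (nhds 0) := by
        refine Real.tendsto_exp_atBot.comp ?_
        exact (Filter.tendsto_pow_atTop two_ne_zero).const_mul_atTop_of_neg (by linarith)
      simpa using (this.const_mul K).mul_const |b - a|
    refine squeeze_zero_norm (fun R => ?_) h0
    refine intervalIntegral.norm_integral_le_of_norm_le_const fun y hy => ?_
    have hmem : ((s * R : ℝ) + y * I : ℂ) ∈ strip a b := by
      simpa [strip] using uIoc_subset_uIcc hy
    have := hGb _ hmem
    have e : ((s * R : ℝ) + y * I : ℂ).re = s * R := by simp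
    rw [e, mul_pow, hs, one_mul] at this
    exact this
  have hrect : ∀ R : ℝ, (∫ x in (-R)..R, G (hline a x)) - (∫ x in (-R)..R, G (hline b x)) +
      I • (∫ y in a..b, G ((1 * R : ℝ) + y * I)) - I • (∫ y in a..b, G (((-1) * R : ℝ) + y * I))
        = 0 := by
    intro R
    have := Complex.integral_boundary_rect_eq_zero_of_differentiableOn G ⟨-R, a⟩ ⟨R, b⟩
      (hGd.mono fun u hu => hu.2)
    simpa [hline] using this
  have l1 := intervalIntegral_tendsto_integral hia Filter.tendsto_neg_atTop_atBot Filter.tendsto_id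
  have l2 := intervalIntegral_tendsto_integral hib Filter.tendsto_neg_atTop_atBot Filter.tendsto_id
  have l3 := ((l1.sub l2).add ((hdecay 1 (by norm_num)).const_smul I)).sub
    ((hdecay (-1) (by norm_num)).const_smul I)
  have l4 := tendsto_nhds_unique (l3.congr hrect) tendsto_const_nhds
  simpa only [smul_zero, add_zero, sub_zero, sub_eq_zero] using l4

/-- Horizontal line integrals of a bounded holomorphic function on a strip agree on any two lines
on which the function is integrable. -/
theorem integral_hline_eq {H : ℂ → ℂ} {a b C : ℝ}
    (hd : DifferentiableOn ℂ H (strip a b)) (hb : ∀ u ∈ strip a b, ‖H u‖ ≤ C)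
    (hia : Integrable fun τ => H (hline a τ)) (hib : Integrable fun τ => H (hline b τ)) :
    ∫ τ, H (hline a τ) = ∫ τ, H (hline b τ) := by
  -- The Gaussian factor is removed by dominated convergence: for `0 < ε < 1` its modulus on the
  -- line at height `c` is at most `e^{c²}`.
  have key : ∀ c : ℝ, Integrable (fun τ => H (hline c τ)) →
      Filter.Tendsto (fun ε : ℝ => ∫ τ, exp (-ε * hline c τ ^ 2) * H (hline c τ))
        (nhdsWithin 0 (Ioi 0)) (nhds (∫ τ, H (hline c τ))) := by
    intro c hc
    refine tendsto_integral_filter_of_dominated_convergence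
      (fun τ => Real.exp (c ^ 2) * ‖H (hline c τ)‖) ?_ ?_ (hc.norm.const_mul _) ?_
    · refine Filter.Eventually.of_forall fun ε => AEStronglyMeasurable.mul ?_ hc.1
      exact (by fun_prop : Continuous fun τ => exp (-ε * hline c τ ^ 2)).aestronglyMeasurable
    · filter_upwards [Ioo_mem_nhdsGT (zero_lt_one' ℝ)] with ε hε
      refine Filter.Eventually.of_forall fun τ => ?_
      rw [norm_mul, norm_exp_neg_mul_sq]
      gcongr
      rw [← Real.exp_add, Real.exp_le_exp, hline_re, hline_im]
      nlinarith [sq_nonneg τ, sq_nonneg c, hε.1, hε.2, mul_nonneg hε.1.le (sq_nonneg τ),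
        mul_nonneg (sub_nonneg.2 hε.2.le) (sq_nonneg c)]
    · refine Filter.Eventually.of_forall fun τ => ?_
      have : ContinuousAt (fun ε : ℝ => exp (-ε * hline c τ ^ 2) * H (hline c τ)) 0 := by
        fun_prop
      have h2 := this.tendsto
      simp only [Complex.ofReal_zero, neg_zero, zero_mul, Complex.exp_zero, one_mul] at h2
      exact h2.mono_left nhdsWithin_le_nhds
  refine tendsto_nhds_unique (key a hia) ((key b hib).congr' ?_)
  filter_upwards [self_mem_nhdsWithin] with ε hε
  exact (integral_hline_gaussian hε hd hb).symm

end CliffordCalculus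

namespace CliffordCalculus

/-! ### The kernel `1 / sinh` and the Cauchy formula on a strip -/

open Complex (I exp sinh cosh)

theorem sinh_im (u : ℂ) : (sinh u).im = Real.cosh u.re * Real.sin u.im := by
  conv_lhs => rw [← Complex.re_add_im u, Complex.sinh_add, Complex.sinh_mul_I, Complex.cosh_mul_I]
  simp [Complex.sinh_ofReal_re, Complex.cosh_ofReal_re, Complex.sin_ofReal_re,
    Complex.cos_ofReal_re]

theorem sinh_re (u : ℂ) : (sinh u).re = Real.sinh u.re * Real.cos u.im := by
  conv_lhs => rw [← Complex.re_add_im u, Complex.sinh_add, Complex.sinh_mul_I, Complex.cosh_mul_I]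
  simp [Complex.sinh_ofReal_re, Complex.cosh_ofReal_re, Complex.sin_ofReal_re,
    Complex.cos_ofReal_re]

theorem cosh_mul_abs_sin_le_norm_sinh (u : ℂ) :
    Real.cosh u.re * |Real.sin u.im| ≤ ‖sinh u‖ := by
  rw [← abs_of_pos (Real.cosh_pos u.re), ← abs_mul, ← sinh_im]
  exact Complex.abs_im_le_norm _

/-- `|sinh u|² = sinh² x + sin² y`. In contrast to the previous bound, this one stays useful at
heights where `sin y` vanishes, provided that `x` is away from `0`. -/
theorem abs_sinh_re_le_norm_sinh (u : ℂ) : |Real.sinh u.re| ≤ ‖sinh u‖ := by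
  refine abs_le_of_sq_le_sq ?_ (norm_nonneg _)
  rw [Complex.sq_norm, Complex.normSq_apply, sinh_re, sinh_im]
  nlinarith [Real.sin_sq_add_cos_sq u.im, Real.cosh_sq u.re, sq_nonneg (Real.sin u.im),
    sq_nonneg (Real.sinh u.re)]

theorem sinh_ne_zero {u : ℂ} (h : |u.im| < Real.pi) (hu : u ≠ 0) : sinh u ≠ 0 := by
  intro h0
  have h1 := sinh_im u
  have h2 := sinh_re u
  rw [h0] at h1 h2
  have h3 : Real.sin u.im = 0 := by
    simpa [(Real.cosh_pos u.re).ne'] using h1.symm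
  have h4 : u.im = 0 := (Real.sin_eq_zero_iff_of_lt_of_lt (abs_lt.1 h).1 (abs_lt.1 h).2).1 h3
  rw [h4] at h2
  have h5 : u.re = 0 := by simpa using h2.symm
  exact hu (Complex.ext h5 h4)

theorem norm_inv_sinh_hline_le {b : ℝ} (hb : Real.sin b ≠ 0) (τ : ℝ) :
    ‖(sinh (hline b τ))⁻¹‖ ≤ |Real.sin b|⁻¹ * (Real.cosh τ)⁻¹ := by
  rw [norm_inv, ← mul_inv, mul_comm]
  refine inv_anti₀ (mul_pos (Real.cosh_pos _) (abs_pos.2 hb)) ?_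
  simpa using cosh_mul_abs_sin_le_norm_sinh (hline b τ)

theorem sinh_hline_ne_zero {b : ℝ} (hb : Real.sin b ≠ 0) (τ : ℝ) : sinh (hline b τ) ≠ 0 := by
  intro h
  have := sinh_im (hline b τ)
  rw [h] at this
  simp [(Real.cosh_pos τ).ne', hb] at this

theorem integrable_inv_sinh_hline {b : ℝ} (hb : Real.sin b ≠ 0) :
    Integrable fun τ => (sinh (hline b τ))⁻¹ := by
  refine (integrable_inv_cosh.const_mul |Real.sin b|⁻¹).mono' ?_
    (Filter.Eventually.of_forall (norm_inv_sinh_hline_le hb))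
  exact (Continuous.inv₀ (by fun_prop) (sinh_hline_ne_zero hb)).aestronglyMeasurable

/-- The line may be moved to height `π/2`, where `sinh (τ + iπ/2) = i cosh τ`. -/
theorem integral_inv_sinh_hline {b : ℝ} (h0 : 0 < b) (hπ : b < Real.pi) :
    ∫ τ, (sinh (hline b τ))⁻¹ = -(Real.pi * I) := by
  have hsub : ∀ y ∈ uIcc b (Real.pi / 2), 0 < y ∧ y < Real.pi := fun y hy => by
    rcases le_total b (Real.pi / 2) with h | h
    · rw [uIcc_of_le h] at hy; constructor <;> linarith [hy.1, hy.2]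
    · rw [uIcc_of_ge h] at hy; constructor <;> linarith [hy.1, hy.2, Real.pi_pos]
  have hne : ∀ u ∈ strip b (Real.pi / 2), sinh u ≠ 0 := fun u hu => by
    have := hsub _ hu
    refine sinh_ne_zero (abs_lt.2 ⟨by linarith, this.2⟩) fun h => ?_
    simp [h] at this
  -- A positive minimum of `sin` on the compact range of heights bounds `1 / sinh` on the whole
  -- strip, as `|sinh u| ≥ cosh x |sin y|`.
  obtain ⟨c, hc, hcb⟩ : ∃ c > 0, ∀ y ∈ uIcc b (Real.pi / 2), c ≤ Real.sin y := by
    obtain ⟨y0, hy0, hmin⟩ := (isCompact_uIcc (a := b) (b := Real.pi / 2)).exists_isMinOn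
      nonempty_uIcc Real.continuous_sin.continuousOn
    exact ⟨Real.sin y0, Real.sin_pos_of_pos_of_lt_pi (hsub _ hy0).1 (hsub _ hy0).2,
      fun y hy => hmin hy⟩
  have hs : Real.sin b ≠ 0 := (Real.sin_pos_of_pos_of_lt_pi h0 hπ).ne'
  have := integral_hline_eq (H := fun u => (sinh u)⁻¹) (a := b) (b := Real.pi / 2) (C := c⁻¹)
    (DifferentiableOn.inv (Complex.differentiable_sinh.differentiableOn) hne)
    (fun u hu => by
      rw [norm_inv]
      refine inv_anti₀ hc ((hcb _ hu).trans ?_)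
      have h1 := cosh_mul_abs_sin_le_norm_sinh u
      have h2 := Real.one_le_cosh u.re
      have h3 := le_abs_self (Real.sin u.im)
      nlinarith [abs_nonneg (Real.sin u.im)])
    (integrable_inv_sinh_hline hs) (integrable_inv_sinh_hline (by simp))
  rw [this]
  have e : ∀ τ : ℝ, (sinh (hline (Real.pi / 2) τ))⁻¹ = -I * ((Real.cosh τ)⁻¹ : ℝ) := fun τ => by
    have : sinh (hline (Real.pi / 2) τ) = Complex.cosh τ * I := by
      rw [hline, Complex.sinh_add]
      have h1 : ((Real.pi / 2 : ℝ) : ℂ) = (Real.pi : ℂ) / 2 := by push_cast; rfl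
      rw [Complex.sinh_mul_I, Complex.cosh_mul_I, h1]
      simp
    rw [this, mul_inv, Complex.inv_I]
    push_cast
    ring
  simp_rw [e]
  rw [integral_const_mul, integral_complex_ofReal, integral_inv_cosh]
  ring

/-- `sinh` is odd, so `τ ↦ -τ` reduces to positive heights. The jump `2πi` across height `0` is the
contribution of the pole at `0`. -/
theorem integral_inv_sinh_hline_neg {b : ℝ} (h0 : b < 0) (hπ : -Real.pi < b) :
    ∫ τ, (sinh (hline b τ))⁻¹ = Real.pi * I := by
  have h := integral_inv_sinh_hline (b := -b) (by linarith) (by linarith)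
  rw [← integral_neg_eq_self] at h
  have e : ∀ τ, (sinh (hline (-b) (-τ)))⁻¹ = -(sinh (hline b τ))⁻¹ := fun τ => by
    rw [← inv_neg, ← Complex.sinh_neg]
    congr 2
    simp [hline]; ring
  simp_rw [e] at h
  rw [integral_neg] at h
  exact neg_injective h

theorem hline_sub (b τ : ℝ) (v : ℂ) : hline b τ - v = hline (b - v.im) (τ - v.re) := by
  apply Complex.ext <;> simp

/-- The Cauchy formula for a horizontal strip, with kernel `1 / sinh`. -/
theorem cauchy_formula_strip {H : ℂ → ℂ} {φ C : ℝ} (hφ : φ < Real.pi / 2)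
    (hd : DifferentiableOn ℂ H (strip (-φ) φ)) (hb : ∀ u ∈ strip (-φ) φ, ‖H u‖ ≤ C) {v : ℂ}
    (hv : |v.im| < φ) :
    (∫ τ, H (hline (-φ) τ) * (sinh (hline (-φ) τ - v))⁻¹) -
      ∫ τ, H (hline φ τ) * (sinh (hline φ τ - v))⁻¹ = 2 * Real.pi * I * H v := by
  have hφ0 : 0 < φ := (abs_nonneg _).trans_lt hv
  obtain ⟨hv1, hv2⟩ := abs_lt.1 hv
  have hstrip : strip (-φ) φ = {u | u.im ∈ Icc (-φ) φ} := by
    rw [strip, uIcc_of_le (by linarith)]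
  have hnhds : strip (-φ) φ ∈ nhds v := by
    rw [hstrip]
    exact Complex.continuous_im.continuousAt.preimage_mem_nhds (Icc_mem_nhds hv1 hv2)
  have hvm : v ∈ strip (-φ) φ := mem_of_mem_nhds hnhds
  have hC : 0 ≤ C := (norm_nonneg _).trans (hb v hvm)
  have him : ∀ u ∈ strip (-φ) φ, |(u - v).im| < Real.pi := fun u hu => by
    rw [hstrip] at hu
    rw [Complex.sub_im, abs_lt]
    constructor <;> linarith [hu.1, hu.2]
  set S : ℂ → ℂ := fun u => sinh (u - v) with hS
  -- Away from `v` this is `(H u - H v) / sinh (u - v)`. As a quotient of two `dslope`s it is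
  -- holomorphic across `v` too, because `sinh (u - v)` has only a simple zero in the strip.
  set D : ℂ → ℂ := fun u => dslope H v u * (dslope S v u)⁻¹ with hD
  have hSv : S v = 0 := by simp [hS]
  have hD_eq : ∀ u, u ≠ v → D u = (H u - H v) * (sinh (u - v))⁻¹ := fun u hu => by
    have h1 : u - v ≠ 0 := sub_ne_zero.2 hu
    simp only [hD]
    rw [dslope_of_ne _ hu, dslope_of_ne _ hu, slope_def_field, slope_def_field, hSv, sub_zero]
    simp only [hS]
    rw [inv_div, div_mul_div_comm, mul_comm (u - v), mul_div_mul_right _ _ h1, div_eq_mul_inv]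
  have hSne : ∀ u ∈ strip (-φ) φ, dslope S v u ≠ 0 := fun u hu => by
    rcases eq_or_ne u v with rfl | h
    · rw [dslope_same]
      have : HasDerivAt S (Complex.cosh (u - u) * 1) u :=
        ((hasDerivAt_id u).sub_const u).csinh
      rw [this.deriv]; simp
    · rw [dslope_of_ne _ h, slope_def_field, hSv, sub_zero]
      exact div_ne_zero (sinh_ne_zero (him u hu) (sub_ne_zero.2 h)) (sub_ne_zero.2 h)
  have hDd : DifferentiableOn ℂ D (strip (-φ) φ) :=
    ((Complex.differentiableOn_dslope hnhds).2 hd).mul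
      (((Complex.differentiableOn_dslope hnhds).2 (by fun_prop)).inv hSne)
  -- Compactness bounds `D` within horizontal distance `1` of `v`; farther out `|sinh (u - v)| ≥
  -- sinh 1`.
  obtain ⟨K, hK⟩ : ∃ K, ∀ u ∈ strip (-φ) φ, ‖D u‖ ≤ K := by
    have hcomp : IsCompact (Icc (v.re - 1) (v.re + 1) ×ℂ Icc (-φ) φ) :=
      isCompact_Icc.reProdIm isCompact_Icc
    obtain ⟨K, hK⟩ := hcomp.exists_bound_of_continuousOn (f := D)
      (hDd.continuousOn.mono fun u hu => by rw [hstrip]; exact hu.2)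
    refine ⟨max K (2 * C * (Real.sinh 1)⁻¹), fun u hu => ?_⟩
    by_cases h : u.re ∈ Icc (v.re - 1) (v.re + 1)
    · exact (hK u ⟨h, by rw [hstrip] at hu; exact hu⟩).trans (le_max_left _ _)
    · refine le_trans ?_ (le_max_right _ _)
      have h1 : 1 ≤ |(u - v).re| := by
        rw [Complex.sub_re]
        by_contra! h2
        rw [abs_lt] at h2
        exact h ⟨by linarith, by linarith⟩
      have hne : u ≠ v := by
        rintro rfl; simp at h1; linarith
      have h2 : Real.sinh 1 ≤ ‖sinh (u - v)‖ := by
        refine le_trans ?_ (abs_sinh_re_le_norm_sinh _)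
        rw [Real.abs_sinh]
        exact Real.sinh_le_sinh.2 h1
      have h3 : 0 < Real.sinh 1 := Real.sinh_pos_iff.2 one_pos
      rw [hD_eq u hne, norm_mul, norm_inv]
      have h4 : ‖H u - H v‖ ≤ 2 * C := (norm_sub_le _ _).trans (by linarith [hb u hu, hb v hvm])
      exact mul_le_mul h4 (inv_anti₀ h3 h2) (by positivity) (by linarith)
  have hl : ∀ b, b ∈ Icc (-φ) φ → b ≠ v.im →
      Integrable (fun τ => H (hline b τ) * (sinh (hline b τ - v))⁻¹) ∧
      Integrable (fun τ => (sinh (hline b τ - v))⁻¹) ∧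
      (∀ τ, D (hline b τ) = H (hline b τ) * (sinh (hline b τ - v))⁻¹
        - H v * (sinh (hline b τ - v))⁻¹) := by
    intro b hbm hne
    have hsin : Real.sin (b - v.im) ≠ 0 := by
      intro h0
      have := him (hline b 0) (by rw [hstrip]; simpa using hbm)
      rw [Complex.sub_im, hline_im, abs_lt] at this
      exact hne (sub_eq_zero.1 ((Real.sin_eq_zero_iff_of_lt_of_lt this.1 this.2).1 h0))
    have h1 : Integrable (fun τ => (sinh (hline b τ - v))⁻¹) := by
      simp_rw [hline_sub]
      exact (integrable_inv_sinh_hline hsin).comp_sub_right v.re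
    refine ⟨h1.bdd_mul (c := C) ?_ (Filter.Eventually.of_forall fun τ => ?_), h1, fun τ => ?_⟩
    · exact (hd.continuousOn.comp_continuous (continuous_hline b)
        fun τ => by rw [hstrip]; simpa using hbm).aestronglyMeasurable
    · exact hb _ (by rw [hstrip]; simpa using hbm)
    · rw [hD_eq, sub_mul]
      intro h
      exact hne (by rw [← h, hline_im])
  obtain ⟨i1, j1, e1⟩ := hl (-φ) ⟨le_rfl, by linarith⟩ hv1.ne
  obtain ⟨i2, j2, e2⟩ := hl φ ⟨by linarith, le_rfl⟩ hv2.ne'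
  -- `D` has the same integral over both edges. Hence the edge integrals of `H / sinh` differ by `H
  -- v` times the difference of those of `1 / sinh`, which is `2πi`.
  have key := integral_hline_eq hDd hK (by simp_rw [e1]; exact i1.sub (j1.const_mul _))
    (by simp_rw [e2]; exact i2.sub (j2.const_mul _))
  simp_rw [e1, e2] at key
  rw [integral_sub i1 (j1.const_mul _), integral_sub i2 (j2.const_mul _), integral_const_mul,
    integral_const_mul] at key
  have v1 : ∫ τ, (sinh (hline (-φ) τ - v))⁻¹ = Real.pi * I := by
    simp_rw [hline_sub]
    rw [integral_sub_right_eq_self (fun τ => (sinh (hline (-φ - v.im) τ))⁻¹) v.re]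
    exact integral_inv_sinh_hline_neg (by linarith) (by linarith)
  have v2 : ∫ τ, (sinh (hline φ τ - v))⁻¹ = -(Real.pi * I) := by
    simp_rw [hline_sub]
    rw [integral_sub_right_eq_self (fun τ => (sinh (hline (φ - v.im) τ))⁻¹) v.re]
    exact integral_inv_sinh_hline (by linarith) (by linarith)
  rw [v1, v2] at key
  linear_combination key

end CliffordCalculus

namespace CliffordCalculus

/-! ### Double sectors, boundary rays and contour integrals in the coordinate `z = ± e^u` -/

open Complex (I exp sinh cosh)

/-- The sign `1` or `-1`. -/
def sg (b : Bool) : ℝ := if b then 1 else -1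

@[simp] theorem sg_true : sg true = 1 := rfl
@[simp] theorem sg_false : sg false = -1 := rfl
@[simp] theorem abs_sg (b : Bool) : |sg b| = 1 := by cases b <;> simp
theorem sg_mul_self (b : Bool) : sg b * sg b = 1 := by cases b <;> simp
@[simp] theorem sg_ne_zero (b : Bool) : sg b ≠ 0 := by cases b <;> simp

/-- The open double sector of half-angle `θ` in the complex plane. -/
def cSector (θ : ℝ) : Set ℂ := {z | |z.im| * Real.cos θ < |z.re| * Real.sin θ}

/-- The complement of the closed double sector of half-angle `ω` in the complex plane. -/
def cExt (ω : ℝ) : Set ℂ := {z | |z.re| * Real.sin ω < |z.im| * Real.cos ω}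

theorem isOpen_cSector (θ : ℝ) : IsOpen (cSector θ) :=
  isOpen_lt (by fun_prop) (by fun_prop)

theorem isOpen_cExt (ω : ℝ) : IsOpen (cExt ω) :=
  isOpen_lt (by fun_prop) (by fun_prop)

/-- The point `± e^u`. -/
def pt (ε : Bool) (u : ℂ) : ℂ := sg ε * exp u

@[fun_prop] theorem differentiable_pt (ε : Bool) : Differentiable ℂ (pt ε) := by
  unfold pt; fun_prop

@[fun_prop] theorem continuous_pt (ε : Bool) : Continuous (pt ε) := (differentiable_pt ε).continuous

theorem pt_ne_zero (ε : Bool) (u : ℂ) : pt ε u ≠ 0 :=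
  mul_ne_zero (by simp) (Complex.exp_ne_zero u)

theorem norm_pt (ε : Bool) (u : ℂ) : ‖pt ε u‖ = Real.exp u.re := by
  rw [pt, norm_mul, Complex.norm_real, Real.norm_eq_abs, abs_sg, one_mul, Complex.norm_exp]

theorem pt_re (ε : Bool) (u : ℂ) : (pt ε u).re = sg ε * (Real.exp u.re * Real.cos u.im) := by
  simp [pt, Complex.exp_re]

theorem pt_im (ε : Bool) (u : ℂ) : (pt ε u).im = sg ε * (Real.exp u.re * Real.sin u.im) := by
  simp [pt, Complex.exp_im]

theorem abs_pt_re (ε : Bool) {u : ℂ} (hu : |u.im| < Real.pi / 2) :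
    |(pt ε u).re| = Real.exp u.re * Real.cos |u.im| := by
  rw [pt_re, abs_mul, abs_sg, one_mul, abs_mul, Real.abs_exp, Real.cos_abs, abs_of_pos]
  exact Real.cos_pos_of_mem_Ioo (abs_lt.1 hu)

theorem abs_pt_im (ε : Bool) {u : ℂ} (hu : |u.im| < Real.pi / 2) :
    |(pt ε u).im| = Real.exp u.re * Real.sin |u.im| := by
  rw [pt_im, abs_mul, abs_sg, one_mul, abs_mul, Real.abs_exp]
  congr 1
  have h := abs_lt.1 hu
  rcases le_total 0 u.im with h0 | h0
  · rw [abs_of_nonneg h0, abs_of_nonneg]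
    exact Real.sin_nonneg_of_nonneg_of_le_pi h0 (by linarith [h.2, Real.pi_pos])
  · rw [abs_of_nonpos h0, abs_of_nonpos, Real.sin_neg]
    exact Real.sin_nonpos_of_nonpos_of_neg_pi_le h0 (by linarith [h.1, Real.pi_pos])

theorem pt_mem_cSector (ε : Bool) {u : ℂ} {θ : ℝ} (hu : |u.im| < θ) (hθ : θ < Real.pi / 2) :
    pt ε u ∈ cSector θ := by
  rw [cSector, mem_ofPred_eq, abs_pt_re ε (hu.trans hθ), abs_pt_im ε (hu.trans hθ)]
  have := Real.sin_pos_of_pos_of_lt_pi (sub_pos.2 hu)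
    (by linarith [abs_nonneg u.im, Real.pi_pos])
  rw [Real.sin_sub] at this
  nlinarith [Real.exp_pos u.re]

theorem pt_mem_cExt (ε : Bool) {u : ℂ} {ω : ℝ} (h0 : 0 ≤ ω) (hu : ω < |u.im|)
    (hu2 : |u.im| < Real.pi / 2) : pt ε u ∈ cExt ω := by
  rw [cExt, mem_ofPred_eq, abs_pt_re ε hu2, abs_pt_im ε hu2]
  have := Real.sin_pos_of_pos_of_lt_pi (sub_pos.2 hu) (by linarith [Real.pi_pos])
  rw [Real.sin_sub] at this
  nlinarith [Real.exp_pos u.re]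

theorem conj_pt (ε : Bool) (b τ : ℝ) :
    (starRingEnd ℂ) (pt ε (hline b τ)) = pt ε (hline (-b) τ) := by
  rw [pt, map_mul, Complex.conj_ofReal, ← Complex.exp_conj, pt]
  congr 2
  simp [hline]

/-- The reverse triangle inequality for `sin α cos β` and `cos α sin β`, both cosines being
positive. -/
theorem sin_abs_sub_le (α β : ℝ) (hα : |α| < Real.pi / 2) (hβ : |β| < Real.pi / 2) :
    Real.sin (|β| - |α|) ≤ |Real.sin (α - β)| := by
  have hcα := Real.cos_pos_of_mem_Ioo (abs_lt.1 hα)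
  have hcβ := Real.cos_pos_of_mem_Ioo (abs_lt.1 hβ)
  have hs : ∀ x : ℝ, |x| < Real.pi / 2 → Real.sin |x| = |Real.sin x| := fun x hx => by
    have := abs_pt_im true (u := hline x 0) (by simpa using hx)
    rw [pt_im] at this
    simpa using this.symm
  rw [Real.sin_sub, Real.sin_sub, Real.cos_abs, Real.cos_abs, hs α hα, hs β hβ]
  have e1 : |Real.sin β| * Real.cos α = |Real.cos α * Real.sin β| := by
    rw [abs_mul, abs_of_pos hcα, mul_comm]
  have e2 : Real.cos β * |Real.sin α| = |Real.sin α * Real.cos β| := by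
    rw [abs_mul, abs_of_pos hcβ, mul_comm]
  rw [e1, e2, abs_sub_comm]
  exact abs_sub_abs_le_abs_sub _ _

/-- The left side is the distance from `± e^u` to the real line through `0` and `± e^v`. Rotation by
`e^{-i Im v}` makes that line the real axis, and the distance becomes the modulus of an imaginary
part. -/
theorem norm_pt_mul_abs_sin_le (ε ε' : Bool) (u v : ℂ) :
    ‖pt ε u‖ * |Real.sin (u.im - v.im)| ≤ ‖pt ε u - pt ε' v‖ := by
  have h : ((pt ε u - pt ε' v) * exp (-(v.im : ℂ) * I)).im
      = sg ε * (Real.exp u.re * Real.sin (u.im - v.im)) := by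
    have e : (pt ε u - pt ε' v) * exp (-(v.im : ℂ) * I)
        = sg ε * exp (u - v.im * I) - sg ε' * exp (v - v.im * I) := by
      rw [pt, pt, sub_mul, mul_assoc, mul_assoc, ← Complex.exp_add, ← Complex.exp_add]
      congr 3 <;> ring_nf
    rw [e]
    simp [Complex.exp_im]
  have h2 : ‖exp (-(v.im : ℂ) * I)‖ = 1 := by
    rw [← Complex.ofReal_neg, Complex.norm_exp_ofReal_mul_I]
  calc _ = |((pt ε u - pt ε' v) * exp (-(v.im : ℂ) * I)).im| := by
        rw [h, abs_mul, abs_sg, one_mul, abs_mul, Real.abs_exp, norm_pt]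
    _ ≤ ‖(pt ε u - pt ε' v) * exp (-(v.im : ℂ) * I)‖ := Complex.abs_im_le_norm _
    _ = _ := by rw [norm_mul, h2, mul_one]

/-- Two points of the double sector at different angles to the real axis are apart. -/
theorem norm_pt_mul_sin_le (ε ε' : Bool) {u v : ℂ} {α β : ℝ} (hα : |u.im| ≤ α) (h : α ≤ β)
    (hβ : β ≤ |v.im|) (hv : |v.im| < Real.pi / 2) :
    ‖pt ε u‖ * Real.sin (β - α) ≤ ‖pt ε u - pt ε' v‖ ∧
      ‖pt ε' v‖ * Real.sin (β - α) ≤ ‖pt ε u - pt ε' v‖ := by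
  have h0 := abs_nonneg u.im
  have h1 : Real.sin (β - α) ≤ |Real.sin (u.im - v.im)| := by
    refine le_trans ?_ (sin_abs_sub_le _ _ (by linarith) hv)
    exact Real.sin_le_sin_of_le_of_le_pi_div_two (by linarith) (by linarith) (by linarith)
  constructor
  · exact (mul_le_mul_of_nonneg_left h1 (norm_nonneg _)).trans (norm_pt_mul_abs_sin_le ε ε' u v)
  · rw [norm_sub_rev]
    refine (mul_le_mul_of_nonneg_left h1 (norm_nonneg _)).trans ?_
    rw [← abs_neg, ← Real.sin_neg, neg_sub]
    exact norm_pt_mul_abs_sin_le ε' ε v u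

/-- Bounded holomorphic functions on the double sector which are real on the real axis and
integrable with respect to `dt / t` along rays. -/
structure HoloDecay (θ : ℝ) (h : ℂ → ℂ) : Prop where
  diff : DifferentiableOn ℂ h (cSector θ)
  bdd : ∃ C, ∀ z ∈ cSector θ, ‖h z‖ ≤ C
  int : ∀ ε φ, |φ| < θ → Integrable fun τ => h (pt ε (hline φ τ))
  symm : ∀ z ∈ cSector θ, h ((starRingEnd ℂ) z) = (starRingEnd ℂ) (h z)

/-- The four rays bounding the double sector of half-angle `φ`, in logarithmic coordinates. -/
def ray (p : Bool × Bool) (φ τ : ℝ) : ℂ := pt p.1 (hline (-(sg p.2) * φ) τ)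

theorem continuous_ray (p : Bool × Bool) (φ : ℝ) : Continuous (ray p φ) :=
  (continuous_pt _).comp (continuous_hline _)

theorem ray_ne_zero (p : Bool × Bool) (φ τ : ℝ) : ray p φ τ ≠ 0 := pt_ne_zero _ _

theorem abs_neg_sg_mul (b : Bool) {φ : ℝ} (h : 0 < φ) : |-(sg b) * φ| = φ := by
  rw [abs_mul, abs_neg, abs_sg, one_mul, abs_of_pos h]

/-- `(2πi)⁻¹ ∫ k(z) dz` over the positively oriented boundary of the double sector of
half-angle `φ`. -/
def ctr (φ : ℝ) (k : ℂ → ℂ) : ℂ :=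
  (2 * Real.pi * I)⁻¹ * ∑ p : Bool × Bool, sg p.2 * ∫ τ, ray p φ τ * k (ray p φ τ)

/-- Absolute convergence of `ctr φ k`. -/
def CtrInt (φ : ℝ) (k : ℂ → ℂ) : Prop :=
  ∀ p, Integrable fun τ => ray p φ τ * k (ray p φ τ)

theorem ctr_congr {φ : ℝ} {k k' : ℂ → ℂ} (h : ∀ p τ, k (ray p φ τ) = k' (ray p φ τ)) :
    ctr φ k = ctr φ k' := by
  simp [ctr, h]

theorem CtrInt.congr {φ : ℝ} {k k' : ℂ → ℂ} (hk : CtrInt φ k)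
    (h : ∀ p τ, k (ray p φ τ) = k' (ray p φ τ)) : CtrInt φ k' := by
  simpa [CtrInt, h] using hk

theorem ctr_sub {φ : ℝ} {k k' : ℂ → ℂ} (hk : CtrInt φ k) (hk' : CtrInt φ k') :
    ctr φ (fun z => k z - k' z) = ctr φ k - ctr φ k' := by
  simp only [ctr, mul_sub, integral_sub (hk _) (hk' _), Finset.sum_sub_distrib]

theorem ctr_const_mul (φ : ℝ) (c : ℂ) (k : ℂ → ℂ) : ctr φ (fun z => c * k z) = c * ctr φ k := by
  simp only [ctr, mul_left_comm _ c, integral_const_mul, ← Finset.mul_sum]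

/-- Fubini for each of the sixteen pairs of rays; signs and normalizing factors are carried along as
constants. -/
theorem ctr_swap {φ₁ φ₂ : ℝ} {K : ℂ → ℂ → ℂ}
    (h : ∀ p q, Integrable (Function.uncurry fun τ σ : ℝ =>
      ray p φ₁ τ * (ray q φ₂ σ * K (ray p φ₁ τ) (ray q φ₂ σ))) (volume.prod volume)) :
    ctr φ₁ (fun z => ctr φ₂ (fun w => K z w)) = ctr φ₂ (fun w => ctr φ₁ (fun z => K z w)) ∧
      CtrInt φ₁ (fun z => ctr φ₂ (fun w => K z w)) := by
  have h1 : ∀ p q, Integrable fun τ => ray p φ₁ τ *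
      (sg q.2 * ∫ σ, ray q φ₂ σ * K (ray p φ₁ τ) (ray q φ₂ σ)) := fun p q => by
    have := ((h p q).integral_prod_left).const_mul (sg q.2 : ℂ)
    refine this.congr (Filter.Eventually.of_forall fun τ => ?_)
    simp only [Function.uncurry]
    rw [integral_const_mul]
    ring
  have h2 : ∀ p q, Integrable fun σ => ray q φ₂ σ *
      (sg p.2 * ∫ τ, ray p φ₁ τ * K (ray p φ₁ τ) (ray q φ₂ σ)) := fun p q => by
    have := ((h p q).integral_prod_right).const_mul (sg p.2 : ℂ)
    refine this.congr (Filter.Eventually.of_forall fun τ => ?_)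
    simp only [Function.uncurry]
    simp_rw [mul_left_comm _ (ray q φ₂ τ)]
    rw [integral_const_mul]
    ring
  constructor
  · have e1 : ∀ p, (∫ τ, ray p φ₁ τ * ctr φ₂ (fun w => K (ray p φ₁ τ) w)) =
        (2 * Real.pi * I)⁻¹ * ∑ q : Bool × Bool, sg q.2 *
          ∫ τ, ∫ σ, ray p φ₁ τ * (ray q φ₂ σ * K (ray p φ₁ τ) (ray q φ₂ σ)) := fun p => by
      simp only [ctr, mul_left_comm (ray p φ₁ _), integral_const_mul]
      congr 1
      simp_rw [Finset.mul_sum]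
      rw [integral_finsetSum _ fun q _ => h1 p q]
      refine Finset.sum_congr rfl fun q _ => ?_
      simp only [mul_left_comm (ray p φ₁ _), integral_const_mul]
      congr 1
      refine integral_congr_ae (Filter.Eventually.of_forall fun τ => ?_)
      simp only
      rw [← integral_const_mul]
      refine integral_congr_ae (Filter.Eventually.of_forall fun σ => ?_)
      simp only; ring
    have e2 : ∀ q, (∫ σ, ray q φ₂ σ * ctr φ₁ (fun z => K z (ray q φ₂ σ))) =
        (2 * Real.pi * I)⁻¹ * ∑ p : Bool × Bool, sg p.2 *
          ∫ σ, ∫ τ, ray p φ₁ τ * (ray q φ₂ σ * K (ray p φ₁ τ) (ray q φ₂ σ)) := fun q => by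
      simp only [ctr, mul_left_comm (ray q φ₂ _), integral_const_mul]
      congr 1
      simp_rw [Finset.mul_sum]
      rw [integral_finsetSum _ fun p _ => h2 p q]
      refine Finset.sum_congr rfl fun p _ => ?_
      simp only [mul_left_comm (ray q φ₂ _), integral_const_mul]
      congr 1
      refine integral_congr_ae (Filter.Eventually.of_forall fun σ => ?_)
      simp only
      rw [← integral_const_mul]
      refine integral_congr_ae (Filter.Eventually.of_forall fun τ => ?_)
      simp only; ring
    rw [ctr, ctr]
    simp_rw [e1, e2, fun p q => integral_integral_swap (h p q), Finset.mul_sum]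
    rw [Finset.sum_comm]
    refine Finset.sum_congr rfl fun q _ => Finset.sum_congr rfl fun p _ => ?_
    ring
  · intro p
    simp only [ctr, mul_left_comm (ray p φ₁ _)]
    refine Integrable.const_mul ?_ _
    simp_rw [Finset.mul_sum]
    exact integrable_finsetSum _ fun q _ => h1 p q

end CliffordCalculus

namespace CliffordCalculus

/-! ### Cauchy's theorem and formula on the double sector, and the double contour integral -/

open Complex (I exp sinh cosh)

theorem strip_symm_eq {φ : ℝ} (h : 0 < φ) : strip (-φ) φ = {u | |u.im| ≤ φ} := by
  ext u
  rw [strip, uIcc_of_le (by linarith)]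
  exact abs_le.symm

/-- For fixed `ε` the two rays are the edges of a single strip, which is the form the strip lemmas
apply to. -/
theorem ctr_eq_sum (φ : ℝ) (k : ℂ → ℂ) : ctr φ k = (2 * Real.pi * I)⁻¹ * ∑ ε : Bool,
    ((∫ τ, pt ε (hline (-φ) τ) * k (pt ε (hline (-φ) τ))) -
      ∫ τ, pt ε (hline φ τ) * k (pt ε (hline φ τ))) := by
  simp [ctr, ray, Fintype.sum_prod_type, sub_eq_add_neg]

/-- The contour of a holomorphic integrand may be moved in the region of holomorphy. -/
theorem ctr_eq_ctr {ω θ φ φ' C : ℝ} {k : ℂ → ℂ} (h0 : 0 ≤ ω) (hθ : θ < Real.pi / 2)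
    (hφ : φ ∈ Ioo ω θ) (hφ' : φ' ∈ Ioo ω θ)
    (hd : DifferentiableOn ℂ k (cSector θ ∩ cExt ω))
    (hb : ∀ z ε u, z = pt ε u → |u.im| ∈ uIcc φ φ' → ‖z * k z‖ ≤ C)
    (hi : CtrInt φ k) (hi' : CtrInt φ' k) : ctr φ k = ctr φ' k := by
  -- Along one ray the sign of the height is fixed, so moving the height from `∓φ` to `∓φ'` keeps
  -- `|Im u|` between `φ` and `φ'`.
  have hsub : ∀ b, ∀ u ∈ strip (-(sg b) * φ) (-(sg b) * φ'), |u.im| ∈ uIcc φ φ' := by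
    intro b u hu
    have h1 : -(sg b) * u.im ∈ uIcc φ φ' := by
      have h2 : -(sg b) * u.im ∈ (fun x => -(sg b) * x) '' uIcc (-(sg b) * φ) (-(sg b) * φ') :=
        mem_image_of_mem _ hu
      rw [image_const_mul_uIcc] at h2
      simpa [← mul_assoc, sg_mul_self] using h2
    have h3 : 0 ≤ -(sg b) * u.im := by
      rcases mem_uIcc.1 h1 with h | h <;> linarith [h.1, hφ.1, hφ'.1]
    rwa [← abs_of_nonneg h3, abs_mul, abs_neg, abs_sg, one_mul] at h1
  have hIoo : ∀ x ∈ uIcc φ φ', x ∈ Ioo ω θ := fun x hx => by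
    rcases mem_uIcc.1 hx with h | h <;>
      exact ⟨by linarith [h.1, hφ.1, hφ'.1], by linarith [h.2, hφ.2, hφ'.2]⟩
  rw [ctr, ctr]
  congr 1
  refine Finset.sum_congr rfl fun p _ => ?_
  congr 1
  refine integral_hline_eq (H := fun u => pt p.1 u * k (pt p.1 u)) (C := C) ?_ ?_ (hi p) (hi' p)
  · refine DifferentiableOn.mul (by fun_prop) (hd.comp (by fun_prop) fun u hu => ?_)
    have := hIoo _ (hsub _ u hu)
    exact ⟨pt_mem_cSector _ this.2 hθ, pt_mem_cExt _ h0 this.1 (this.2.trans hθ)⟩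
  · exact fun u hu => hb _ p.1 u rfl (hsub _ u hu)

namespace HoloDecay

variable {θ : ℝ} {h : ℂ → ℂ}

theorem differentiableOn_strip (hh : HoloDecay θ h) (hθ : θ < Real.pi / 2) {φ : ℝ} (h0 : 0 < φ)
    (hφ : φ < θ) (ε : Bool) : DifferentiableOn ℂ (fun u => h (pt ε u)) (strip (-φ) φ) := by
  rw [strip_symm_eq h0]
  exact hh.diff.comp (by fun_prop) fun u hu => pt_mem_cSector ε (lt_of_le_of_lt hu hφ) hθ

theorem ray_mem {φ : ℝ} (hθ : θ < Real.pi / 2) (h0 : 0 < φ) (hφ : φ < θ) (p : Bool × Bool)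
    (τ : ℝ) : ray p φ τ ∈ cSector θ :=
  pt_mem_cSector _ (by rwa [hline_im, abs_neg_sg_mul _ h0]) hθ

theorem continuous_ray (hh : HoloDecay θ h) (hθ : θ < Real.pi / 2) {φ : ℝ} (h0 : 0 < φ)
    (hφ : φ < θ) (p : Bool × Bool) : Continuous fun τ => h (ray p φ τ) :=
  hh.diff.continuousOn.comp_continuous (CliffordCalculus.continuous_ray p φ)
    (ray_mem hθ h0 hφ p)

theorem integrable_ray (hh : HoloDecay θ h) {φ : ℝ} (h0 : 0 < φ)
    (hφ : φ < θ) (p : Bool × Bool) : Integrable fun τ => h (ray p φ τ) :=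
  hh.int _ _ (by rwa [abs_neg_sg_mul _ h0])

/-- Convergence comes from `h` alone: in logarithmic coordinates the integrand is `h(z)` times `z
k(z)`, and the latter only has to be bounded. -/
theorem ctrInt_mul (hh : HoloDecay θ h) {φ C : ℝ} (h0 : 0 < φ) (hφ : φ < θ) {k : ℂ → ℂ}
    (hk : ∀ p, Continuous fun τ => k (ray p φ τ)) (hb : ∀ p τ, ‖ray p φ τ * k (ray p φ τ)‖ ≤ C) :
    CtrInt φ fun z => h z * k z := by
  intro p
  have := (hh.integrable_ray h0 hφ p).bdd_mul (c := C)
    (f := fun τ => ray p φ τ * k (ray p φ τ))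
    ((CliffordCalculus.continuous_ray p φ).mul (hk p)).aestronglyMeasurable
    (Filter.Eventually.of_forall (hb p))
  exact this.congr (Filter.Eventually.of_forall fun τ => by simp only; ring)

/-- Disposes of every part of a Cauchy kernel without a pole in the strip: its two edge integrals
cancel in `ctr_eq_sum`. -/
theorem integral_hline_mul_eq (hh : HoloDecay θ h) (hθ : θ < Real.pi / 2) {φ C : ℝ} (h0 : 0 < φ)
    (hφ : φ < θ) (ε : Bool) {κ : ℂ → ℂ} (hd : DifferentiableOn ℂ κ (strip (-φ) φ))
    (hb : ∀ u ∈ strip (-φ) φ, ‖κ u‖ ≤ C) :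
    Integrable (fun τ => h (pt ε (hline (-φ) τ)) * κ (hline (-φ) τ)) ∧
    Integrable (fun τ => h (pt ε (hline φ τ)) * κ (hline φ τ)) ∧
    ∫ τ, h (pt ε (hline (-φ) τ)) * κ (hline (-φ) τ) =
      ∫ τ, h (pt ε (hline φ τ)) * κ (hline φ τ) := by
  have i1 : Integrable (fun τ => h (pt ε (hline (-φ) τ)) * κ (hline (-φ) τ)) :=
    (hh.int ε (-φ) (by rwa [abs_neg, abs_of_pos h0])).mul_bdd (c := C)
      (hd.continuousOn.comp_continuous (continuous_hline _)
        (hline_mem_strip_left _ _)).aestronglyMeasurable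
      (Filter.Eventually.of_forall fun τ => hb _ (hline_mem_strip_left _ _ τ))
  have i2 : Integrable (fun τ => h (pt ε (hline φ τ)) * κ (hline φ τ)) :=
    (hh.int ε φ (by rwa [abs_of_pos h0])).mul_bdd (c := C)
      (hd.continuousOn.comp_continuous (continuous_hline _)
        (hline_mem_strip_right _ _)).aestronglyMeasurable
      (Filter.Eventually.of_forall fun τ => hb _ (hline_mem_strip_right _ _ τ))
  obtain ⟨K, hK⟩ := hh.bdd
  refine ⟨i1, i2, integral_hline_eq (H := fun u => h (pt ε u) * κ u) (C := K * C)
    ((hh.differentiableOn_strip hθ h0 hφ ε).mul hd) (fun u hu => ?_) i1 i2⟩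
  rw [norm_mul]
  have hm : pt ε u ∈ cSector θ :=
    pt_mem_cSector ε (lt_of_le_of_lt (by rwa [strip_symm_eq h0] at hu) hφ) hθ
  exact mul_le_mul (hK _ hm) (hb u hu) (norm_nonneg _) ((norm_nonneg _).trans (hK _ hm))

/-- The Cauchy integral of `h` vanishes outside the contour. -/
theorem ctr_div_eq_zero (hh : HoloDecay θ h) (hθ : θ < Real.pi / 2) {φ : ℝ} (h0 : 0 < φ)
    (hφ : φ < θ) (ε' : Bool) {v : ℂ} (hv : φ < |v.im|) (hv' : |v.im| < Real.pi / 2) :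
    ctr φ (fun z => h z / (pt ε' v - z)) = 0 := by
  rw [ctr_eq_sum, mul_eq_zero]
  right
  refine Finset.sum_eq_zero fun ε _ => ?_
  have hs : 0 < Real.sin (|v.im| - φ) :=
    Real.sin_pos_of_pos_of_lt_pi (by linarith) (by linarith [Real.pi_pos])
  have hest : ∀ u ∈ strip (-φ) φ,
      ‖pt ε u‖ * Real.sin (|v.im| - φ) ≤ ‖pt ε' v - pt ε u‖ := fun u hu => by
    rw [strip_symm_eq h0] at hu
    rw [norm_sub_rev]
    exact (norm_pt_mul_sin_le ε ε' hu hv.le le_rfl hv').1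
  have hne : ∀ u ∈ strip (-φ) φ, pt ε' v - pt ε u ≠ 0 := fun u hu =>
    norm_pos_iff.1 (lt_of_lt_of_le (mul_pos (norm_pos_iff.2 (pt_ne_zero ε u)) hs) (hest u hu))
  -- The point `± e^v` is at a larger angle than every point of the strip, so the kernel has no pole
  -- there.
  have := (hh.integral_hline_mul_eq hθ h0 hφ ε (κ := fun u => pt ε u / (pt ε' v - pt ε u))
    (C := (Real.sin (|v.im| - φ))⁻¹)
    (DifferentiableOn.div (by fun_prop) (by fun_prop) hne) fun u hu => by
      rw [norm_div, div_le_iff₀ (norm_pos_iff.2 (hne u hu)), inv_mul_eq_div, le_div_iff₀ hs]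
      exact hest u hu).2.2
  rw [sub_eq_zero]
  convert this using 2 <;> · ext τ; ring

/-- Both exponentials lie in the right half-plane, so their real parts add without cancellation.
This keeps each half of the double sector away from the opposite half. -/
theorem exp_add_exp_bound {u v : ℂ} {φ : ℝ} (hu : |u.im| ≤ φ) (hv : |v.im| ≤ φ)
    (hφ : φ < Real.pi / 2) : ‖exp u‖ * Real.cos φ ≤ ‖exp u + exp v‖ := by
  have h1 : ∀ w : ℂ, |w.im| ≤ φ → Real.exp w.re * Real.cos φ ≤ (exp w).re := fun w hw => by
    rw [Complex.exp_re, ← Real.cos_abs w.im]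
    gcongr
    exact Real.cos_le_cos_of_nonneg_of_le_pi (abs_nonneg _) (by linarith [Real.pi_pos]) hw
  have h2 : 0 ≤ Real.cos φ := Real.cos_nonneg_of_mem_Icc
    ⟨by linarith [abs_nonneg u.im, Real.pi_pos], hφ.le⟩
  have h3 := h1 u hu
  have h4 := h1 v hv
  have h5 := mul_nonneg (Real.exp_pos v.re).le h2
  calc _ ≤ (exp u + exp v).re := by rw [Complex.norm_exp, Complex.add_re]; linarith
    _ ≤ _ := Complex.re_le_norm _

/-- The Cauchy integral formula on the double sector. -/
theorem ctr_div_eq (hh : HoloDecay θ h) (hθ : θ < Real.pi / 2) {φ : ℝ} (h0 : 0 < φ)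
    (hφ : φ < θ) (ε' : Bool) {v : ℂ} (hv : |v.im| < φ) :
    ctr φ (fun z => h z / (z - pt ε' v)) = h (pt ε' v) := by
  have hcos : 0 < Real.cos φ := Real.cos_pos_of_mem_Ioo ⟨by linarith, hφ.trans hθ⟩
  have hest : ∀ u ∈ strip (-φ) φ, ‖exp u‖ * Real.cos φ ≤ ‖exp u + exp v‖ := fun u hu => by
    rw [strip_symm_eq h0] at hu
    exact exp_add_exp_bound hu hv.le (hφ.trans hθ)
  have hne : ∀ u ∈ strip (-φ) φ, exp u + exp v ≠ 0 := fun u hu =>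
    norm_pos_iff.1 (lt_of_lt_of_le
      (mul_pos (norm_pos_iff.2 (Complex.exp_ne_zero u)) hcos) (hest u hu))
  -- This kernel is the whole Cauchy kernel for the half not containing `± e^v`, and the pole-free
  -- remainder for the half containing it.
  have hreg := fun ε => hh.integral_hline_mul_eq hθ h0 hφ ε
    (κ := fun u => exp u / (exp u + exp v)) (C := (Real.cos φ)⁻¹)
    (DifferentiableOn.div (by fun_prop) (by fun_prop) hne) fun u hu => by
      rw [norm_div, div_le_iff₀ (norm_pos_iff.2 (hne u hu)), inv_mul_eq_div, le_div_iff₀ hcos]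
      exact hest u hu
  have hsame : (∫ τ, pt ε' (hline (-φ) τ) * (h (pt ε' (hline (-φ) τ)) /
        (pt ε' (hline (-φ) τ) - pt ε' v))) -
      (∫ τ, pt ε' (hline φ τ) * (h (pt ε' (hline φ τ)) / (pt ε' (hline φ τ) - pt ε' v)))
        = 2 * Real.pi * I * h (pt ε' v) := by
    obtain ⟨K, hK⟩ := hh.bdd
    have hc := cauchy_formula_strip (hφ.trans hθ) (hh.differentiableOn_strip hθ h0 hφ ε') (C := K)
      (fun u hu => hK _ (pt_mem_cSector ε' (lt_of_le_of_lt
        (by rwa [strip_symm_eq h0] at hu) hφ) hθ)) hv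
    -- The splitting `e^u / (e^u - e^v) = 1 / sinh (u - v) + e^u / (e^u + e^v)`. The first term has
    -- the pole and decays in both directions; the second is bounded and regular.
    have hpt : ∀ b, |b| = φ → ∀ τ, pt ε' (hline b τ) * (h (pt ε' (hline b τ)) /
        (pt ε' (hline b τ) - pt ε' v)) = h (pt ε' (hline b τ)) * (sinh (hline b τ - v))⁻¹ +
          h (pt ε' (hline b τ)) * (exp (hline b τ) / (exp (hline b τ) + exp v)) := by
      intro b hb τ
      have hm : hline b τ ∈ strip (-φ) φ := by rw [strip_symm_eq h0]; simpa using hb.le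
      have hn1 := hne _ hm
      have hns : sinh (hline b τ - v) ≠ 0 := by
        refine sinh_ne_zero ?_ fun h => ?_
        · rw [Complex.sub_im, hline_im]
          refine (abs_sub _ _).trans_lt ?_
          linarith
        · rw [sub_eq_zero.1 h |>.symm, hline_im, hb] at hv
          exact lt_irrefl _ hv
      have hsinh : sinh (hline b τ - v) = (exp (hline b τ) + exp v) *
          (exp (hline b τ) - exp v) / (2 * exp (hline b τ) * exp v) := by
        rw [Complex.sinh, neg_sub, Complex.exp_sub, Complex.exp_sub]
        have := Complex.exp_ne_zero (hline b τ)
        have := Complex.exp_ne_zero v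
        field_simp
        ring
      have hn2 : exp (hline b τ) - exp v ≠ 0 := by
        intro h; rw [hsinh, h] at hns; simp at hns
      have hsg : (sg ε' : ℂ) ≠ 0 := by simp
      have hev := Complex.exp_ne_zero v
      have heu := Complex.exp_ne_zero (hline b τ)
      rw [hsinh, ← mul_add, mul_div_left_comm]
      congr 1
      rw [pt, pt, ← mul_sub, mul_div_mul_left _ _ hsg]
      field_simp
      ring
    have iS : ∀ b, |b| = φ → Integrable fun τ =>
        h (pt ε' (hline b τ)) * (sinh (hline b τ - v))⁻¹ := by
      intro b hb
      have hbθ : |b| < θ := hb.trans_lt hφ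
      have hsin : Real.sin (b - v.im) ≠ 0 := by
        have h1 : |b - v.im| < Real.pi := by
          refine (abs_sub _ _).trans_lt ?_
          linarith
        intro h
        have := (Real.sin_eq_zero_iff_of_lt_of_lt (abs_lt.1 h1).1 (abs_lt.1 h1).2).1 h
        rw [← sub_eq_zero.1 this, hb] at hv
        exact lt_irrefl _ hv
      have hj : Integrable fun τ => (sinh (hline b τ - v))⁻¹ := by
        simp_rw [hline_sub]
        exact (integrable_inv_sinh_hline hsin).comp_sub_right v.re
      exact hj.bdd_mul (c := K) (hh.int _ _ hbθ).1 (Filter.Eventually.of_forall fun τ =>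
        hK _ (pt_mem_cSector ε' (by simpa using hbθ) hθ))
    have ha : |-φ| = φ := by rw [abs_neg, abs_of_pos h0]
    have hb : |φ| = φ := abs_of_pos h0
    simp_rw [hpt _ ha, hpt _ hb]
    rw [integral_add (iS _ ha) (hreg ε').1, integral_add (iS _ hb) (hreg ε').2.1, (hreg ε').2.2,
      ← hc]
    ring
  -- Opposite signs turn the difference in the denominator into `e^u + e^v`, so there is no pole in
  -- this half.
  have hopp : ∀ ε, ε ≠ ε' → (∫ τ, pt ε (hline (-φ) τ) * (h (pt ε (hline (-φ) τ)) /
        (pt ε (hline (-φ) τ) - pt ε' v))) -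
      (∫ τ, pt ε (hline φ τ) * (h (pt ε (hline φ τ)) / (pt ε (hline φ τ) - pt ε' v))) = 0 := by
    intro ε hε
    have hsg : (sg ε' : ℂ) = -sg ε := by cases ε <;> cases ε' <;> simp_all
    have e : ∀ u : ℂ, pt ε u * (h (pt ε u) / (pt ε u - pt ε' v)) =
        h (pt ε u) * (exp u / (exp u + exp v)) := fun u => by
      rw [mul_div_left_comm]
      congr 1
      rw [pt, pt, hsg, neg_mul, sub_neg_eq_add, ← mul_add, mul_div_mul_left _ _ (by simp)]
    simp_rw [e]
    rw [sub_eq_zero]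
    exact (hreg ε).2.2
  rw [ctr_eq_sum, Finset.sum_eq_single ε' (fun ε _ hε => hopp ε hε) (by simp), hsame,
    inv_mul_cancel_left₀]
  simp [Real.pi_ne_zero]

/-- The contour integral behind the product rule: an integrand satisfying the resolvent equation. -/
theorem ctr_resolvent {g : ℂ → ℂ} (hg : HoloDecay θ g) (hh : HoloDecay θ h)
    (hθ : θ < Real.pi / 2) {φ₁ φ₂ C : ℝ} (h0 : 0 < φ₁) (h12 : φ₁ < φ₂) (h2 : φ₂ < θ)
    {F : ℂ → ℂ} {G : ℂ → ℂ → ℂ} (hF₁ : ∀ p, Continuous fun τ => F (ray p φ₁ τ))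
    (hF₂ : ∀ p, Continuous fun τ => F (ray p φ₂ τ))
    (hb₁ : ∀ p τ, ‖ray p φ₁ τ * F (ray p φ₁ τ)‖ ≤ C)
    (hb₂ : ∀ p τ, ‖ray p φ₂ τ * F (ray p φ₂ τ)‖ ≤ C)
    (hG : ∀ p q τ σ, F (ray p φ₁ τ) - F (ray q φ₂ σ) =
      (ray q φ₂ σ - ray p φ₁ τ) * G (ray p φ₁ τ) (ray q φ₂ σ)) :
    ctr φ₁ (fun z => g z * ctr φ₂ (fun w => h w * G z w)) =
      ctr φ₁ (fun z => g z * h z * F z) := by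
  have h02 : 0 < φ₂ := h0.trans h12
  have h1 : φ₁ < θ := h12.trans h2
  have hs : 0 < Real.sin (φ₂ - φ₁) :=
    Real.sin_pos_of_pos_of_lt_pi (by linarith) (by linarith [Real.pi_pos])
  have hest : ∀ p q τ σ, ‖ray p φ₁ τ‖ * Real.sin (φ₂ - φ₁) ≤ ‖ray q φ₂ σ - ray p φ₁ τ‖ ∧
      ‖ray q φ₂ σ‖ * Real.sin (φ₂ - φ₁) ≤ ‖ray q φ₂ σ - ray p φ₁ τ‖ := fun p q τ σ => by
    rw [norm_sub_rev]
    exact norm_pt_mul_sin_le _ _ (by rw [hline_im, abs_neg_sg_mul _ h0]) h12.le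
      (by rw [hline_im, abs_neg_sg_mul _ h02])
      (by rw [hline_im, abs_neg_sg_mul _ h02]; exact h2.trans hθ)
  have hne : ∀ p q τ σ, ray q φ₂ σ - ray p φ₁ τ ≠ 0 := fun p q τ σ =>
    norm_pos_iff.1 (lt_of_lt_of_le (mul_pos (norm_pos_iff.2 (ray_ne_zero p φ₁ τ)) hs)
      (hest p q τ σ).1)
  -- Here `G z w = (F z - F w) / (w - z)`. The term with `F z` is a Cauchy integral of `h` at a
  -- point inside the contour, hence `h z F z`.
  have hinner : ∀ p τ, ctr φ₂ (fun w => h w * G (ray p φ₁ τ) w) =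
      h (ray p φ₁ τ) * F (ray p φ₁ τ) -
        ctr φ₂ (fun w => h w * F w / (w - ray p φ₁ τ)) := by
    intro p τ
    have hq : ∀ q, Continuous fun σ => 1 / (ray q φ₂ σ - ray p φ₁ τ) := fun q =>
      continuous_const.div ((CliffordCalculus.continuous_ray q φ₂).sub continuous_const)
        (hne p q τ)
    have hqb : ∀ q σ, ‖1 / (ray q φ₂ σ - ray p φ₁ τ)‖ ≤
        (‖ray p φ₁ τ‖ * Real.sin (φ₂ - φ₁))⁻¹ := fun q σ => by
      rw [norm_div, norm_one, one_div]
      exact inv_anti₀ (mul_pos (norm_pos_iff.2 (ray_ne_zero p φ₁ τ)) hs) (hest p q τ σ).1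
    have i1 : CtrInt φ₂ fun w => F (ray p φ₁ τ) * (h w / (w - ray p φ₁ τ)) := by
      refine (hh.ctrInt_mul h02 h2 (k := fun w => F (ray p φ₁ τ) * (1 / (w - ray p φ₁ τ)))
        (C := ‖F (ray p φ₁ τ)‖ * (Real.sin (φ₂ - φ₁))⁻¹)
        (fun q => continuous_const.mul (hq q)) fun q σ => ?_).congr fun q σ => by ring
      rw [mul_left_comm, norm_mul]
      gcongr
      rw [mul_one_div, norm_div, div_le_iff₀ (norm_pos_iff.2 (hne p q τ σ)), inv_mul_eq_div,
        le_div_iff₀ hs]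
      exact (hest p q τ σ).2
    have i2 : CtrInt φ₂ fun w => h w * F w / (w - ray p φ₁ τ) := by
      refine (hh.ctrInt_mul h02 h2 (k := fun w => F w * (1 / (w - ray p φ₁ τ)))
        (C := C * (‖ray p φ₁ τ‖ * Real.sin (φ₂ - φ₁))⁻¹)
        (fun q => (hF₂ q).mul (hq q)) fun q σ => ?_).congr fun q σ => by ring
      rw [← mul_assoc, norm_mul]
      exact mul_le_mul (hb₂ q σ) (hqb q σ) (norm_nonneg _) ((norm_nonneg _).trans (hb₂ q σ))
    have hc : ctr φ₂ (fun w => h w / (w - ray p φ₁ τ)) = h (ray p φ₁ τ) :=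
      hh.ctr_div_eq hθ h02 h2 p.1 (by rwa [hline_im, abs_neg_sg_mul _ h0])
    calc _ = ctr φ₂ (fun w => F (ray p φ₁ τ) * (h w / (w - ray p φ₁ τ)) -
          h w * F w / (w - ray p φ₁ τ)) := ctr_congr fun q σ => by
            have := hne p q τ σ
            rw [mul_div_left_comm, ← mul_div_assoc, ← sub_div, eq_div_iff this]
            linear_combination (-h (ray q φ₂ σ)) * hG p q τ σ
      _ = F (ray p φ₁ τ) * ctr φ₂ (fun w => h w / (w - ray p φ₁ τ)) - _ := by
            rw [ctr_sub i1 i2, ctr_const_mul]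
      _ = F (ray p φ₁ τ) * h (ray p φ₁ τ) - _ := by rw [hc]
      _ = _ := by ring
  -- The integrand is `g z · (w h w F w)`, a product of integrable functions of separate variables,
  -- times `z / (w - z)`. The last factor is bounded because the two contours make different angles
  -- with the real axis.
  have hfub := ctr_swap (φ₁ := φ₁) (φ₂ := φ₂)
    (K := fun z w => g z * (h w * F w / (w - z))) fun p q => by
      have hgi := hg.integrable_ray h0 h1 p
      have hhi : Integrable fun σ => ray q φ₂ σ * (h (ray q φ₂ σ) * F (ray q φ₂ σ)) :=
        hh.ctrInt_mul h02 h2 hF₂ hb₂ q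
      have hprod := hgi.mul_prod hhi
      have hcont : Continuous fun x : ℝ × ℝ => ray p φ₁ x.1 / (ray q φ₂ x.2 - ray p φ₁ x.1) :=
        ((CliffordCalculus.continuous_ray p φ₁).comp continuous_fst).div
          (((CliffordCalculus.continuous_ray q φ₂).comp continuous_snd).sub
            ((CliffordCalculus.continuous_ray p φ₁).comp continuous_fst)) fun x => hne p q _ _
      have := hprod.bdd_mul (c := (Real.sin (φ₂ - φ₁))⁻¹) hcont.aestronglyMeasurable
        (Filter.Eventually.of_forall fun x => by
          rw [norm_div, div_le_iff₀ (norm_pos_iff.2 (hne p q _ _)), inv_mul_eq_div,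
            le_div_iff₀ hs]
          exact (hest p q _ _).1)
      refine this.congr (Filter.Eventually.of_forall fun x => ?_)
      simp only [Function.uncurry]
      ring
  -- After the interchange the inner integral is the Cauchy integral of `g` at a point `w` outside
  -- its contour.
  have hzero : ctr φ₁ (fun z => ctr φ₂ (fun w => g z * (h w * F w / (w - z)))) = 0 := by
    rw [hfub.1]
    have : ctr φ₂ (fun w => ctr φ₁ (fun z => g z * (h w * F w / (w - z)))) =
        ctr φ₂ (fun _ => 0 * 0) := ctr_congr fun q σ => by
      have hc : ctr φ₁ (fun z => g z / (ray q φ₂ σ - z)) = 0 :=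
        hg.ctr_div_eq_zero hθ h0 h1 q.1 (by rwa [hline_im, abs_neg_sg_mul _ h02])
        (by rw [hline_im, abs_neg_sg_mul _ h02]; exact h2.trans hθ)
      calc _ = ctr φ₁ (fun z => (h (ray q φ₂ σ) * F (ray q φ₂ σ)) *
            (g z / (ray q φ₂ σ - z))) := by congr 1; ext z; ring
        _ = _ := by rw [ctr_const_mul, hc]; simp
    rw [this, ctr_const_mul, zero_mul]
  have i3 : CtrInt φ₁ fun z => g z * h z * F z := by
    obtain ⟨K, hK⟩ := hh.bdd
    refine (hg.ctrInt_mul h0 h1 (k := fun z => h z * F z) (C := K * C)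
      (fun p => (hh.continuous_ray hθ h0 h1 p).mul (hF₁ p)) fun p τ => ?_).congr
        fun p τ => by ring
    rw [mul_left_comm, norm_mul]
    have hk := hK _ (ray_mem hθ h0 h1 p τ)
    exact mul_le_mul hk (hb₁ p τ) (norm_nonneg _) ((norm_nonneg _).trans hk)
  calc _ = ctr φ₁ (fun z => g z * h z * F z -
        ctr φ₂ (fun w => g z * (h w * F w / (w - z)))) := ctr_congr fun p τ => by
          rw [hinner, ctr_const_mul]; ring
    _ = _ := by rw [ctr_sub i3 hfub.2, hzero, sub_zero]

end HoloDecay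

end CliffordCalculus

namespace CliffordCalculus

/-! ### Multiplication in the Clifford algebra -/

section Clifford

variable {n : ℕ} {VR : Type*} [NormedAddCommGroup VR] [NormedSpace ℝ VR]

instance : FiniteDimensional ℝ (Cl n) :=
  inferInstanceAs (FiniteDimensional ℝ (PiLp 2 (fun _ : Finset (Fin n) => ℝ)))

/-- Left multiplication as a continuous linear map into the bounded operators. -/
def lmulL (n : ℕ) (VR : Type*) [NormedAddCommGroup VR] [NormedSpace ℝ VR] :
    Cl n →L[ℝ] (CMod n VR →L[ℝ] CMod n VR) :=
  LinearMap.toContinuousLinearMap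
    { toFun := fun s => lmul s
      map_add' := fun s t => ContinuousLinearMap.ext fun v => lmul_add_left s t v
      map_smul' := fun c s => by
        ext v C
        simp [coeff_lmul, Finset.smul_sum, smul_smul, mul_left_comm] }

@[simp] theorem lmulL_apply (s : Cl n) : lmulL n VR s = lmul s := rfl

theorem norm_lmul_le (s : Cl n) :
    ‖(lmul s : CMod n VR →L[ℝ] CMod n VR)‖ ≤ ‖lmulL n VR‖ * ‖s‖ :=
  (lmulL n VR).le_opNorm s

theorem lmul_comp_lmul (s t : Cl n) :
    (lmul s : CMod n VR →L[ℝ] CMod n VR) ∘L lmul t = lmul (s * t) :=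
  ContinuousLinearMap.ext fun v => (lmul_lmul s t v).symm

theorem norm_mul_le_lmulL (s t : Cl n) : ‖s * t‖ ≤ ‖lmulL n ℝ‖ * ‖s‖ * ‖t‖ :=
  ((lmul s).le_opNorm t).trans (mul_le_mul_of_nonneg_right (norm_lmul_le s) (norm_nonneg t))

theorem continuous_Cl_mul : Continuous fun p : Cl n × Cl n => p.1 * p.2 :=
  ((lmulL n ℝ).continuous.comp continuous_fst).clm_apply continuous_snd

theorem lmul_rmul (s t : Cl n) (v : CMod n VR) : lmul s (rmul t v) = rmul t (lmul s v) := by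
  ext C
  simp only [coeff_lmul, coeff_rmul, Finset.smul_sum]
  rw [Finset.sum_comm]
  refine Finset.sum_congr rfl fun B _ => Finset.sum_congr rfl fun A _ => ?_
  rw [smul_smul, smul_smul, symmDiff_assoc]
  congr 1
  simp only [sgn_symmDiff_left, sgn_symmDiff_right]
  ring

theorem lmul_eq_sum (s : Cl n) : (lmul s : CMod n VR →L[ℝ] CMod n VR) =
    ∑ A, CMod.coeff A s • lmul (basisVec A) := by
  have h : s = ∑ A, CMod.coeff A s • basisVec A := by
    ext B
    simp [basisVec, map_sum]
  conv_lhs => rw [h, ← lmulL_apply, map_sum]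
  simp

theorem lmul_one_eq_id : (lmul (1 : Cl n) : CMod n VR →L[ℝ] CMod n VR) = .id ℝ _ :=
  ContinuousLinearMap.ext lmul_one

/-! ### Paravectors and the double sector -/

theorem imagSphere_eq_sum {J : Cl n} (hJ : J ∈ imagSphere n) :
    J = ∑ i, CMod.coeff {i} J • unitVec i := by
  ext C
  simp only [map_sum, map_smul, smul_eq_mul, unitVec, basisVec, CMod.coeff_mk]
  rcases lt_trichotomy C.card 1 with h | h | h
  · obtain rfl : C = ∅ := Finset.card_eq_zero.1 (by omega)
    have : CMod.coeff ∅ J = 0 := hJ.2.1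
    simp [this, (Finset.singleton_ne_empty _).symm]
  · obtain ⟨i, rfl⟩ := Finset.card_eq_one.1 h
    simp
  · rw [hJ.1 C h, Finset.sum_eq_zero]
    intro i _
    have : C ≠ {i} := by rintro rfl; simp at h
    simp [this]

theorem sum_coeff_sq_imagSphere {J : Cl n} (hJ : J ∈ imagSphere n) :
    ∑ i, CMod.coeff {i} J ^ 2 = 1 := by
  have h := CMod.norm_sq J
  rw [hJ.2.2, one_pow] at h
  rw [h]
  let e : Fin n ↪ Finset (Fin n) := ⟨fun i => {i}, Finset.singleton_injective⟩
  have h2 : ∑ i, CMod.coeff {i} J ^ 2 = ∑ A ∈ Finset.univ.map e, ‖CMod.coeff A J‖ ^ 2 := by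
    rw [Finset.sum_map]; simp [e]
  rw [h2]
  refine Finset.sum_subset (Finset.subset_univ _) fun A _ hA => ?_
  have h3 : CMod.coeff A J = 0 := by
    rcases lt_trichotomy A.card 1 with h | h | h
    · obtain rfl : A = ∅ := Finset.card_eq_zero.1 (by omega)
      exact hJ.2.1
    · obtain ⟨i, rfl⟩ := Finset.card_eq_one.1 h
      exact absurd (Finset.mem_map.2 ⟨i, Finset.mem_univ _, rfl⟩) hA
    · exact hJ.1 A h
  rw [h3]; simp

/-- In `J² + J²` the double sum can be symmetrized; anticommutation then leaves only the diagonal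
`-2 ∑ c_i² = -2`. -/
theorem imagSphere_mul_self {J : Cl n} (hJ : J ∈ imagSphere n) : J * J = -1 := by
  set c : Fin n → ℝ := fun i => CMod.coeff {i} J with hc
  have hs : J = ∑ i, c i • unitVec i := imagSphere_eq_sum hJ
  have e1 : J * J = ∑ i, ∑ j, (c i * c j) • (unitVec i * unitVec j : Cl n) := by
    conv_lhs => rw [hs]
    simp only [Finset.sum_mul_sum, smul_mul_smul_comm]
  have e2 : J * J = ∑ i, ∑ j, (c i * c j) • (unitVec j * unitVec i : Cl n) := by
    rw [e1, Finset.sum_comm]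
    refine Finset.sum_congr rfl fun i _ => Finset.sum_congr rfl fun j _ => ?_
    rw [mul_comm]
  have e3 : J * J + J * J = ∑ i, ∑ j, if i = j then (c i ^ 2) • (-2 : Cl n) else 0 := by
    conv_lhs => rw [e1]; arg 2; rw [← e1, e2]
    simp only [← Finset.sum_add_distrib, ← smul_add]
    refine Finset.sum_congr rfl fun i _ => Finset.sum_congr rfl fun j _ => ?_
    split_ifs with h
    · subst h
      rw [unitVec_mul_self, ← sq]; norm_num
    · rw [unitVec_mul_comm h]; simp
  simp only [Finset.sum_ite_eq, Finset.mem_univ, if_true, ← Finset.sum_smul] at e3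
  rw [show ∑ i, c i ^ 2 = 1 from sum_coeff_sq_imagSphere hJ, one_smul, ← two_smul ℝ] at e3
  have : (2 : ℝ) • (J * J) = (2 : ℝ) • (-1 : Cl n) := by
    rw [e3, two_smul]; norm_num
  exact smul_right_injective _ (two_ne_zero (α := ℝ)) this

theorem neg_mem_imagSphere {J : Cl n} (hJ : J ∈ imagSphere n) : -J ∈ imagSphere n := by
  refine ⟨fun A hA => ?_, ?_, ?_⟩
  · rw [map_neg, hJ.1 A hA, neg_zero]
  · have := hJ.2.1; rw [re] at *; rw [map_neg, this, neg_zero]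
  · rw [norm_neg, hJ.2.2]

theorem slicePt_mem_paravectors {J : Cl n} (hJ : J ∈ imagSphere n) (x y : ℝ) :
    slicePt J x y ∈ paravectors n := by
  intro A hA
  have : A ≠ ∅ := by rintro rfl; simp at hA
  simp [slicePt, hJ.1 A hA, Cl.coeff_one, this]

theorem re_slicePt {J : Cl n} (hJ : J ∈ imagSphere n) (x y : ℝ) : re (slicePt J x y) = x := by
  have : CMod.coeff ∅ J = 0 := hJ.2.1
  simp [re, slicePt, Cl.coeff_one, this]

theorem norm_sq_slicePt {J : Cl n} (hJ : J ∈ imagSphere n) (x y : ℝ) :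
    ‖slicePt J x y‖ ^ 2 = x ^ 2 + y ^ 2 := by
  have h1 := CMod.norm_sq J
  have h0 : CMod.coeff ∅ J = 0 := hJ.2.1
  rw [hJ.2.2] at h1
  rw [CMod.norm_sq]
  have : ∀ A : Finset (Fin n), ‖CMod.coeff A (slicePt J x y)‖ ^ 2 =
      (if A = ∅ then x ^ 2 else 0) + y ^ 2 * ‖CMod.coeff A J‖ ^ 2 := fun A => by
    simp only [slicePt, map_add, map_smul, smul_eq_mul, Cl.coeff_one, Real.norm_eq_abs, sq_abs]
    split_ifs with h
    · subst h; rw [h0]; ring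
    · ring
  simp only [this, Finset.sum_add_distrib, ← Finset.mul_sum, ← h1]
  simp

theorem norm_slicePt {J : Cl n} (hJ : J ∈ imagSphere n) (z : ℂ) :
    ‖slicePt J z.re z.im‖ = ‖z‖ := by
  rw [← sq_eq_sq₀ (norm_nonneg _) (norm_nonneg _), norm_sq_slicePt hJ, Complex.sq_norm,
    Complex.normSq_apply]
  ring

theorem conj_slicePt {J : Cl n} (hJ : J ∈ imagSphere n) (x y : ℝ) :
    conj (slicePt J x y) = slicePt J x (-y) := by
  ext A
  simp only [conj, CMod.coeff_mk, slicePt, map_add, map_smul, smul_eq_mul, Cl.coeff_one]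
  rcases lt_trichotomy A.card 1 with h | h | h
  · obtain rfl : A = ∅ := Finset.card_eq_zero.1 (by omega)
    have h0 : CMod.coeff ∅ J = 0 := hJ.2.1
    simp [h0]
  · have : A ≠ ∅ := by rintro rfl; simp at h
    rw [h, if_neg this]
    norm_num
  · have : A ≠ ∅ := by rintro rfl; simp at h
    rw [hJ.1 A h, if_neg this]
    simp

theorem slicePt_sub_re {J : Cl n} (hJ : J ∈ imagSphere n) (x y : ℝ) :
    ‖slicePt J x y - re (slicePt J x y) • (1 : Cl n)‖ = |y| := by
  rw [re_slicePt hJ, slicePt, add_sub_cancel_left, norm_smul, hJ.2.2, mul_one, Real.norm_eq_abs]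

theorem polarPt_eq_slicePt_pt (J : Cl n) (ε : Bool) (φ τ : ℝ) :
    polarPt J (sg ε * Real.exp τ) φ = slicePt J (pt ε (hline φ τ)).re (pt ε (hline φ τ)).im := by
  rw [polarPt, pt_re, pt_im, hline_re, hline_im, mul_assoc, mul_assoc]

theorem polarPt_neg (J : Cl n) (r φ : ℝ) : polarPt J (-r) φ = polarPt J r (φ + Real.pi) := by
  rw [polarPt, polarPt, Real.cos_add_pi, Real.sin_add_pi]
  congr 1 <;> ring

theorem exists_eq_pt {θ : ℝ} (hθ0 : 0 < θ) (hθ : θ < Real.pi / 2) {z : ℂ} (hz : z ∈ cSector θ) :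
    ∃ ε φ τ, |φ| < θ ∧ z = pt ε (hline φ τ) := by
  have hc : 0 < Real.cos θ := Real.cos_pos_of_mem_Ioo ⟨by linarith, hθ⟩
  have hs : 0 < Real.sin θ := Real.sin_pos_of_pos_of_lt_pi hθ0 (by linarith)
  have hz' : |z.im| * Real.cos θ < |z.re| * Real.sin θ := hz
  have hx : z.re ≠ 0 := by
    intro h
    rw [h, abs_zero, zero_mul] at hz'
    exact absurd hz' (not_lt.2 (by positivity))
  set q := z.im / z.re with hq
  have hqt : |q| < Real.tan θ := by
    rw [hq, abs_div, Real.tan_eq_sin_div_cos, div_lt_div_iff₀ (abs_pos.2 hx) hc]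
    linarith
  have hat : |Real.arctan q| < θ := by
    have e : Real.arctan (Real.tan θ) = θ := Real.arctan_tan (by linarith) hθ
    rw [abs_lt] at hqt ⊢
    constructor
    · have := Real.arctan_strictMono hqt.1
      rwa [Real.arctan_neg, e] at this
    · have := Real.arctan_strictMono hqt.2
      rwa [e] at this
  have hsq : 0 < Real.sqrt (1 + q ^ 2) := Real.sqrt_pos.2 (by positivity)
  obtain ⟨ε, hε⟩ : ∃ ε, z.re = sg ε * |z.re| := by
    rcases lt_or_gt_of_ne hx with h | h
    · exact ⟨false, by rw [abs_of_neg h]; simp⟩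
    · exact ⟨true, by rw [abs_of_pos h]; simp⟩
  -- `ε` is the sign of `x`, and `|x| √(1 + q²)` is the modulus of `z`.
  refine ⟨ε, Real.arctan q, Real.log (|z.re| * Real.sqrt (1 + q ^ 2)), hat, ?_⟩
  have hexp := Real.exp_log (mul_pos (abs_pos.2 hx) hsq)
  have hre : sg ε * (|z.re| * Real.sqrt (1 + q ^ 2) * Real.cos (Real.arctan q)) = z.re := by
    rw [Real.cos_arctan, mul_assoc, mul_one_div_cancel hsq.ne', mul_one, ← hε]
  apply Complex.ext
  · rw [pt_re, hline_re, hline_im, hexp, hre]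
  · rw [pt_im, hline_re, hline_im, hexp]
    have : Real.sin (Real.arctan q) = q * Real.cos (Real.arctan q) := by
      rw [Real.sin_arctan, Real.cos_arctan]; ring
    rw [this]
    calc z.im = q * z.re := by rw [hq, div_mul_cancel₀ _ hx]
      _ = q * (sg ε * (|z.re| * Real.sqrt (1 + q ^ 2) * Real.cos (Real.arctan q))) := by rw [hre]
      _ = _ := by ring

theorem polarPt_mem_doubleSector {J : Cl n} (hJ : J ∈ imagSphere n) {θ φ : ℝ} (hφ : |φ| < θ)
    (ε : Bool) {r : ℝ} (hr : 0 < r) : polarPt J (sg ε * r) φ ∈ doubleSector n θ := by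
  rw [abs_lt] at hφ
  cases ε
  · refine ⟨J, hJ, r, hr, φ + Real.pi, Or.inr ⟨by linarith [hφ.1], by linarith [hφ.2]⟩, ?_⟩
    rw [← polarPt_neg]; simp
  · exact ⟨J, hJ, r, hr, φ, Or.inl hφ, by simp⟩

/-- An inequality free of `J` and of the angle. Its non-strict form defines a closed set, which is
how the closure of the sector is controlled. -/
theorem doubleSector_subset {θ : ℝ} (hθ : θ < Real.pi / 2) {s : Cl n} (hs : s ∈ doubleSector n θ) :
    ‖s - re s • (1 : Cl n)‖ * Real.cos θ < |re s| * Real.sin θ := by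
  obtain ⟨J, hJ, r, hr, φ, hφ, rfl⟩ := hs
  have key : ∀ ψ, |ψ| < θ → |r * Real.sin ψ| * Real.cos θ < |r * Real.cos ψ| * Real.sin θ := by
    intro ψ hψ
    have := pt_mem_cSector true (u := hline ψ (Real.log r)) (by simpa using hψ) hθ
    simpa [cSector, pt_re, pt_im, Real.exp_log hr] using this
  rw [polarPt, slicePt_sub_re hJ, re_slicePt hJ]
  rcases hφ with h | h
  · exact key φ (abs_lt.2 h)
  · have := key (φ - Real.pi) (abs_lt.2 ⟨by linarith [h.1], by linarith [h.2]⟩)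
    simpa [Real.sin_sub_pi, Real.cos_sub_pi] using this

theorem slicePt_mem_doubleSector {J : Cl n} (hJ : J ∈ imagSphere n) {θ : ℝ} (hθ0 : 0 < θ)
    (hθ : θ < Real.pi / 2) {z : ℂ} : slicePt J z.re z.im ∈ doubleSector n θ ↔ z ∈ cSector θ := by
  constructor
  · intro h
    have := doubleSector_subset hθ h
    rwa [slicePt_sub_re hJ, re_slicePt hJ] at this
  · intro h
    obtain ⟨ε, φ, τ, hφ, rfl⟩ := exists_eq_pt hθ0 hθ h
    rw [← polarPt_eq_slicePt_pt]
    exact polarPt_mem_doubleSector hJ hφ ε (Real.exp_pos τ)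

theorem closure_doubleSector_subset {θ : ℝ} (hθ : θ < Real.pi / 2) {s : Cl n}
    (hs : s ∈ closure (doubleSector n θ)) :
    ‖s - re s • (1 : Cl n)‖ * Real.cos θ ≤ |re s| * Real.sin θ := by
  have hre : Continuous (re : Cl n → ℝ) := (CMod.coeff ∅).continuous
  have hcl : IsClosed {s : Cl n | ‖s - re s • (1 : Cl n)‖ * Real.cos θ ≤ |re s| * Real.sin θ} :=
    isClosed_le (by fun_prop) (by fun_prop)
  exact closure_minimal (fun s hs => (doubleSector_subset hθ hs).le) hcl hs

/-- `1 ≤ n` supplies a point of `𝕊`; for an empty sphere the condition defining the slice domain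
would be vacuous. -/
theorem mem_sliceDomain (hn : 1 ≤ n) {θ : ℝ} (hθ0 : 0 < θ) (hθ : θ < Real.pi / 2) {p : ℝ × ℝ} :
    p ∈ sliceDomain (doubleSector n θ) ↔ (⟨p.1, p.2⟩ : ℂ) ∈ cSector θ := by
  constructor
  · intro h
    have hJ := unitVec_mem_imagSphere (⟨0, hn⟩ : Fin n)
    exact (slicePt_mem_doubleSector (z := ⟨p.1, p.2⟩) hJ hθ0 hθ).1 (h _ hJ)
  · intro h J hJ
    exact (slicePt_mem_doubleSector (z := ⟨p.1, p.2⟩) hJ hθ0 hθ).2 h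

theorem isOpen_sliceDomain (hn : 1 ≤ n) {θ : ℝ} (hθ0 : 0 < θ) (hθ : θ < Real.pi / 2) :
    IsOpen (sliceDomain (doubleSector n θ)) := by
  have : sliceDomain (doubleSector n θ) =
      (fun p : ℝ × ℝ => (⟨p.1, p.2⟩ : ℂ)) ⁻¹' cSector θ := by
    ext p; exact mem_sliceDomain hn hθ0 hθ
  rw [this]
  exact (isOpen_cSector θ).preimage Complex.equivRealProdCLM.symm.continuous

end Clifford

end CliffordCalculus

namespace CliffordCalculus

variable {n : ℕ} {VR : Type*} [NormedAddCommGroup VR] [NormedSpace ℝ VR]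

namespace ClosedOp

/-! ### The operators `Q_s[T]⁻¹` and `T Q_s[T]⁻¹` -/

/-- `R = Q_s[T]⁻¹` and `P = T Q_s[T]⁻¹` for the points `s = x + J y` with `z = x + i y`. -/
structure IsRes (T : ClosedOp n VR) (z : ℂ) (R P : CMod n VR →L[ℝ] CMod n VR) : Prop where
  graph₁ : ∀ w, (R w, P w) ∈ T.op.graph
  graph₂ : ∀ w, (P w, w + (2 * z.re) • P w - ‖z‖ ^ 2 • R w) ∈ T.op.graph
  left : ∀ v v₁ v₂, (v, v₁) ∈ T.op.graph → (v₁, v₂) ∈ T.op.graph →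
    R (v₂ - (2 * z.re) • v₁ + ‖z‖ ^ 2 • v) = v
  rightLinear₁ : IsRightLinear R
  rightLinear₂ : IsRightLinear P

theorem graph_unique (T : ClosedOp n VR) {v w w' : CMod n VR} (h : (v, w) ∈ T.op.graph)
    (h' : (v, w') ∈ T.op.graph) : w = w' :=
  T.op.mem_graph_snd_inj h h' rfl

theorem isRes_Qinv [CompleteSpace VR] (T : ClosedOp n VR) {J : Cl n} (hJ : J ∈ imagSphere n)
    {z : ℂ} (hs : slicePt J z.re z.im ∈ T.resolventSet) :
    T.IsRes z (T.Qinv hs) (T.TQinv hs) where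
  graph₁ w := T.op.mem_graph ⟨T.Qinv hs w, T.Qinv_mem hs w⟩
  graph₂ w := by
    obtain ⟨h₁, h₂, e⟩ := (T.isQInv_Qinv hs).right_inv w
    have := T.op.mem_graph ⟨T.op ⟨T.Qinv hs w, h₁⟩, h₂⟩
    rw [Q, re_slicePt hJ, norm_slicePt hJ] at e
    have hw : w + (2 * z.re) • T.TQinv hs w - ‖z‖ ^ 2 • T.Qinv hs w =
        T.op ⟨T.op ⟨T.Qinv hs w, h₁⟩, h₂⟩ := by
      change w + (2 * z.re) • T.op ⟨T.Qinv hs w, h₁⟩ - ‖z‖ ^ 2 • T.Qinv hs w = _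
      linear_combination (norm := module) -e
    rw [hw]
    exact this
  left v v₁ v₂ h h' := by
    obtain ⟨y, rfl, rfl⟩ := (LinearPMap.mem_graph_iff _).1 h
    obtain ⟨y', e, rfl⟩ := (LinearPMap.mem_graph_iff _).1 h'
    replace e : (y' : CMod n VR) = T.op y := e
    have hm : T.op y ∈ T.op.domain := e ▸ y'.2
    have := (T.isQInv_Qinv hs).left_inv y hm
    rw [Q, re_slicePt hJ, norm_slicePt hJ] at this
    obtain rfl : y' = ⟨T.op y, hm⟩ := Subtype.ext e
    exact this
  rightLinear₁ := (T.isQInv_Qinv hs).rightLinear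
  rightLinear₂ s v := by
    rw [TQinv_apply, TQinv_apply, ← T.map_rmul]
    congr 1
    exact Subtype.ext ((T.isQInv_Qinv hs).rightLinear s v)

namespace IsRes

variable {T : ClosedOp n VR} {z w : ℂ} {R P R' P' : CMod n VR →L[ℝ] CMod n VR}

theorem congr (h : T.IsRes z R P) (hre : z.re = w.re) (hn : ‖z‖ = ‖w‖) : T.IsRes w R P where
  graph₁ := h.graph₁
  graph₂ := by rw [← hre, ← hn]; exact h.graph₂
  left := by rw [← hre, ← hn]; exact h.left
  rightLinear₁ := h.rightLinear₁
  rightLinear₂ := h.rightLinear₂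

theorem unique (h : T.IsRes z R P) (h' : T.IsRes z R' P') : R = R' ∧ P = P' := by
  have e : ∀ v, R v = R' v := fun v => by
    have := h.left _ _ _ (h'.graph₁ v) (h'.graph₂ v)
    rwa [show v + (2 * z.re) • P' v - ‖z‖ ^ 2 • R' v - (2 * z.re) • P' v + ‖z‖ ^ 2 • R' v = v by
      abel] at this
  refine ⟨ContinuousLinearMap.ext e, ContinuousLinearMap.ext fun v => ?_⟩
  have h1 := h.graph₁ v
  rw [e] at h1
  exact T.graph_unique h1 (h'.graph₁ v)

/-- `P v` lies in `dom T²` and `Q (P v) = T v`, so inverting `Q` gives `R T v = P v = T R v`. All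
the commutation rules below rest on this. -/
theorem apply_graph (h : T.IsRes z R P) {v v₁ : CMod n VR} (hv : (v, v₁) ∈ T.op.graph) :
    R v₁ = P v := by
  have h1 := h.graph₂ v
  have h2 := T.op.graph.sub_mem (T.op.graph.add_mem hv (T.op.graph.smul_mem (2 * z.re) h1))
    (T.op.graph.smul_mem (‖z‖ ^ 2) (h.graph₁ v))
  have := h.left _ _ _ h1 h2
  simp only [Prod.smul_mk, Prod.mk_add_mk] at this
  rw [← this]
  congr 1
  abel

theorem comm₁ (h : T.IsRes z R P) (h' : T.IsRes w R' P') (v : CMod n VR) :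
    P (R' v) = R (P' v) := (h.apply_graph (h'.graph₁ v)).symm

/-- `P` applied to `P' v` is `R` applied to `T P' v`, and `T P' = T² R'` is known from `Q_w R' = 1`.
-/
theorem comp_PP (h : T.IsRes z R P) (h' : T.IsRes w R' P') (v : CMod n VR) :
    P (P' v) = R v + (2 * w.re) • R (P' v) - ‖w‖ ^ 2 • R (R' v) := by
  rw [← h.apply_graph (h'.graph₂ v)]
  simp

/-- `R R' v` lies in `dom T²` and the quadratic operator of `R'` maps it to `R v`. -/
theorem comm_RR (h : T.IsRes z R P) (h' : T.IsRes w R' P') (v : CMod n VR) :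
    R' (R v) = R (R' v) := by
  have g1 := h.graph₁ (R' v)
  rw [h.comm₁ h'] at g1
  have g2 := h.graph₁ (P' v)
  rw [h.comp_PP h'] at g2
  have := h'.left _ _ _ g1 g2
  rw [← this]
  congr 1
  abel

theorem comm_RP (h : T.IsRes z R P) (h' : T.IsRes w R' P') (v : CMod n VR) :
    R' (P v) = R (P' v) := by
  have g1 := h.graph₁ (R' v)
  have g2 := h'.graph₁ (R v)
  rw [h.comm_RR h'] at g2
  rw [← h.comm₁ h', ← h'.comm₁ h]
  exact T.graph_unique g2 g1

theorem comm_PP (h : T.IsRes z R P) (h' : T.IsRes w R' P') (v : CMod n VR) :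
    P' (P v) = P (P' v) := by
  have g1 := h.graph₁ (P' v)
  have g2 := h'.graph₁ (P v)
  rw [h.comm_RP h'] at g2
  exact T.graph_unique g2 g1

/-- `P P' = P' P` is evaluated by `comp_PP` in both orders and the results are compared. -/
theorem R_sub (h : T.IsRes z R P) (h' : T.IsRes w R' P') (v : CMod n VR) :
    R' v - R v = (2 * (w.re - z.re)) • R (P' v) + (‖z‖ ^ 2 - ‖w‖ ^ 2) • R (R' v) := by
  have e1 := h.comp_PP h' v
  have e2 := h'.comp_PP h v
  rw [h.comm_PP h', h.comm_RP h', h.comm_RR h', e1] at e2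
  have : R' v - R v = (2 * w.re) • R (P' v) - ‖w‖ ^ 2 • R (R' v)
      - (2 * z.re) • R (P' v) + ‖z‖ ^ 2 • R (R' v) := by
    linear_combination (norm := module) -e2
  rw [this]
  module

/-- This is `T` applied to `R_sub`, by uniqueness of values in the graph. -/
theorem P_sub (h : T.IsRes z R P) (h' : T.IsRes w R' P') (v : CMod n VR) :
    P' v - P v = (2 * (w.re - z.re)) • P (P' v) + (‖z‖ ^ 2 - ‖w‖ ^ 2) • R (P' v) := by
  have g1 := T.op.graph.sub_mem (h'.graph₁ v) (h.graph₁ v)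
  have g2 := T.op.graph.add_mem (T.op.graph.smul_mem (2 * (w.re - z.re)) (h.graph₁ (P' v)))
    (T.op.graph.smul_mem (‖z‖ ^ 2 - ‖w‖ ^ 2) (h.graph₁ (R' v)))
  simp only [Prod.smul_mk, Prod.mk_add_mk, Prod.mk_sub_mk] at g1 g2
  rw [← h.R_sub h', h.comm₁ h'] at g2
  exact T.graph_unique g1 g2

end IsRes

open Classical in
/-- `Q_s[T]⁻¹` as a function of `z = x + i y`, where `s = x + J y`; zero off the resolvent set. -/
def Rop (T : ClosedOp n VR) (z : ℂ) : CMod n VR →L[ℝ] CMod n VR :=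
  if h : ∃ R P, T.IsRes z R P then h.choose else 0

open Classical in
/-- `T Q_s[T]⁻¹` as a function of `z = x + i y`, where `s = x + J y`; zero off the resolvent set. -/
def Pop (T : ClosedOp n VR) (z : ℂ) : CMod n VR →L[ℝ] CMod n VR :=
  if h : ∃ R P, T.IsRes z R P then h.choose_spec.choose else 0

theorem isRes_Rop (T : ClosedOp n VR) {z : ℂ} (h : ∃ R P, T.IsRes z R P) :
    T.IsRes z (T.Rop z) (T.Pop z) := by
  rw [Rop, Pop, dif_pos h, dif_pos h]
  exact h.choose_spec.choose_spec

/-- `Q_s[T]` involves only the real part and the modulus, which conjugation preserves. -/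
theorem Rop_conj (T : ClosedOp n VR) {z : ℂ} (h : T.IsRes z (T.Rop z) (T.Pop z)) :
    T.Rop (starRingEnd ℂ z) = T.Rop z ∧ T.Pop (starRingEnd ℂ z) = T.Pop z := by
  have h1 : T.IsRes (starRingEnd ℂ z) (T.Rop z) (T.Pop z) := h.congr (by simp) (by simp)
  exact (T.isRes_Rop ⟨_, _, h1⟩).unique h1

/-- The matrix coefficients of the (complexified) resolvent. -/
def resCoeff (T : ClosedOp n VR) (ℓ : CMod n VR →L[ℝ] ℝ) (v : CMod n VR) (z : ℂ) : ℂ :=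
  starRingEnd ℂ z * ℓ (T.Rop z v) - ℓ (T.Pop z v)

/-- The matrix coefficients of products of (complexified) resolvents. -/
def resCoeff₂ (T : ClosedOp n VR) (ℓ : CMod n VR →L[ℝ] ℝ) (v : CMod n VR) (z w : ℂ) : ℂ :=
  starRingEnd ℂ z * resCoeff T (ℓ ∘L T.Rop z) v w - resCoeff T (ℓ ∘L T.Pop z) v w

/-- The resolvent equation. -/
theorem resCoeff_sub (T : ClosedOp n VR) (ℓ : CMod n VR →L[ℝ] ℝ) (v : CMod n VR) {z w : ℂ}
    (h : T.IsRes z (T.Rop z) (T.Pop z)) (h' : T.IsRes w (T.Rop w) (T.Pop w)) :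
    T.resCoeff ℓ v z - T.resCoeff ℓ v w = (w - z) * T.resCoeff₂ ℓ v z w := by
  have e1 := congrArg ℓ (h.R_sub h' v)
  have e2 := congrArg ℓ (h.P_sub h' v)
  have e3 := congrArg ℓ (h.comp_PP h' v)
  have e4 := congrArg ℓ (h.comm₁ h' v)
  simp only [map_sub, map_add, map_smul, smul_eq_mul] at e1 e2 e3 e4
  have hsq : ∀ z : ℂ, ((‖z‖ ^ 2 : ℝ) : ℂ) = z * starRingEnd ℂ z := fun z => by
    rw [Complex.mul_conj, Complex.normSq_eq_norm_sq]
  have hre : ∀ z : ℂ, ((2 * z.re : ℝ) : ℂ) = z + starRingEnd ℂ z := fun z => by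
    rw [Complex.add_conj]
  replace e1 := congrArg (fun x : ℝ => (x : ℂ)) e1
  replace e2 := congrArg (fun x : ℝ => (x : ℂ)) e2
  replace e3 := congrArg (fun x : ℝ => (x : ℂ)) e3
  replace e4 := congrArg (fun x : ℝ => (x : ℂ)) e4
  simp only [mul_sub, Complex.ofReal_sub, Complex.ofReal_add, Complex.ofReal_mul _ (ℓ _), hsq,
    hre] at e1 e2 e3
  simp only [resCoeff₂, resCoeff, ContinuousLinearMap.comp_apply, e4]
  -- Since `z̄ R - w̄ R' = (z̄ - w̄) R - w̄ (R' - R)`, `e1` and `e2` treat the differences, and `e3`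
  -- rewrites the single remaining `R` through products.
  linear_combination -(starRingEnd ℂ w) * e1 + e2 + (starRingEnd ℂ w - starRingEnd ℂ z) * e3

end ClosedOp

end CliffordCalculus

namespace CliffordCalculus

/-! ### Bounds, continuity and holomorphy of the resolvent -/

theorem pt_notMem_cSector (ε : Bool) {u : ℂ} {φ : ℝ} (h0 : 0 ≤ φ) (hu : φ ≤ |u.im|)
    (hu2 : |u.im| < Real.pi / 2) : pt ε u ∉ cSector φ := by
  rw [cSector, mem_ofPred_eq, abs_pt_re ε hu2, abs_pt_im ε hu2, not_lt]
  have := Real.sin_nonneg_of_nonneg_of_le_pi (sub_nonneg.2 hu) (by linarith [Real.pi_pos])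
  rw [Real.sin_sub] at this
  nlinarith [Real.exp_pos u.re]

theorem norm_mul_sin_le_abs_im {z : ℂ} {φ : ℝ} (h0 : 0 ≤ φ) (hφ : φ < Real.pi / 2)
    (h : z ∉ cSector φ) : ‖z‖ * Real.sin φ ≤ |z.im| := by
  have hs : 0 ≤ Real.sin φ := Real.sin_nonneg_of_nonneg_of_le_pi h0 (by linarith [Real.pi_pos])
  have h1 : |z.re| * Real.sin φ ≤ |z.im| * Real.cos φ := not_lt.1 h
  refine abs_le_of_sq_le_sq' ?_ (abs_nonneg _) |>.2
  rw [mul_pow, Complex.sq_norm, Complex.normSq_apply]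
  have h2 := pow_le_pow_left₀ (mul_nonneg (abs_nonneg _) hs) h1 2
  rw [mul_pow, mul_pow, sq_abs, sq_abs] at h2
  rw [sq_abs]
  nlinarith [Real.sin_sq_add_cos_sq φ]

theorem mem_cExt_of_notMem_cSector {z : ℂ} {ω φ : ℝ} (h0 : 0 < ω) (h : ω < φ)
    (hφ : φ < Real.pi / 2) (hz : z ≠ 0) (hzφ : z ∉ cSector φ) : z ∈ cExt ω := by
  have hs : 0 < Real.sin φ := Real.sin_pos_of_pos_of_lt_pi (by linarith) (by linarith)
  have hsω : 0 < Real.sin ω := Real.sin_pos_of_pos_of_lt_pi (by linarith) (by linarith)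
  have h1 : |z.re| * Real.sin φ ≤ |z.im| * Real.cos φ := not_lt.1 hzφ
  have h2 : 0 < |z.im| := lt_of_lt_of_le (mul_pos (norm_pos_iff.2 hz) hs)
    (norm_mul_sin_le_abs_im (by linarith) hφ hzφ)
  have h3 := Real.sin_pos_of_pos_of_lt_pi (sub_pos.2 h) (by linarith [Real.pi_pos])
  rw [Real.sin_sub] at h3
  change |z.re| * Real.sin ω < |z.im| * Real.cos ω
  have h4 : |z.re| * Real.sin ω * Real.sin φ < |z.im| * Real.cos ω * Real.sin φ := by
    nlinarith
  exact lt_of_mul_lt_mul_right h4 hs.le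

/-- No bound on `f` near `z` is assumed: as soon as `a w < 1/2`, the estimate itself yields `‖f w‖ ≤
2 ‖f z‖`. -/
theorem continuousAt_of_norm_sub_le {E : Type*} [NormedAddCommGroup E] {f : ℂ → E} {a : ℂ → ℝ}
    {z : ℂ} (h : ∀ᶠ w in nhds z, ‖f w - f z‖ ≤ a w * ‖f w‖)
    (ha : Filter.Tendsto a (nhds z) (nhds 0)) (ha0 : ∀ w, 0 ≤ a w) : ContinuousAt f z := by
  rw [ContinuousAt, tendsto_iff_norm_sub_tendsto_zero]
  have h2 : Filter.Tendsto (fun w => a w * (2 * ‖f z‖)) (nhds z) (nhds 0) := by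
    simpa using ha.mul_const (2 * ‖f z‖)
  refine squeeze_zero' (Filter.Eventually.of_forall fun w => norm_nonneg _) ?_ h2
  filter_upwards [h, ha.eventually (Iio_mem_nhds (show (0 : ℝ) < 1 / 2 by norm_num))] with w h1 h3
  refine h1.trans (mul_le_mul_of_nonneg_left ?_ (ha0 w))
  have h4 : ‖f w‖ ≤ ‖f w - f z‖ + ‖f z‖ := by
    simpa using norm_add_le (f w - f z) (f z)
  have h3' : a w < 1 / 2 := h3
  nlinarith [norm_nonneg (f w)]

variable {n : ℕ} {VR : Type*} [NormedAddCommGroup VR] [NormedSpace ℝ VR]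

namespace ClosedOp

namespace IsRes

variable {T : ClosedOp n VR} {z w : ℂ} {R P R' P' : CMod n VR →L[ℝ] CMod n VR}

/-- In the identities for `R' - R` and `P' - P` every product can be arranged to end in the primed
operator being compared. This is the self-referential shape that `continuousAt_of_norm_sub_le`
accepts. -/
theorem norm_sub_le (h : T.IsRes z R P) (h' : T.IsRes w R' P') :
    ‖R' - R‖ ≤ (2 * |w.re - z.re| * ‖P‖ + |‖z‖ ^ 2 - ‖w‖ ^ 2| * ‖R‖) * ‖R'‖ ∧
      ‖P' - P‖ ≤ (2 * |w.re - z.re| * ‖P‖ + |‖z‖ ^ 2 - ‖w‖ ^ 2| * ‖R‖) * ‖P'‖ := by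
  have e1 : R' - R = (2 * (w.re - z.re)) • (P ∘L R') + (‖z‖ ^ 2 - ‖w‖ ^ 2) • (R ∘L R') :=
    ContinuousLinearMap.ext fun v => by
      simpa [h.comm₁ h'] using h.R_sub h' v
  have e2 : P' - P = (2 * (w.re - z.re)) • (P ∘L P') + (‖z‖ ^ 2 - ‖w‖ ^ 2) • (R ∘L P') :=
    ContinuousLinearMap.ext fun v => by simpa using h.P_sub h' v
  have key : ∀ A : CMod n VR →L[ℝ] CMod n VR,
      ‖(2 * (w.re - z.re)) • (P ∘L A) + (‖z‖ ^ 2 - ‖w‖ ^ 2) • (R ∘L A)‖ ≤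
        (2 * |w.re - z.re| * ‖P‖ + |‖z‖ ^ 2 - ‖w‖ ^ 2| * ‖R‖) * ‖A‖ := fun A => by
    refine (norm_add_le _ _).trans ?_
    rw [norm_smul, norm_smul, Real.norm_eq_abs, Real.norm_eq_abs, abs_mul, abs_two, add_mul,
      mul_assoc _ ‖P‖, mul_assoc _ ‖R‖]
    gcongr <;> exact ContinuousLinearMap.opNorm_comp_le _ _
  rw [e1, e2]
  exact ⟨key _, key _⟩

end IsRes

variable [CompleteSpace VR]

namespace IsBisectorial

variable {T : ClosedOp n VR} {ω : ℝ}

theorem mem_resolventSet (hT : T.IsBisectorial ω) (hω : ω < Real.pi / 2) {J : Cl n}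
    (hJ : J ∈ imagSphere n) {z : ℂ} (hz : z ∈ cExt ω) :
    slicePt J z.re z.im ∈ T.resolventSet := by
  by_contra h
  have := closure_doubleSector_subset hω
    (hT.spectrum_subset ⟨slicePt_mem_paravectors hJ z.re z.im, h⟩)
  rw [slicePt_sub_re hJ, re_slicePt hJ] at this
  exact absurd hz (not_lt.2 this)

theorem isRes (hT : T.IsBisectorial ω) (hn : 1 ≤ n) (hω : ω < Real.pi / 2) {z : ℂ}
    (hz : z ∈ cExt ω) : T.IsRes z (T.Rop z) (T.Pop z) := by
  have hJ := unitVec_mem_imagSphere (⟨0, hn⟩ : Fin n)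
  exact T.isRes_Rop ⟨_, _, T.isRes_Qinv hJ (hT.mem_resolventSet hω hJ hz)⟩

theorem SL_slicePt (hT : T.IsBisectorial ω) (hn : 1 ≤ n) (hω : ω < Real.pi / 2) {J : Cl n}
    (hJ : J ∈ imagSphere n) {z : ℂ} (hz : z ∈ cExt ω) :
    T.SL (slicePt J z.re z.im) = T.Rop z ∘L lmul (slicePt J z.re (-z.im)) - T.Pop z := by
  have hs := hT.mem_resolventSet hω hJ hz
  obtain ⟨e1, e2⟩ := (T.isRes_Qinv hJ hs).unique (hT.isRes hn hω hz)
  rw [SL, dif_pos hs, e1, e2, conj_slicePt hJ]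

theorem Rop_conj (hT : T.IsBisectorial ω) (hn : 1 ≤ n) (hω : ω < Real.pi / 2) {z : ℂ}
    (hz : z ∈ cExt ω) :
    T.Rop (starRingEnd ℂ z) = T.Rop z ∧ T.Pop (starRingEnd ℂ z) = T.Pop z :=
  T.Rop_conj (hT.isRes hn hω hz)

/-- The hypothesis bounds only the combination `R s̄ - P`. Subtracting its values at `s` and `s̄`
eliminates `P` and leaves `2 y R J`; outside the sector `|y| ≥ |z| sin φ`, so `R` is controlled. The
bound on `P` follows from that on `R`. -/
theorem exists_norm_le (hT : T.IsBisectorial ω) (hn : 1 ≤ n) (hω0 : 0 < ω) {φ : ℝ}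
    (hφ : φ ∈ Ioo ω (Real.pi / 2)) : ∃ C, 0 ≤ C ∧ ∀ z ≠ 0, z ∉ cSector φ →
      ‖T.Rop z‖ * ‖z‖ ^ 2 ≤ C ∧ ‖T.Pop z‖ * ‖z‖ ≤ C := by
  obtain ⟨C, hC, hSL⟩ := hT.norm_SL_le φ hφ
  have hω : ω < Real.pi / 2 := hφ.1.trans hφ.2
  have hφ0 : 0 < φ := hω0.trans hφ.1
  have hs : 0 < Real.sin φ := Real.sin_pos_of_pos_of_lt_pi hφ0 (by linarith [hφ.2])
  obtain ⟨J, hJ⟩ : ∃ J, J ∈ imagSphere n := ⟨_, unitVec_mem_imagSphere (⟨0, hn⟩ : Fin n)⟩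
  set K := ‖lmulL n VR‖ with hK
  have hK0 : 0 ≤ K := by rw [hK]; positivity
  have hCK : 0 ≤ C * K / Real.sin φ := by positivity
  refine ⟨C * K / Real.sin φ + (K * (C * K / Real.sin φ) + C), by positivity, fun z hz hzφ => ?_⟩
  have hzpos : 0 < ‖z‖ := norm_pos_iff.2 hz
  have hext := mem_cExt_of_notMem_cSector hω0 hφ.1 hφ.2 hz hzφ
  have bound : ∀ w : ℂ, ‖w‖ = ‖z‖ → w ∉ cSector φ →
      ‖T.SL (slicePt J w.re w.im)‖ ≤ C / ‖z‖ := fun w hw hwφ => by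
    rw [← hw, ← norm_slicePt hJ w]
    refine hSL _ ⟨slicePt_mem_paravectors hJ _ _, ?_⟩
    rintro (h | h)
    · exact hwφ ((slicePt_mem_doubleSector hJ hφ0 hφ.2).1 h)
    · have := norm_slicePt hJ w
      rw [mem_singleton_iff.1 h, norm_zero, hw] at this
      exact hzpos.ne this
  have hz'φ : starRingEnd ℂ z ∉ cSector φ := by
    intro h; apply hzφ
    simpa [cSector] using h
  have hext' := mem_cExt_of_notMem_cSector hω0 hφ.1 hφ.2 (by simpa using hz) hz'φ
  have b1 := bound z rfl hzφ
  have b2 := bound (starRingEnd ℂ z) (by simp) hz'φ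
  have f1 := hT.SL_slicePt hn hω hJ hext
  have f2 := hT.SL_slicePt hn hω hJ hext'
  rw [(hT.Rop_conj hn hω hext).1, (hT.Rop_conj hn hω hext).2] at f2
  simp only [Complex.conj_re, Complex.conj_im, neg_neg] at f2 b2
  -- `R` and `P` are the same at both points, so `S(s̄) - S(s) = R (s - s̄) = 2 y R J`, and the
  -- factor `-J` on the right removes `J`.
  have hR : (2 * z.im) • T.Rop z =
      (T.SL (slicePt J z.re (-z.im)) - T.SL (slicePt J z.re z.im)) ∘L lmul (-J) := by
    have e : (slicePt J z.re z.im - slicePt J z.re (-z.im)) * (-J) = (2 * z.im) • (1 : Cl n) := by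
      have h1 : slicePt J z.re z.im - slicePt J z.re (-z.im) = (2 * z.im) • J := by
        simp only [slicePt]; module
      rw [h1, smul_mul_assoc, mul_neg, imagSphere_mul_self hJ, neg_neg]
    have e2 : (lmul (slicePt J z.re z.im) : CMod n VR →L[ℝ] CMod n VR) -
        lmul (slicePt J z.re (-z.im)) = lmul (slicePt J z.re z.im - slicePt J z.re (-z.im)) := by
      simp only [← lmulL_apply, map_sub]
    rw [f1, f2, sub_sub_sub_cancel_right, ← ContinuousLinearMap.comp_sub, e2,
      ContinuousLinearMap.comp_assoc, lmul_comp_lmul, e, ← lmulL_apply, map_smul, lmulL_apply,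
      lmul_one_eq_id]
    ext v; simp
  have hJn : ‖(lmul (-J) : CMod n VR →L[ℝ] CMod n VR)‖ ≤ K := by
    simpa [hJ.2.2] using norm_lmul_le (VR := VR) (-J)
  have hR1 : 2 * |z.im| * ‖T.Rop z‖ ≤ (C / ‖z‖ + C / ‖z‖) * K := by
    have := congrArg norm hR
    rw [norm_smul, Real.norm_eq_abs, abs_mul, abs_two] at this
    rw [this]
    refine (ContinuousLinearMap.opNorm_comp_le _ _).trans ?_
    exact mul_le_mul ((norm_sub_le _ _).trans (add_le_add b2 b1)) hJn (norm_nonneg _)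
      (by positivity)
  have him := norm_mul_sin_le_abs_im hφ0.le hφ.2 hzφ
  have hR2 : ‖T.Rop z‖ * ‖z‖ ^ 2 ≤ C * K / Real.sin φ := by
    rw [le_div_iff₀ hs]
    have h1 : |z.im| * ‖T.Rop z‖ * ‖z‖ ≤ C * K := by
      have h2 := mul_le_mul_of_nonneg_right hR1 hzpos.le
      have h3 : (C / ‖z‖ + C / ‖z‖) * K * ‖z‖ = 2 * (C * K) := by field_simp; ring
      rw [h3] at h2
      linarith
    have h4 := mul_le_mul_of_nonneg_right him (mul_nonneg (norm_nonneg (T.Rop z)) hzpos.le)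
    nlinarith
  refine ⟨hR2.trans (le_add_of_nonneg_right (by positivity)), ?_⟩
  have hP : T.Pop z = T.Rop z ∘L lmul (slicePt J z.re (-z.im)) - T.SL (slicePt J z.re z.im) := by
    rw [f1]; abel
  have hn' : ‖slicePt J z.re (-z.im)‖ = ‖z‖ := by
    simpa using norm_slicePt hJ (starRingEnd ℂ z)
  have hP1 : ‖T.Pop z‖ ≤ ‖T.Rop z‖ * (K * ‖z‖) + C / ‖z‖ := by
    rw [hP]
    refine (norm_sub_le _ _).trans (add_le_add ?_ b1)
    refine (ContinuousLinearMap.opNorm_comp_le _ _).trans ?_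
    gcongr
    rw [← hn']
    exact norm_lmul_le _
  have hP2 := mul_le_mul_of_nonneg_right hP1 hzpos.le
  have h5 : (‖T.Rop z‖ * (K * ‖z‖) + C / ‖z‖) * ‖z‖ = K * (‖T.Rop z‖ * ‖z‖ ^ 2) + C := by
    field_simp
  rw [h5] at hP2
  have := mul_le_mul_of_nonneg_left hR2 hK0
  linarith

theorem continuousAt_Rop_Pop (hT : T.IsBisectorial ω) (hn : 1 ≤ n) (hω : ω < Real.pi / 2) {z : ℂ}
    (hz : z ∈ cExt ω) : ContinuousAt T.Rop z ∧ ContinuousAt T.Pop z := by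
  have hev : ∀ᶠ w in nhds z, w ∈ cExt ω := (isOpen_cExt ω).mem_nhds hz
  have ha : Filter.Tendsto (fun w : ℂ => 2 * |w.re - z.re| * ‖T.Pop z‖ +
      |‖z‖ ^ 2 - ‖w‖ ^ 2| * ‖T.Rop z‖) (nhds z) (nhds 0) := by
    have : ContinuousAt (fun w : ℂ => 2 * |w.re - z.re| * ‖T.Pop z‖ +
      |‖z‖ ^ 2 - ‖w‖ ^ 2| * ‖T.Rop z‖) z := by fun_prop
    simpa using this.tendsto
  have key := fun w (hw : w ∈ cExt ω) =>
    (hT.isRes hn hω hz).norm_sub_le (hT.isRes hn hω hw)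
  exact ⟨continuousAt_of_norm_sub_le (hev.mono fun w hw => (key w hw).1) ha fun w => by positivity,
    continuousAt_of_norm_sub_le (hev.mono fun w hw => (key w hw).2) ha fun w => by positivity⟩

theorem continuousAt_resCoeff (hT : T.IsBisectorial ω) (hn : 1 ≤ n) (hω : ω < Real.pi / 2)
    (ℓ : CMod n VR →L[ℝ] ℝ) (v : CMod n VR) {z : ℂ} (hz : z ∈ cExt ω) :
    ContinuousAt (T.resCoeff ℓ v) z := by
  obtain ⟨h1, h2⟩ := hT.continuousAt_Rop_Pop hn hω hz
  have hc : ∀ A : ℂ → CMod n VR →L[ℝ] CMod n VR, ContinuousAt A z →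
      ContinuousAt (fun w => (ℓ (A w v) : ℂ)) z := fun A hA =>
    Complex.continuous_ofReal.continuousAt.comp
      (ℓ.continuous.continuousAt.comp (hA.clm_apply continuousAt_const))
  exact (Complex.continuous_conj.continuousAt.mul (hc _ h1)).sub (hc _ h2)

/-- By the resolvent equation the difference quotient at `z` is `-resCoeff₂ z w`. With `z` fixed
this is a combination of coefficients for the functionals `ℓ ∘ R_z` and `ℓ ∘ P_z`, so it is
continuous in `w`. -/
theorem differentiableOn_resCoeff (hT : T.IsBisectorial ω) (hn : 1 ≤ n) (hω : ω < Real.pi / 2)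
    (ℓ : CMod n VR →L[ℝ] ℝ) (v : CMod n VR) : DifferentiableOn ℂ (T.resCoeff ℓ v) (cExt ω) := by
  intro z hz
  refine DifferentiableAt.differentiableWithinAt (HasDerivAt.differentiableAt
    (f' := -T.resCoeff₂ ℓ v z z) ?_)
  rw [hasDerivAt_iff_tendsto_slope]
  have hc : ContinuousAt (fun w => -T.resCoeff₂ ℓ v z w) z :=
    ((continuousAt_const.mul (hT.continuousAt_resCoeff hn hω _ v hz)).sub
      (hT.continuousAt_resCoeff hn hω _ v hz)).neg
  refine (hc.tendsto.mono_left nhdsWithin_le_nhds).congr' ?_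
  filter_upwards [self_mem_nhdsWithin,
    mem_nhdsWithin_of_mem_nhds ((isOpen_cExt ω).mem_nhds hz)] with w hw hwe
  have h1 := T.resCoeff_sub ℓ v (hT.isRes hn hω hz) (hT.isRes hn hω hwe)
  have h2 : w - z ≠ 0 := sub_ne_zero.2 hw
  rw [slope_def_field, eq_div_iff h2]
  linear_combination h1

theorem exists_norm_resCoeff_le (hT : T.IsBisectorial ω) (hn : 1 ≤ n) (hω0 : 0 < ω) {φ : ℝ}
    (hφ : φ ∈ Ioo ω (Real.pi / 2)) (ℓ : CMod n VR →L[ℝ] ℝ) (v : CMod n VR) :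
    ∃ C, ∀ z ≠ 0, z ∉ cSector φ → ‖z * T.resCoeff ℓ v z‖ ≤ C := by
  obtain ⟨C, hC, h⟩ := hT.exists_norm_le hn hω0 hφ
  refine ⟨2 * (‖ℓ‖ * C * ‖v‖), fun z hz hzφ => ?_⟩
  obtain ⟨h1, h2⟩ := h z hz hzφ
  have key : ∀ A : CMod n VR →L[ℝ] CMod n VR, ‖(ℓ (A v) : ℂ)‖ ≤ ‖ℓ‖ * ‖A‖ * ‖v‖ := fun A => by
    rw [Complex.norm_real]
    refine (ℓ.le_opNorm _).trans ?_
    rw [mul_assoc]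
    gcongr
    exact A.le_opNorm v
  have h3 := key (T.Rop z)
  have h4 := key (T.Pop z)
  have hz0 := norm_nonneg z
  calc ‖z * T.resCoeff ℓ v z‖ ≤ ‖z‖ * (‖z‖ * ‖(ℓ (T.Rop z v) : ℂ)‖ + ‖(ℓ (T.Pop z v) : ℂ)‖) := by
        rw [norm_mul, resCoeff]
        gcongr
        refine (norm_sub_le _ _).trans ?_
        rw [norm_mul, RCLike.norm_conj]
    _ ≤ ‖z‖ * (‖z‖ * (‖ℓ‖ * ‖T.Rop z‖ * ‖v‖) + ‖ℓ‖ * ‖T.Pop z‖ * ‖v‖) := by gcongr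
    _ = ‖ℓ‖ * (‖T.Rop z‖ * ‖z‖ ^ 2) * ‖v‖ + ‖ℓ‖ * (‖T.Pop z‖ * ‖z‖) * ‖v‖ := by ring
    _ ≤ ‖ℓ‖ * C * ‖v‖ + ‖ℓ‖ * C * ‖v‖ := by gcongr
    _ = _ := by ring

theorem resCoeff_conj (hT : T.IsBisectorial ω) (hn : 1 ≤ n) (hω : ω < Real.pi / 2)
    (ℓ : CMod n VR →L[ℝ] ℝ) (v : CMod n VR) {z : ℂ} (hz : z ∈ cExt ω) :
    T.resCoeff ℓ v (starRingEnd ℂ z) = starRingEnd ℂ (T.resCoeff ℓ v z) := by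
  obtain ⟨e1, e2⟩ := hT.Rop_conj hn hω hz
  simp [resCoeff, e1, e2]

end IsBisectorial

end ClosedOp

end CliffordCalculus

namespace CliffordCalculus

namespace HoloDecay

theorem mul {θ : ℝ} {g h : ℂ → ℂ} (hg : HoloDecay θ g) (hh : HoloDecay θ h)
    (hθ : θ < Real.pi / 2) : HoloDecay θ fun z => g z * h z := by
  obtain ⟨C, hC⟩ := hg.bdd
  obtain ⟨D, hD⟩ := hh.bdd
  refine ⟨hg.diff.mul hh.diff, ⟨C * D, fun z hz => ?_⟩, fun ε φ hφ => ?_, fun z hz => ?_⟩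
  · rw [norm_mul]
    exact mul_le_mul (hC z hz) (hD z hz) (norm_nonneg _) ((norm_nonneg _).trans (hC z hz))
  · exact (hh.int ε φ hφ).bdd_mul (c := C) (hg.int ε φ hφ).1
      (Filter.Eventually.of_forall fun τ => hC _ (pt_mem_cSector ε (by simpa using hφ) hθ))
  · rw [hg.symm z hz, hh.symm z hz, map_mul]

end HoloDecay

variable {n : ℕ} {VR : Type*} [NormedAddCommGroup VR] [NormedSpace ℝ VR]

namespace ClosedOp

/-! ### The functional calculus for intrinsic functions -/

/-- The real form of the integrand of the functional calculus for an intrinsic function: the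
imaginary part of `z h(z) (z - T)⁻¹`. -/
def calcIntegrand (T : ClosedOp n VR) (h : ℂ → ℂ) (z : ℂ) : CMod n VR →L[ℝ] CMod n VR :=
  (z * h z).im • (z.re • T.Rop z - T.Pop z) - (z.im * (z * h z).re) • T.Rop z

/-- The operator `h(T)` for an intrinsic function, as an integral over the two rays of the boundary
of the double sector of half-angle `φ` with `arg (± z) = -φ`. -/
def intrinsicCalc (T : ClosedOp n VR) (φ : ℝ) (h : ℂ → ℂ) : CMod n VR →L[ℝ] CMod n VR :=
  Real.pi⁻¹ • ∑ ε : Bool, ∫ τ, T.calcIntegrand h (ray (ε, true) φ τ)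

theorem apply_calcIntegrand (T : ClosedOp n VR) (h : ℂ → ℂ) (z : ℂ) (ℓ : CMod n VR →L[ℝ] ℝ)
    (v : CMod n VR) : ℓ (T.calcIntegrand h z v) = (z * (h z * T.resCoeff ℓ v z)).im := by
  rw [← mul_assoc, calcIntegrand, resCoeff]
  generalize z * h z = q
  simp
  ring

theorem ext_of_forall_dual {A B : CMod n VR →L[ℝ] CMod n VR}
    (h : ∀ (ℓ : CMod n VR →L[ℝ] ℝ) v, (ℓ (A v) : ℂ) = ℓ (B v)) : A = B :=
  ContinuousLinearMap.ext fun v =>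
    (SeparatingDual.eq_iff_forall_dual_eq (R := ℝ)).2 fun ℓ => Complex.ofReal_injective (h ℓ v)

variable [CompleteSpace VR]

namespace IsBisectorial

variable {T : ClosedOp n VR} {ω θ : ℝ}

theorem ray_mem_cExt {φ : ℝ} (h0 : 0 < ω) (h : ω < φ) (hφ : φ < Real.pi / 2) (p : Bool × Bool)
    (τ : ℝ) : ray p φ τ ∈ cExt ω :=
  pt_mem_cExt _ h0.le (by rwa [hline_im, abs_neg_sg_mul _ (h0.trans h)])
    (by rwa [hline_im, abs_neg_sg_mul _ (h0.trans h)])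

theorem ray_notMem_cSector {φ φ' : ℝ} (h0 : 0 < φ') (h : φ' ≤ φ) (hφ : φ < Real.pi / 2)
    (p : Bool × Bool) (τ : ℝ) : ray p φ τ ∉ cSector φ' :=
  pt_notMem_cSector _ h0.le (by rwa [hline_im, abs_neg_sg_mul _ (h0.trans_le h)])
    (by rwa [hline_im, abs_neg_sg_mul _ (h0.trans_le h)])

theorem continuous_Rop_Pop_ray (hT : T.IsBisectorial ω) (hn : 1 ≤ n) (hω : 0 < ω) {φ : ℝ}
    (hφ : φ ∈ Ioo ω (Real.pi / 2)) (p : Bool × Bool) :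
    (Continuous fun τ => T.Rop (ray p φ τ)) ∧ Continuous fun τ => T.Pop (ray p φ τ) := by
  have key := fun τ => hT.continuousAt_Rop_Pop hn (hφ.1.trans hφ.2)
    (ray_mem_cExt hω hφ.1 hφ.2 p τ)
  have hc := continuous_ray p φ
  exact ⟨continuous_iff_continuousAt.2 fun τ =>
      ContinuousAt.comp (f := ray p φ) (key τ).1 hc.continuousAt,
    continuous_iff_continuousAt.2 fun τ =>
      ContinuousAt.comp (f := ray p φ) (key τ).2 hc.continuousAt⟩

theorem continuous_resCoeff_ray (hT : T.IsBisectorial ω) (hn : 1 ≤ n) (hω : 0 < ω) {φ : ℝ}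
    (hφ : φ ∈ Ioo ω (Real.pi / 2)) (ℓ : CMod n VR →L[ℝ] ℝ) (v : CMod n VR) (p : Bool × Bool) :
    Continuous fun τ => T.resCoeff ℓ v (ray p φ τ) :=
  continuous_iff_continuousAt.2 fun τ => ContinuousAt.comp (f := ray p φ)
    (hT.continuousAt_resCoeff hn (hφ.1.trans hφ.2) ℓ v (ray_mem_cExt hω hφ.1 hφ.2 p τ))
    (continuous_ray p φ).continuousAt

theorem ctrInt_mul_resCoeff (hT : T.IsBisectorial ω) (hn : 1 ≤ n) (hω : 0 < ω)
    (hθ : θ < Real.pi / 2) {φ : ℝ} (hφ : φ ∈ Ioo ω θ) {h : ℂ → ℂ} (hh : HoloDecay θ h)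
    (ℓ : CMod n VR →L[ℝ] ℝ) (v : CMod n VR) : CtrInt φ fun z => h z * T.resCoeff ℓ v z := by
  have hφ' : φ ∈ Ioo ω (Real.pi / 2) := ⟨hφ.1, hφ.2.trans hθ⟩
  obtain ⟨C, hC⟩ := hT.exists_norm_resCoeff_le hn hω hφ' ℓ v
  exact hh.ctrInt_mul (hω.trans hφ.1) hφ.2 (hT.continuous_resCoeff_ray hn hω hφ' ℓ v)
    fun p τ => hC _ (ray_ne_zero p φ τ)
      (ray_notMem_cSector (hω.trans hφ.1) le_rfl hφ'.2 p τ)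

theorem integrable_calcIntegrand (hT : T.IsBisectorial ω) (hn : 1 ≤ n) (hω : 0 < ω)
    (hθ : θ < Real.pi / 2) {φ : ℝ} (hφ : φ ∈ Ioo ω θ) {h : ℂ → ℂ} (hh : HoloDecay θ h)
    (p : Bool × Bool) : Integrable fun τ => T.calcIntegrand h (ray p φ τ) := by
  have hφ' : φ ∈ Ioo ω (Real.pi / 2) := ⟨hφ.1, hφ.2.trans hθ⟩
  have hφ0 := hω.trans hφ.1
  obtain ⟨C, hC, hb⟩ := hT.exists_norm_le hn hω hφ'
  have hr := continuous_ray p φ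
  have hhr := hh.continuous_ray hθ hφ0 hφ.2 p
  obtain ⟨cR, cP⟩ := hT.continuous_Rop_Pop_ray hn hω hφ' p
  have hcont : Continuous fun τ => T.calcIntegrand h (ray p φ τ) := by
    have hq := hr.mul hhr
    exact ((Complex.continuous_im.comp hq).smul
      (((Complex.continuous_re.comp hr).smul cR).sub cP)).sub
        (((Complex.continuous_im.comp hr).mul (Complex.continuous_re.comp hq)).smul cR)
  refine ((hh.integrable_ray hφ0 hφ.2 p).norm.const_mul (3 * C)).mono' hcont.aestronglyMeasurable
    (Filter.Eventually.of_forall fun τ => ?_)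
  obtain ⟨b1, b2⟩ := hb _ (ray_ne_zero p φ τ) (ray_notMem_cSector hφ0 le_rfl hφ'.2 p τ)
  generalize ray p φ τ = z at *
  have e1 := Complex.abs_im_le_norm (z * h z)
  have e2 := Complex.abs_re_le_norm (z * h z)
  have e3 := Complex.abs_re_le_norm z
  have e4 := Complex.abs_im_le_norm z
  rw [norm_mul] at e1 e2
  calc ‖T.calcIntegrand h z‖
      ≤ |(z * h z).im| * (|z.re| * ‖T.Rop z‖ + ‖T.Pop z‖)
        + |z.im| * |(z * h z).re| * ‖T.Rop z‖ := by
        refine (norm_sub_le _ _).trans ?_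
        rw [norm_smul, norm_smul, Real.norm_eq_abs, Real.norm_eq_abs, abs_mul]
        gcongr
        refine (norm_sub_le _ _).trans ?_
        rw [norm_smul, Real.norm_eq_abs]
    _ ≤ (‖z‖ * ‖h z‖) * (‖z‖ * ‖T.Rop z‖ + ‖T.Pop z‖) + ‖z‖ * (‖z‖ * ‖h z‖) * ‖T.Rop z‖ := by
        gcongr
    _ = ‖h z‖ * (2 * (‖T.Rop z‖ * ‖z‖ ^ 2) + ‖T.Pop z‖ * ‖z‖) := by ring
    _ ≤ ‖h z‖ * (2 * C + C) := by gcongr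
    _ = _ := by ring

/-- The bridge from operator integrals to scalar contour integrals. The rays `(ε, false)` are
conjugate to `(ε, true)` and the integrand is symmetric, so each pair contributes `(2πi)⁻¹ (c - c̄)
= Im c / π`. -/
theorem apply_intrinsicCalc (hT : T.IsBisectorial ω) (hn : 1 ≤ n) (hω : 0 < ω)
    (hθ : θ < Real.pi / 2) {φ : ℝ} (hφ : φ ∈ Ioo ω θ) {h : ℂ → ℂ} (hh : HoloDecay θ h)
    (ℓ : CMod n VR →L[ℝ] ℝ) (v : CMod n VR) :
    (ℓ (T.intrinsicCalc φ h v) : ℂ) = ctr φ fun z => h z * T.resCoeff ℓ v z := by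
  have hφ0 := hω.trans hφ.1
  have hφ2 := hφ.2.trans hθ
  let e : (CMod n VR →L[ℝ] CMod n VR) →L[ℝ] ℝ :=
    ℓ ∘L (ContinuousLinearMap.apply ℝ (CMod n VR) v)
  set k : ℂ → ℂ := fun z => h z * T.resCoeff ℓ v z with hk
  have hi := hT.ctrInt_mul_resCoeff hn hω hθ hφ hh ℓ v
  have h1 : ℓ (T.intrinsicCalc φ h v) = Real.pi⁻¹ * ∑ ε : Bool,
      (∫ τ, ray (ε, true) φ τ * k (ray (ε, true) φ τ)).im := by
    have : ℓ (T.intrinsicCalc φ h v) = e (T.intrinsicCalc φ h) := rfl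
    rw [this, intrinsicCalc, map_smul, map_sum, smul_eq_mul]
    congr 1
    refine Finset.sum_congr rfl fun ε _ => ?_
    rw [← e.integral_comp_comm (hT.integrable_calcIntegrand hn hω hθ hφ hh (ε, true)),
      ← Complex.imCLM_apply, ← Complex.imCLM.integral_comp_comm (hi (ε, true))]
    exact integral_congr_ae (Filter.Eventually.of_forall fun τ =>
      T.apply_calcIntegrand h _ ℓ v)
  have h2 : ∀ ε, ∫ τ, ray (ε, false) φ τ * k (ray (ε, false) φ τ) =
      starRingEnd ℂ (∫ τ, ray (ε, true) φ τ * k (ray (ε, true) φ τ)) := fun ε => by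
    rw [← integral_conj]
    refine integral_congr_ae (Filter.Eventually.of_forall fun τ => ?_)
    have hr : ray (ε, false) φ τ = starRingEnd ℂ (ray (ε, true) φ τ) := by
      simp [ray, conj_pt]
    simp only [hr, hk, map_mul, hh.symm _ (HoloDecay.ray_mem hθ hφ0 hφ.2 _ _),
      hT.resCoeff_conj hn (hφ.1.trans hφ2) ℓ v (ray_mem_cExt hω hφ.1 hφ2 _ _)]
  rw [h1, ctr, Fintype.sum_prod_type, Complex.ofReal_mul, Complex.ofReal_sum, Finset.mul_sum,
    Finset.mul_sum]
  refine Finset.sum_congr rfl fun ε _ => ?_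
  rw [Fintype.sum_bool, h2]
  simp only [sg_true, sg_false]
  push_cast
  rw [neg_one_mul, one_mul, ← sub_eq_add_neg, Complex.sub_conj]
  have := Complex.I_ne_zero
  have hpi : (Real.pi : ℂ) ≠ 0 := by simp [Real.pi_ne_zero]
  push_cast
  field_simp

/-- `h(T)` does not depend on the angle of the contour. -/
theorem intrinsicCalc_eq (hT : T.IsBisectorial ω) (hn : 1 ≤ n) (hω : 0 < ω)
    (hθ : θ < Real.pi / 2) {φ φ' : ℝ} (hφ : φ ∈ Ioo ω θ) (hφ' : φ' ∈ Ioo ω θ) {h : ℂ → ℂ}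
    (hh : HoloDecay θ h) : T.intrinsicCalc φ h = T.intrinsicCalc φ' h := by
  refine ext_of_forall_dual fun ℓ v => ?_
  rw [hT.apply_intrinsicCalc hn hω hθ hφ hh, hT.apply_intrinsicCalc hn hω hθ hφ' hh]
  obtain ⟨C, hC⟩ := hh.bdd
  have hm : min φ φ' ∈ Ioo ω (Real.pi / 2) :=
    ⟨lt_min hφ.1 hφ'.1, (min_le_left _ _).trans_lt (hφ.2.trans hθ)⟩
  obtain ⟨D, hD⟩ := hT.exists_norm_resCoeff_le hn hω hm ℓ v
  have hω2 : ω < Real.pi / 2 := hm.1.trans hm.2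
  refine ctr_eq_ctr (C := C * D) hω.le hθ hφ hφ' ?_ ?_
    (hT.ctrInt_mul_resCoeff hn hω hθ hφ hh ℓ v) (hT.ctrInt_mul_resCoeff hn hω hθ hφ' hh ℓ v)
  · exact (hh.diff.mono inter_subset_left).mul
      ((hT.differentiableOn_resCoeff hn hω2 ℓ v).mono inter_subset_right)
  · rintro _ ε u rfl hu
    have hu1 : min φ φ' ≤ |u.im| := hu.1
    have hu2 : |u.im| < θ := hu.2.trans_lt (max_lt hφ.2 hφ'.2)
    have b1 := hC _ (pt_mem_cSector ε hu2 hθ)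
    have b2 := hD _ (pt_ne_zero ε u)
      (pt_notMem_cSector ε (hω.trans hm.1).le hu1 (hu2.trans hθ))
    rw [mul_left_comm, norm_mul]
    exact mul_le_mul b1 b2 (norm_nonneg _) ((norm_nonneg _).trans b1)

/-- `ℓ ∘ R_z` and `ℓ ∘ P_z` are again functionals, so the outer resolvent moves under the integral
defining `h(T)`. -/
theorem resCoeff_intrinsicCalc (hT : T.IsBisectorial ω) (hn : 1 ≤ n) (hω : 0 < ω)
    (hθ : θ < Real.pi / 2) {φ : ℝ} (hφ : φ ∈ Ioo ω θ) {h : ℂ → ℂ} (hh : HoloDecay θ h)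
    (ℓ : CMod n VR →L[ℝ] ℝ) (v : CMod n VR) (z : ℂ) :
    T.resCoeff ℓ (T.intrinsicCalc φ h v) z = ctr φ fun w => h w * T.resCoeff₂ ℓ v z w := by
  have i1 := hT.ctrInt_mul_resCoeff hn hω hθ hφ hh (ℓ ∘L T.Rop z) v
  have i2 := hT.ctrInt_mul_resCoeff hn hω hθ hφ hh (ℓ ∘L T.Pop z) v
  have i1' : CtrInt φ fun w => starRingEnd ℂ z * (h w * T.resCoeff (ℓ ∘L T.Rop z) v w) :=
    fun p => ((i1 p).const_mul (starRingEnd ℂ z)).congr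
      (Filter.Eventually.of_forall fun τ => by simp only; ring)
  have e : ∀ A : CMod n VR →L[ℝ] CMod n VR, (ℓ (A (T.intrinsicCalc φ h v)) : ℂ) =
      ctr φ fun w => h w * T.resCoeff (ℓ ∘L A) v w := fun A =>
    hT.apply_intrinsicCalc hn hω hθ hφ hh (ℓ ∘L A) v
  rw [resCoeff, e, e, ← ctr_const_mul, ← ctr_sub i1' i2]
  congr 1
  ext w
  rw [resCoeff₂]
  ring

/-- The product rule for intrinsic functions. -/
theorem intrinsicCalc_comp (hT : T.IsBisectorial ω) (hn : 1 ≤ n) (hω : 0 < ω)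
    (hθ : θ < Real.pi / 2) {φ₁ φ₂ : ℝ} (hφ₁ : φ₁ ∈ Ioo ω θ) (hφ₂ : φ₂ ∈ Ioo ω θ) {g h : ℂ → ℂ}
    (hg : HoloDecay θ g) (hh : HoloDecay θ h) :
    T.intrinsicCalc φ₁ g ∘L T.intrinsicCalc φ₂ h = T.intrinsicCalc φ₁ fun z => g z * h z := by
  -- The contour of `h(T)` is moved strictly outside that of `g(T)`, as the Cauchy argument
  -- requires.
  obtain ⟨φ₃, hφ₃⟩ := exists_between hφ₁.2
  have hφ₃' : φ₃ ∈ Ioo ω θ := ⟨hφ₁.1.trans hφ₃.1, hφ₃.2⟩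
  rw [hT.intrinsicCalc_eq hn hω hθ hφ₂ hφ₃' hh]
  have hφ₁' : φ₁ ∈ Ioo ω (Real.pi / 2) := ⟨hφ₁.1, hφ₁.2.trans hθ⟩
  have hφ₃'' : φ₃ ∈ Ioo ω (Real.pi / 2) := ⟨hφ₃'.1, hφ₃'.2.trans hθ⟩
  have hφ0 := hω.trans hφ₁.1
  refine ext_of_forall_dual fun ℓ v => ?_
  rw [ContinuousLinearMap.comp_apply, hT.apply_intrinsicCalc hn hω hθ hφ₁ hg,
    hT.apply_intrinsicCalc hn hω hθ hφ₁ (hg.mul hh hθ)]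
  obtain ⟨C, hC⟩ := hT.exists_norm_resCoeff_le hn hω hφ₁' ℓ v
  simp_rw [hT.resCoeff_intrinsicCalc hn hω hθ hφ₃' hh ℓ v]
  exact hg.ctr_resolvent hh hθ hφ0 hφ₃.1 hφ₃.2
    (hT.continuous_resCoeff_ray hn hω hφ₁' ℓ v) (hT.continuous_resCoeff_ray hn hω hφ₃'' ℓ v)
    (fun p τ => hC _ (ray_ne_zero _ _ _) (ray_notMem_cSector hφ0 le_rfl hφ₁'.2 p τ))
    (fun p τ => hC _ (ray_ne_zero _ _ _) (ray_notMem_cSector hφ0 hφ₃.1.le hφ₃''.2 p τ))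
    fun p q τ σ => T.resCoeff_sub ℓ v
      (hT.isRes hn (hφ₁'.1.trans hφ₁'.2) (ray_mem_cExt hω hφ₁.1 hφ₁'.2 p τ))
      (hT.isRes hn (hφ₁'.1.trans hφ₁'.2) (ray_mem_cExt hω hφ₃'.1 hφ₃''.2 q σ))

theorem isRightLinear_intrinsicCalc (hT : T.IsBisectorial ω) (hn : 1 ≤ n) (hω : 0 < ω)
    (hθ : θ < Real.pi / 2) {φ : ℝ} (hφ : φ ∈ Ioo ω θ) {h : ℂ → ℂ} (hh : HoloDecay θ h) :
    IsRightLinear (T.intrinsicCalc φ h) := by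
  intro s v
  refine (SeparatingDual.eq_iff_forall_dual_eq (R := ℝ)).2 fun ℓ => Complex.ofReal_injective ?_
  have h1 := hT.apply_intrinsicCalc hn hω hθ hφ hh ℓ (rmul s v)
  have h2 := hT.apply_intrinsicCalc hn hω hθ hφ hh (ℓ ∘L rmul s) v
  refine h1.trans (Eq.trans (ctr_congr fun p τ => ?_) h2.symm)
  have hr := hT.isRes hn (hφ.1.trans (hφ.2.trans hθ)) (ray_mem_cExt hω hφ.1 (hφ.2.trans hθ) p τ)
  rw [resCoeff, resCoeff, hr.rightLinear₁, hr.rightLinear₂]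
  rfl

end IsBisectorial

end ClosedOp

end CliffordCalculus

namespace CliffordCalculus

variable {n : ℕ}

/-! ### Components of slice hyperholomorphic functions -/

theorem abs_coeff_le (A : Finset (Fin n)) (s : Cl n) : |CMod.coeff A s| ≤ ‖s‖ := by
  refine abs_le_of_sq_le_sq ?_ (norm_nonneg _)
  rw [CMod.norm_sq, ← sq_abs, ← Real.norm_eq_abs]
  exact Finset.single_le_sum (f := fun A => ‖CMod.coeff A s‖ ^ 2) (fun _ _ => sq_nonneg _)
    (Finset.mem_univ A)

/-- The holomorphic function `z = x + i y ↦ f₀ (x, y) + i f₁ (x, y)`, at the basis vector `e_A`. -/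
def component (f₀ f₁ : ℝ × ℝ → Cl n) (A : Finset (Fin n)) (z : ℂ) : ℂ :=
  CMod.coeff A (f₀ (z.re, z.im)) + CMod.coeff A (f₁ (z.re, z.im)) * Complex.I

namespace IsLeftSliceDecomp

variable {θ : ℝ} {f : Cl n → Cl n} {f₀ f₁ : ℝ × ℝ → Cl n}

theorem mem_sliceDomain_of_mem (hn : 1 ≤ n) (hθ0 : 0 < θ) (hθ : θ < Real.pi / 2) {z : ℂ}
    (hz : z ∈ cSector θ) : (z.re, z.im) ∈ sliceDomain (doubleSector n θ) :=
  (mem_sliceDomain hn hθ0 hθ).2 hz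

theorem hasFDerivAt (hd : IsLeftSliceDecomp (doubleSector n θ) f f₀ f₁) (hn : 1 ≤ n)
    (hθ0 : 0 < θ) (hθ : θ < Real.pi / 2) {p : ℝ × ℝ} (hp : p ∈ sliceDomain (doubleSector n θ)) :
    ∃ D₀ D₁ : ℝ × ℝ →L[ℝ] Cl n, HasFDerivAt f₀ D₀ p ∧ HasFDerivAt f₁ D₁ p ∧
      D₀ (1, 0) = D₁ (0, 1) ∧ D₀ (0, 1) = -D₁ (1, 0) := by
  have hnhds := (isOpen_sliceDomain hn hθ0 hθ).mem_nhds hp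
  have h0 := ((hd.contDiffOn_zero.contDiffAt hnhds).differentiableAt one_ne_zero).hasFDerivAt
  have h1 := ((hd.contDiffOn_one.contDiffAt hnhds).differentiableAt one_ne_zero).hasFDerivAt
  refine ⟨_, _, h0, h1, ?_, ?_⟩
  · have hx : HasDerivAt (fun x => f₀ (x, p.2)) (fderiv ℝ f₀ p (1, 0)) p.1 :=
      HasFDerivAt.comp_hasDerivAt (f := fun x : ℝ => (x, p.2)) p.1 h0
        ((hasDerivAt_id p.1).prodMk (hasDerivAt_const p.1 p.2))
    have hy : HasDerivAt (fun y => f₁ (p.1, y)) (fderiv ℝ f₁ p (0, 1)) p.2 :=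
      HasFDerivAt.comp_hasDerivAt (f := fun y : ℝ => (p.1, y)) p.2 h1
        ((hasDerivAt_const p.2 p.1).prodMk (hasDerivAt_id p.2))
    rw [← hx.deriv, ← hy.deriv, hd.cauchyRiemann_x p hp]
  · have hx : HasDerivAt (fun x => f₁ (x, p.2)) (fderiv ℝ f₁ p (1, 0)) p.1 :=
      HasFDerivAt.comp_hasDerivAt (f := fun x : ℝ => (x, p.2)) p.1 h1
        ((hasDerivAt_id p.1).prodMk (hasDerivAt_const p.1 p.2))
    have hy : HasDerivAt (fun y => f₀ (p.1, y)) (fderiv ℝ f₀ p (0, 1)) p.2 :=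
      HasFDerivAt.comp_hasDerivAt (f := fun y : ℝ => (p.1, y)) p.2 h0
        ((hasDerivAt_const p.2 p.1).prodMk (hasDerivAt_id p.2))
    rw [← hx.deriv, ← hy.deriv, hd.cauchyRiemann_y p hp]

/-- The equations for `f₀`, `f₁` hold coefficientwise and are the ordinary Cauchy-Riemann equations
of `f₀ + i f₁`. -/
theorem differentiableOn_component (hd : IsLeftSliceDecomp (doubleSector n θ) f f₀ f₁) (hn : 1 ≤ n)
    (hθ0 : 0 < θ) (hθ : θ < Real.pi / 2) (A : Finset (Fin n)) :
    DifferentiableOn ℂ (component f₀ f₁ A) (cSector θ) := by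
  intro z hz
  refine DifferentiableAt.differentiableWithinAt ?_
  obtain ⟨D₀, D₁, h0, h1, e1, e2⟩ := hd.hasFDerivAt hn hθ0 hθ
    (mem_sliceDomain_of_mem hn hθ0 hθ hz)
  have hre : HasFDerivAt (fun z : ℂ => (z.re, z.im)) (Complex.reCLM.prod Complex.imCLM) z :=
    (Complex.reCLM.prod Complex.imCLM).hasFDerivAt
  have key : ∀ (F : ℝ × ℝ → Cl n) D, HasFDerivAt F D (z.re, z.im) →
      HasFDerivAt (fun z : ℂ => ((CMod.coeff A (F (z.re, z.im)) : ℝ) : ℂ))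
        (Complex.ofRealCLM ∘L (CMod.coeff A ∘L (D ∘L Complex.reCLM.prod Complex.imCLM))) z :=
    fun F D hF => Complex.ofRealCLM.hasFDerivAt.comp z
      ((CMod.coeff A).hasFDerivAt.comp z
        (HasFDerivAt.comp (f := fun z : ℂ => (z.re, z.im)) z hF hre))
  have hsum := (key f₀ D₀ h0).add ((key f₁ D₁ h1).mul_const Complex.I)
  rw [differentiableAt_complex_iff_differentiableAt_real]
  refine ⟨hsum.differentiableAt, ?_⟩
  rw [HasFDerivAt.fderiv (f := component f₀ f₁ A) hsum]
  simp [e1, e2, mul_comm Complex.I]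
  ring_nf
  simp

/-- With `a = f(s)` and `b = f(s̄)` one has `2 f₀ = a + b` and `2 f₁ = -J (a - b)`, so bounds and
decay of `f` pass to its components. -/
theorem norm_component_le (hd : IsLeftSliceDecomp (doubleSector n θ) f f₀ f₁) (hn : 1 ≤ n)
    (hθ0 : 0 < θ) (hθ : θ < Real.pi / 2) (A : Finset (Fin n)) {J : Cl n} (hJ : J ∈ imagSphere n)
    {z : ℂ} (hz : z ∈ cSector θ) : ‖component f₀ f₁ A z‖ ≤ (1 + ‖lmulL n ℝ‖) *
      (‖f (slicePt J z.re z.im)‖ + ‖f (slicePt J z.re (-z.im))‖) := by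
  have hp := mem_sliceDomain_of_mem hn hθ0 hθ hz
  have h1 : f (slicePt J z.re z.im) = f₀ (z.re, z.im) + J * f₁ (z.re, z.im) := hd.repr _ hp J hJ
  have h2 : f (slicePt J z.re (-z.im)) = f₀ (z.re, z.im) - J * f₁ (z.re, z.im) := by
    have e : slicePt J z.re (-z.im) = slicePt (-J) z.re z.im := by simp [slicePt]
    rw [e, sub_eq_add_neg, ← neg_mul]
    exact hd.repr _ hp (-J) (neg_mem_imagSphere hJ)
  have e0 : (2 : ℝ) • f₀ (z.re, z.im) = f (slicePt J z.re z.im) + f (slicePt J z.re (-z.im)) := by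
    rw [h1, h2]; module
  have e1 : (2 : ℝ) • f₁ (z.re, z.im) =
      (-J) * (f (slicePt J z.re z.im) - f (slicePt J z.re (-z.im))) := by
    rw [h1, h2, add_sub_sub_cancel, ← two_smul ℝ (J * _), mul_smul_comm, ← mul_assoc, neg_mul,
      imagSphere_mul_self hJ, neg_neg, one_mul]
  set a := f (slicePt J z.re z.im)
  set b := f (slicePt J z.re (-z.im))
  have n0 : 2 * ‖f₀ (z.re, z.im)‖ ≤ ‖a‖ + ‖b‖ := by
    have := congrArg norm e0
    rw [norm_smul, Real.norm_two] at this
    rw [this]; exact norm_add_le _ _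
  have n1 : 2 * ‖f₁ (z.re, z.im)‖ ≤ ‖lmulL n ℝ‖ * (‖a‖ + ‖b‖) := by
    have := congrArg norm e1
    rw [norm_smul, Real.norm_two] at this
    rw [this]
    refine (norm_mul_le_lmulL _ _).trans ?_
    rw [norm_neg, hJ.2.2, mul_one]
    gcongr
    exact norm_sub_le _ _
  have c0 := abs_coeff_le A (f₀ (z.re, z.im))
  have c1 := abs_coeff_le A (f₁ (z.re, z.im))
  have hab : 0 ≤ ‖lmulL n ℝ‖ * (‖a‖ + ‖b‖) := by positivity
  calc ‖component f₀ f₁ A z‖ ≤ |CMod.coeff A (f₀ (z.re, z.im))| +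
        |CMod.coeff A (f₁ (z.re, z.im))| := by
        refine (norm_add_le _ _).trans ?_
        simp
    _ ≤ _ := by nlinarith [norm_nonneg a, norm_nonneg b]

end IsLeftSliceDecomp

theorem integrable_norm_polarPt {θ : ℝ} {f : Cl n → Cl n} (hf : BoundedWithDecay θ f) {J : Cl n}
    (hJ : J ∈ imagSphere n) (ε : Bool) {φ : ℝ} (hφ : |φ| < θ) :
    Integrable fun τ => ‖f (polarPt J (sg ε * Real.exp τ) φ)‖ := by
  have key : ∀ ψ ∈ angleSet θ, Integrable fun τ => ‖f (polarPt J (Real.exp τ) ψ)‖ := fun ψ hψ => by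
    have := (integrable_exp_smul_iff fun t : ℝ => ‖f (polarPt J t ψ)‖ / t).2 (hf.2 J hJ ψ hψ)
    refine this.congr (Filter.Eventually.of_forall fun τ => ?_)
    simp only [smul_eq_mul]
    rw [mul_div_cancel₀ _ (Real.exp_pos τ).ne']
  rw [abs_lt] at hφ
  cases ε
  · simpa [polarPt_neg] using key (φ + Real.pi) (Or.inr ⟨by linarith, by linarith⟩)
  · simpa using key φ (Or.inl hφ)

/-- Bounds and integrability come from values of `f` at conjugate points; the reflection symmetry is
the parity of `f₀` and `f₁`. -/
theorem IsLeftSliceDecomp.holoDecay_component {θ : ℝ} {f : Cl n → Cl n} {f₀ f₁ : ℝ × ℝ → Cl n}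
    (hd : IsLeftSliceDecomp (doubleSector n θ) f f₀ f₁) (hf : BoundedWithDecay θ f) (hn : 1 ≤ n)
    (hθ0 : 0 < θ) (hθ : θ < Real.pi / 2) (A : Finset (Fin n)) :
    HoloDecay θ (component f₀ f₁ A) := by
  obtain ⟨J, hJ⟩ : ∃ J, J ∈ imagSphere n := ⟨_, unitVec_mem_imagSphere (⟨0, hn⟩ : Fin n)⟩
  have hconj : ∀ z ∈ cSector θ, starRingEnd ℂ z ∈ cSector θ := fun z hz => by
    simpa [cSector] using hz
  have hdiff := hd.differentiableOn_component hn hθ0 hθ A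
  refine ⟨hdiff, ?_, fun ε φ hφ => ?_, fun z hz => ?_⟩
  · obtain ⟨C, hC⟩ := hf.1
    refine ⟨(1 + ‖lmulL n ℝ‖) * (C + C), fun z hz => ?_⟩
    refine (hd.norm_component_le hn hθ0 hθ A hJ hz).trans ?_
    gcongr
    · exact hC _ ((slicePt_mem_doubleSector hJ hθ0 hθ).2 hz)
    · exact hC _ ((slicePt_mem_doubleSector (z := starRingEnd ℂ z) hJ hθ0 hθ).2 (hconj z hz))
  · have hmem : ∀ τ, pt ε (hline φ τ) ∈ cSector θ := fun τ =>
      pt_mem_cSector ε (by rwa [hline_im]) hθ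
    refine (((integrable_norm_polarPt hf hJ ε hφ).add (integrable_norm_polarPt hf hJ ε
      (φ := -φ) (by rwa [abs_neg]))).const_mul (1 + ‖lmulL n ℝ‖)).mono' ?_
      (Filter.Eventually.of_forall fun τ => ?_)
    · exact (hdiff.continuousOn.comp_continuous (by fun_prop) hmem).aestronglyMeasurable
    · refine (hd.norm_component_le hn hθ0 hθ A hJ (hmem τ)).trans ?_
      simp only [Pi.add_apply]
      rw [polarPt_eq_slicePt_pt, polarPt_eq_slicePt_pt, ← conj_pt, Complex.conj_re,
        Complex.conj_im]
  · have hp := mem_sliceDomain_of_mem hn hθ0 hθ hz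
    have h0 := hd.even_zero _ hp
    have h1 := hd.odd_one _ hp
    simp only at h0 h1
    simp [component, h0, h1]

/-! ### Products with intrinsic functions -/

/-- Being real, `g₀` and `g₁` commute with `J`, so `(g₀ + J g₁)(f₀ + J f₁)` multiplies out like a
product of complex numbers. -/
theorem IsLeftSliceDecomp.mul {θ : ℝ} {g f : Cl n → Cl n} {g₀ g₁ : ℝ × ℝ → ℝ}
    {f₀ f₁ : ℝ × ℝ → Cl n}
    (hg : IsLeftSliceDecomp (doubleSector n θ) g (fun p => g₀ p • 1) (fun p => g₁ p • 1))
    (hf : IsLeftSliceDecomp (doubleSector n θ) f f₀ f₁) (hn : 1 ≤ n)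
    (hθ0 : 0 < θ) (hθ : θ < Real.pi / 2) :
    IsLeftSliceDecomp (doubleSector n θ) (fun s => g s * f s)
      (fun p => g₀ p • f₀ p - g₁ p • f₁ p) (fun p => g₀ p • f₁ p + g₁ p • f₀ p) := by
  -- The hypothesis concerns the multiples `g₀ • 1` and `g₁ • 1` in `ℝ_n`; the real part recovers
  -- the scalar functions and their regularity.
  have hcoeff : ∀ u : ℝ × ℝ → ℝ, u = fun p => CMod.coeff ∅ (u p • (1 : Cl n)) := fun u => by
    ext p; simp [Cl.coeff_one]
  have hc0 : ContDiffOn ℝ 1 g₀ (sliceDomain (doubleSector n θ)) := by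
    rw [hcoeff g₀]
    exact (CMod.coeff ∅).contDiff.comp_contDiffOn hg.contDiffOn_zero
  have hc1 : ContDiffOn ℝ 1 g₁ (sliceDomain (doubleSector n θ)) := by
    rw [hcoeff g₁]
    exact (CMod.coeff ∅).contDiff.comp_contDiffOn hg.contDiffOn_one
  have hD0 := (hc0.smul hf.contDiffOn_zero).sub (hc1.smul hf.contDiffOn_one)
  have hD1 := (hc0.smul hf.contDiffOn_one).add (hc1.smul hf.contDiffOn_zero)
  have hsymm : ∀ p ∈ sliceDomain (doubleSector n θ), g₀ (p.1, -p.2) = g₀ p ∧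
      g₁ (p.1, -p.2) = -g₁ p := fun p hp => by
    have h0 := congrArg (CMod.coeff ∅) (hg.even_zero p hp)
    have h1 := congrArg (CMod.coeff ∅) (hg.odd_one p hp)
    simpa [Cl.coeff_one] using And.intro h0 h1
  have hCR : ∀ p ∈ sliceDomain (doubleSector n θ), ∃ (G₀ G₁ : ℝ × ℝ →L[ℝ] ℝ)
      (D₀ D₁ : ℝ × ℝ →L[ℝ] Cl n), HasFDerivAt g₀ G₀ p ∧ HasFDerivAt g₁ G₁ p ∧
      HasFDerivAt f₀ D₀ p ∧ HasFDerivAt f₁ D₁ p ∧ G₀ (1, 0) = G₁ (0, 1) ∧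
      G₀ (0, 1) = -G₁ (1, 0) ∧ D₀ (1, 0) = D₁ (0, 1) ∧ D₀ (0, 1) = -D₁ (1, 0) := fun p hp => by
    obtain ⟨D₀, D₁, h0, h1, e1, e2⟩ := hf.hasFDerivAt hn hθ0 hθ hp
    obtain ⟨E₀, E₁, k0, k1, e3, e4⟩ := hg.hasFDerivAt hn hθ0 hθ hp
    refine ⟨CMod.coeff ∅ ∘L E₀, CMod.coeff ∅ ∘L E₁, D₀, D₁, ?_, ?_, h0, h1, ?_, ?_, e1, e2⟩
    · rw [hcoeff g₀]
      exact (CMod.coeff ∅).hasFDerivAt.comp p k0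
    · rw [hcoeff g₁]
      exact (CMod.coeff ∅).hasFDerivAt.comp p k1
    · simp [e3]
    · simp [e4]
  have hpart : ∀ {p : ℝ × ℝ} {F : ℝ × ℝ → Cl n} {D}, HasFDerivAt F D p →
      deriv (fun x => F (x, p.2)) p.1 = D (1, 0) ∧ deriv (fun y => F (p.1, y)) p.2 = D (0, 1) :=
    fun {p F D} hF => ⟨(HasFDerivAt.comp_hasDerivAt (f := fun x : ℝ => (x, p.2)) p.1 hF
        ((hasDerivAt_id p.1).prodMk (hasDerivAt_const p.1 p.2))).deriv,
      (HasFDerivAt.comp_hasDerivAt (f := fun y : ℝ => (p.1, y)) p.2 hF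
        ((hasDerivAt_const p.2 p.1).prodMk (hasDerivAt_id p.2))).deriv⟩
  refine ⟨hD0, hD1, fun p hp J hJ => ?_, fun p hp => ?_, fun p hp => ?_, fun p hp => ?_,
    fun p hp => ?_⟩
  · rw [hg.repr p hp J hJ, hf.repr p hp J hJ]
    have hJ2 : ∀ x : Cl n, J * (J * x) = -x := fun x => by
      rw [← mul_assoc, imagSphere_mul_self hJ, neg_one_mul]
    simp only [add_mul, mul_add, smul_mul_assoc, mul_smul_comm, one_mul, mul_one, hJ2]
    module
  · simp only [(hsymm p hp).1, (hsymm p hp).2, hf.even_zero p hp, hf.odd_one p hp]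
    module
  · simp only [(hsymm p hp).1, (hsymm p hp).2, hf.even_zero p hp, hf.odd_one p hp]
    module
  · obtain ⟨G₀, G₁, D₀, D₁, a0, a1, b0, b1, e1, e2, e3, e4⟩ := hCR p hp
    have k0 : HasFDerivAt (fun p => g₀ p • f₀ p - g₁ p • f₁ p) _ p :=
      (a0.smul b0).sub (a1.smul b1)
    have k1 : HasFDerivAt (fun p => g₀ p • f₁ p + g₁ p • f₀ p) _ p :=
      (a0.smul b1).add (a1.smul b0)
    rw [(hpart k0).1, (hpart k1).2]
    simp [e1, e2, e3, e4]
    module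
  · obtain ⟨G₀, G₁, D₀, D₁, a0, a1, b0, b1, e1, e2, e3, e4⟩ := hCR p hp
    have k0 : HasFDerivAt (fun p => g₀ p • f₀ p - g₁ p • f₁ p) _ p :=
      (a0.smul b0).sub (a1.smul b1)
    have k1 : HasFDerivAt (fun p => g₀ p • f₁ p + g₁ p • f₀ p) _ p :=
      (a0.smul b1).add (a1.smul b0)
    rw [(hpart k0).2, (hpart k1).1]
    simp [e1, e2, e3, e4]
    module

theorem component_mul (g₀ g₁ : ℝ × ℝ → ℝ) (f₀ f₁ : ℝ × ℝ → Cl n) (A : Finset (Fin n)) :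
    component (fun p => g₀ p • f₀ p - g₁ p • f₁ p) (fun p => g₀ p • f₁ p + g₁ p • f₀ p) A =
      fun z => component (fun p => g₀ p • (1 : Cl n)) (fun p => g₁ p • 1) ∅ z *
        component f₀ f₁ A z := by
  ext z
  simp only [component, map_sub, map_add, map_smul, smul_eq_mul, Cl.coeff_one, if_true, mul_one]
  push_cast
  linear_combination (g₁ (z.re, z.im) * CMod.coeff A (f₁ (z.re, z.im)) : ℂ) * (-Complex.I_mul_I)

theorem continuous_slice {θ : ℝ} {f : Cl n → Cl n} (hf : f ∈ SHL (doubleSector n θ)) (hn : 1 ≤ n)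
    (hθ0 : 0 < θ) (hθ : θ < Real.pi / 2) {J : Cl n} (hJ : J ∈ imagSphere n) :
    ContinuousOn (fun z : ℂ => f (slicePt J z.re z.im)) (cSector θ) := by
  obtain ⟨f₀, f₁, hd⟩ := hf
  have hc : ∀ F : ℝ × ℝ → Cl n, ContDiffOn ℝ 1 F (sliceDomain (doubleSector n θ)) →
      ContinuousOn (fun z : ℂ => F (z.re, z.im)) (cSector θ) := fun F hF =>
    hF.continuousOn.comp (by fun_prop) fun z hz =>
      IsLeftSliceDecomp.mem_sliceDomain_of_mem hn hθ0 hθ hz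
  have h0 := hc f₀ hd.contDiffOn_zero
  have h1 := hc f₁ hd.contDiffOn_one
  refine (h0.add ((lmul (VR := ℝ) J).continuous.comp_continuousOn h1)).congr fun z hz => ?_
  exact hd.repr _ (IsLeftSliceDecomp.mem_sliceDomain_of_mem hn hθ0 hθ hz) J hJ

theorem mul_mem_SHL0 {θ : ℝ} {g f : Cl n → Cl n} (hg : g ∈ N0 n θ) (hf : f ∈ SHL0 n θ)
    (hn : 1 ≤ n) (hθ0 : 0 < θ) (hθ : θ < Real.pi / 2) : (fun s => g s * f s) ∈ SHL0 n θ := by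
  obtain ⟨⟨g₀, g₁, hgd⟩, ⟨C, hC⟩, -⟩ := hg
  obtain ⟨⟨f₀, f₁, hfd⟩, ⟨D, hD⟩, hfi⟩ := hf
  have hfg : (fun s => g s * f s) ∈ SHL (doubleSector n θ) := ⟨_, _, hgd.mul hfd hn hθ0 hθ⟩
  have hbd : ∀ s ∈ doubleSector n θ, ‖g s * f s‖ ≤ ‖lmulL n ℝ‖ * C * ‖f s‖ := fun s hs =>
    (norm_mul_le_lmulL _ _).trans (by gcongr; exact hC s hs)
  refine ⟨hfg, ⟨‖lmulL n ℝ‖ * C * D, fun s hs => (hbd s hs).trans ?_⟩, fun J hJ φ hφ => ?_⟩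
  · have : 0 ≤ C := (norm_nonneg _).trans (hC s hs)
    gcongr
    exact hD s hs
  · have hmem : ∀ t ∈ Ioi (0 : ℝ), polarPt J t φ ∈ doubleSector n θ := fun t ht =>
      ⟨J, hJ, t, ht, φ, hφ, rfl⟩
    refine ((hfi J hJ φ hφ).const_mul (‖lmulL n ℝ‖ * C)).mono' ?_ ?_
    · refine ContinuousOn.aestronglyMeasurable ?_ measurableSet_Ioi
      have hc : ContinuousOn (fun t : ℝ => (⟨t * Real.cos φ, t * Real.sin φ⟩ : ℂ)) (Ioi 0) :=
        (Complex.equivRealProdCLM.symm.continuous.comp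
          (by fun_prop : Continuous fun t : ℝ => (t * Real.cos φ, t * Real.sin φ))).continuousOn
      have := (continuous_slice hfg hn hθ0 hθ hJ).comp hc fun t ht =>
        (slicePt_mem_doubleSector hJ hθ0 hθ).1 (hmem t ht)
      exact this.norm.div continuousOn_id fun t ht => ht.ne'
    · filter_upwards [ae_restrict_mem measurableSet_Ioi] with t ht
      have ht' : 0 < t := ht
      rw [Real.norm_of_nonneg (by positivity), ← mul_div_assoc]
      gcongr
      exact hbd _ (hmem t ht)

end CliffordCalculus

namespace CliffordCalculus

variable {n : ℕ} {VR : Type*} [NormedAddCommGroup VR] [NormedSpace ℝ VR]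

/-! ### Reduction of the path integrals to the intrinsic calculus -/

/-- Folding the line at `0` brings conjugate points of the boundary curve under one integral. -/
theorem integrable_of_integrableOn_Ioi {E : Type*} [NormedAddCommGroup E] [NormedSpace ℝ E]
    {F : ℝ → E} (h : ∀ b, IntegrableOn (fun t => F (sg b * t)) (Ioi 0)) :
    Integrable F ∧ ∫ t, F t = ∫ t in Ioi 0, ∑ b, F (sg b * t) := by
  have h1 : IntegrableOn F (Ioi 0) := by simpa using h true
  have h2 : IntegrableOn F (Iic 0) := by
    rw [integrableOn_Iic_iff_integrableOn_Iio]
    have := h false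
    simp only [sg_false, neg_one_mul] at this
    have h3 := (Measure.measurePreserving_neg (volume : Measure ℝ)).integrableOn_comp_preimage
      (MeasurableEquiv.neg ℝ).measurableEmbedding (f := F) (s := Iio 0)
    rw [← h3]
    simpa [Function.comp_def] using this
  refine ⟨?_, ?_⟩
  · rw [← integrableOn_univ, ← Iic_union_Ioi (a := (0 : ℝ))]
    exact h2.union h1
  · have h3 := integral_comp_neg_Ioi 0 F
    rw [neg_zero] at h3
    simp only [Fintype.sum_bool]
    rw [integral_add (h true) (h false), ← intervalIntegral.integral_Iic_add_Ioi h2 h1, ← h3,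
      add_comm]
    simp

theorem continuous_slicePt {X : Type*} [TopologicalSpace X] (J : Cl n) {x y : X → ℝ}
    (hx : Continuous x) (hy : Continuous y) : Continuous fun t => slicePt J (x t) (y t) := by
  unfold slicePt; fun_prop

theorem continuous_mul_Cl {X : Type*} [TopologicalSpace X] {u v : X → Cl n}
    (hu : Continuous u) (hv : Continuous v) : Continuous fun t => u t * v t :=
  continuous_Cl_mul.comp (hu.prodMk hv)

theorem integrable_comp_lmul {S : ℝ → CMod n VR →L[ℝ] CMod n VR} {q : ℝ → Cl n} {u : ℝ → ℝ} {C : ℝ}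
    (hS : Continuous S) (hq : Continuous q) (hu : Integrable u)
    (h : ∀ τ, ‖S τ‖ * ‖q τ‖ ≤ C * u τ) : Integrable fun τ => S τ ∘L lmul (q τ) := by
  have hcont : Continuous fun τ => S τ ∘L lmul (q τ) :=
    hS.clm_comp ((lmulL n VR).continuous.comp hq)
  refine (hu.const_mul (‖lmulL n VR‖ * C)).mono' hcont.aestronglyMeasurable
    (Filter.Eventually.of_forall fun τ => ?_)
  calc _ ≤ ‖S τ‖ * (‖lmulL n VR‖ * ‖q τ‖) :=
        (ContinuousLinearMap.opNorm_comp_le _ _).trans (by gcongr; exact norm_lmul_le _)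
    _ = ‖lmulL n VR‖ * (‖S τ‖ * ‖q τ‖) := by ring
    _ ≤ ‖lmulL n VR‖ * (C * u τ) := mul_le_mul_of_nonneg_left (h τ) (by positivity)
    _ = _ := by ring

theorem integrable_norm_slicePt_ray {θ φ : ℝ} {f : Cl n → Cl n} (hf : BoundedWithDecay θ f)
    {J : Cl n} (hJ : J ∈ imagSphere n) (h0 : 0 < φ) (hφ : φ < θ) (p : Bool × Bool) :
    Integrable fun τ => ‖f (slicePt J (ray p φ τ).re (ray p φ τ).im)‖ := by
  have := integrable_norm_polarPt hf hJ p.1 (φ := -(sg p.2) * φ)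
    (by rwa [abs_neg_sg_mul _ h0])
  simp_rw [polarPt_eq_slicePt_pt] at this
  exact this

theorem boundaryCurve_sg_mul (J : Cl n) (φ : ℝ) (ε b : Bool) {t : ℝ} (ht : 0 < t) :
    boundaryCurve J φ (sg ε) (sg b * t) = polarPt J (sg ε * t) (-(sg b) * φ) := by
  have h1 : Real.sign (sg b * t) = sg b := by
    cases b
    · simp [Real.sign_of_neg, ht]
    · simp [Real.sign_of_pos ht]
  rw [boundaryCurve, h1, abs_mul, abs_sg, one_mul, abs_of_pos ht]

theorem deriv_boundaryCurve (J : Cl n) (φ : ℝ) (ε b : Bool) {t : ℝ} (ht : 0 < t) :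
    deriv (boundaryCurve J φ (sg ε)) (sg b * t) = sg b • polarPt J (sg ε) (-(sg b) * φ) := by
  have hev : boundaryCurve J φ (sg ε) =ᶠ[nhds (sg b * t)]
      fun x => x • sg b • polarPt J (sg ε) (-(sg b) * φ) := by
    have hopen : IsOpen {x : ℝ | 0 < sg b * x} := isOpen_lt continuous_const (by fun_prop)
    have hmem : sg b * t ∈ {x : ℝ | 0 < sg b * x} := by
      change 0 < sg b * (sg b * t)
      rwa [← mul_assoc, sg_mul_self, one_mul]
    filter_upwards [hopen.mem_nhds hmem] with x hx
    have := boundaryCurve_sg_mul J φ ε b hx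
    rw [← mul_assoc, sg_mul_self, one_mul] at this
    rw [this]
    simp only [polarPt, slicePt]
    module
  rw [hev.deriv_eq]
  have := (hasDerivAt_id (sg b * t)).smul_const (sg b • polarPt J (sg ε) (-(sg b) * φ))
  simpa using this.deriv

namespace ClosedOp

variable [CompleteSpace VR]

/-- Each half of the curve is linear in `t`, so at `t = ± e^τ` the product `e^τ γ'(t)` is `± s`.
Thus `γ'(t) dt` turns into `s dτ` up to sign. -/
theorem exp_smul_pathIntegrand (T : ClosedOp n VR) (J : Cl n) (φ : ℝ) (ε b : Bool)
    (f : Cl n → Cl n) (τ : ℝ) {s : Cl n}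
    (hs : s = slicePt J (ray (ε, b) φ τ).re (ray (ε, b) φ τ).im) :
    Real.exp τ • T.pathIntegrand J (boundaryCurve J φ (sg ε)) f (sg b * Real.exp τ) =
      sg b • (T.SL s ∘L lmul (s * (-J) * f s)) := by
  have h1 : s = polarPt J (sg ε * Real.exp τ) (-(sg b) * φ) := by
    rw [hs, polarPt_eq_slicePt_pt]; rfl
  have h2 : s = Real.exp τ • polarPt J (sg ε) (-(sg b) * φ) := by
    rw [h1]; simp only [polarPt, slicePt]; module
  rw [pathIntegrand, boundaryCurve_sg_mul J φ ε b (Real.exp_pos τ),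
    deriv_boundaryCurve J φ ε b (Real.exp_pos τ), ← h1]
  have h3 : s * (-J) * f s =
      Real.exp τ • (polarPt J (sg ε) (-(sg b) * φ) * (-J) * f s) := by
    conv_lhs => enter [1, 1]; rw [h2]
    rw [smul_mul_assoc, smul_mul_assoc]
  rw [h3, smul_mul_assoc, smul_mul_assoc, ← lmulL_apply, ← lmulL_apply, map_smul, map_smul]
  ext v
  simp [smul_smul, mul_comm]

namespace IsBisectorial

variable {T : ClosedOp n VR} {ω θ : ℝ} {f : Cl n → Cl n} {f₀ f₁ : ℝ × ℝ → Cl n}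

/-- The contributions of conjugate points to the path integral add up to an expression which does
not depend on the imaginary unit `J`. -/
theorem SL_comp_lmul_sub (hT : T.IsBisectorial ω) (hn : 1 ≤ n) (hω : ω < Real.pi / 2)
    (hd : IsLeftSliceDecomp (doubleSector n θ) f f₀ f₁) {J : Cl n} (hJ : J ∈ imagSphere n) {z : ℂ}
    (hz : z ∈ cExt ω) (hz' : (z.re, z.im) ∈ sliceDomain (doubleSector n θ)) :
    (T.SL (slicePt J z.re z.im) ∘L
        lmul (slicePt J z.re z.im * (-J) * f (slicePt J z.re z.im))) -
      (T.SL (slicePt J z.re (-z.im)) ∘L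
        lmul (slicePt J z.re (-z.im) * (-J) * f (slicePt J z.re (-z.im)))) =
    (2 : ℝ) • ∑ A, T.calcIntegrand (component f₀ f₁ A) z ∘L lmul (basisVec A) := by
  have hzc : starRingEnd ℂ z ∈ cExt ω := by simpa [cExt] using hz
  have f1 := hT.SL_slicePt hn hω hJ hz
  have f2 := hT.SL_slicePt hn hω hJ hzc
  rw [(hT.Rop_conj hn hω hz).1, (hT.Rop_conj hn hω hz).2] at f2
  simp only [Complex.conj_re, Complex.conj_im, neg_neg] at f2
  have g1 : f (slicePt J z.re z.im) = f₀ (z.re, z.im) + J * f₁ (z.re, z.im) := hd.repr _ hz' J hJ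
  have g2 : f (slicePt J z.re (-z.im)) = f₀ (z.re, z.im) - J * f₁ (z.re, z.im) := by
    have e : slicePt J z.re (-z.im) = slicePt (-J) z.re z.im := by simp [slicePt]
    rw [e, sub_eq_add_neg, ← neg_mul]
    exact hd.repr _ hz' (-J) (neg_mem_imagSphere hJ)
  -- With `a`, `b` as introduced below, `z (f₀ + i f₁) = -b + i a` coefficientwise.
  have hq : ∀ A, z * component f₀ f₁ A z =
      ⟨-CMod.coeff A (z.im • f₁ (z.re, z.im) - z.re • f₀ (z.re, z.im)),
        CMod.coeff A (z.im • f₀ (z.re, z.im) + z.re • f₁ (z.re, z.im))⟩ := fun A => by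
    apply Complex.ext <;> simp [component] <;> ring
  have hsum : ∑ A, T.calcIntegrand (component f₀ f₁ A) z ∘L lmul (basisVec A) =
      (z.re • T.Rop z - T.Pop z) ∘L lmul (z.im • f₀ (z.re, z.im) + z.re • f₁ (z.re, z.im)) +
        (z.im • T.Rop z) ∘L lmul (z.im • f₁ (z.re, z.im) - z.re • f₀ (z.re, z.im)) := by
    rw [lmul_eq_sum (z.im • f₀ (z.re, z.im) + z.re • f₁ (z.re, z.im)),
      lmul_eq_sum (z.im • f₁ (z.re, z.im) - z.re • f₀ (z.re, z.im))]
    ext1 v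
    simp only [sum_apply, ContinuousLinearMap.comp_apply,
      add_apply, smul_apply, map_sum, map_smul,
      ← Finset.sum_add_distrib]
    refine Finset.sum_congr rfl fun A _ => ?_
    simp only [calcIntegrand, hq, sub_apply, smul_apply]
    module
  have hJ2 : ∀ x : Cl n, J * (J * x) = -x := fun x => by
    rw [← mul_assoc, imagSphere_mul_self hJ, neg_one_mul]
  set a := z.im • f₀ (z.re, z.im) + z.re • f₁ (z.re, z.im) with ha
  set b := z.im • f₁ (z.re, z.im) - z.re • f₀ (z.re, z.im) with hb
  have p1 : slicePt J z.re z.im * (-J) * f (slicePt J z.re z.im) = a + J * b := by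
    rw [g1, ha, hb]
    simp only [slicePt, add_mul, mul_add, mul_sub, mul_neg, neg_mul, smul_mul_assoc, mul_smul_comm,
      one_mul, imagSphere_mul_self hJ, hJ2]
    module
  have p2 : slicePt J z.re (-z.im) * (-J) * f (slicePt J z.re (-z.im)) = -(a - J * b) := by
    rw [g2, ha, hb]
    simp only [slicePt, add_mul, mul_sub, mul_neg, neg_mul, smul_mul_assoc, mul_smul_comm,
      one_mul, imagSphere_mul_self hJ, hJ2]
    module
  -- The two contributions add up to `R (s̄ c + s d) - P (c + d)` with `c = a + J b` and `d = a - J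
  -- b`; in both arguments the terms containing `J` cancel.
  have m1 : slicePt J z.re (-z.im) * (a + J * b) + slicePt J z.re z.im * (a - J * b) =
      (2 : ℝ) • (z.re • a + z.im • b) := by
    simp only [slicePt, add_mul, mul_add, mul_sub, smul_mul_assoc, one_mul, hJ2]
    module
  have m3 : (a + J * b) + (a - J * b) = (2 : ℝ) • a := by module
  rw [hsum, f1, f2, p1, p2]
  clear_value a b
  generalize a + J * b = c at *
  generalize a - J * b = d at *
  ext1 v
  have m2 := congrArg (fun s => T.Rop z (lmulL n VR s v)) m1
  have m4 := congrArg (fun s => T.Pop z (lmulL n VR s v)) m3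
  simp only [map_add, map_smul, add_apply, smul_apply] at m2 m4
  simp only [lmulL_apply, ← lmul_comp_lmul, ContinuousLinearMap.comp_apply] at m2 m4
  have hneg : lmul (-d) v = -lmul d v := by
    rw [← lmulL_apply, map_neg]; rfl
  simp only [ContinuousLinearMap.comp_apply, add_apply, sub_apply, smul_apply, hneg, map_neg]
  linear_combination (norm := module) m2 - m4

theorem exists_norm_SL_ray_le (hT : T.IsBisectorial ω) {φ : ℝ} (h0 : 0 < ω)
    (hφ : φ ∈ Ioo ω (Real.pi / 2)) : ∃ C, 0 ≤ C ∧ ∀ J ∈ imagSphere n, ∀ p τ,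
      ‖T.SL (slicePt J (ray p φ τ).re (ray p φ τ).im)‖ * ‖ray p φ τ‖ ≤ C := by
  obtain ⟨C, hC, h⟩ := hT.norm_SL_le φ hφ
  refine ⟨C, hC, fun J hJ p τ => ?_⟩
  have hφ0 := h0.trans hφ.1
  have hpos : 0 < ‖ray p φ τ‖ := norm_pos_iff.2 (ray_ne_zero p φ τ)
  rw [← le_div_iff₀ hpos, ← norm_slicePt hJ (ray p φ τ)]
  refine h _ ⟨slicePt_mem_paravectors hJ _ _, ?_⟩
  rintro (h1 | h1)
  · exact ray_notMem_cSector hφ0 le_rfl hφ.2 p τ ((slicePt_mem_doubleSector hJ hφ0 hφ.2).1 h1)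
  · have := norm_slicePt hJ (ray p φ τ)
    rw [mem_singleton_iff.1 h1, norm_zero] at this
    exact hpos.ne this

theorem continuous_SL_ray (hT : T.IsBisectorial ω) (hn : 1 ≤ n) (hω : 0 < ω) {φ : ℝ}
    (hφ : φ ∈ Ioo ω (Real.pi / 2)) {J : Cl n} (hJ : J ∈ imagSphere n) (p : Bool × Bool) :
    Continuous fun τ => T.SL (slicePt J (ray p φ τ).re (ray p φ τ).im) := by
  obtain ⟨cR, cP⟩ := hT.continuous_Rop_Pop_ray hn hω hφ p
  have hr := continuous_ray p φ
  have cs := continuous_slicePt J (Complex.continuous_re.comp hr) (Complex.continuous_im.comp hr).neg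
  have e : (fun τ => T.SL (slicePt J (ray p φ τ).re (ray p φ τ).im)) = fun τ =>
      T.Rop (ray p φ τ) ∘L lmulL n VR (slicePt J (ray p φ τ).re (-(ray p φ τ).im)) -
        T.Pop (ray p φ τ) := by
    ext1 τ
    rw [hT.SL_slicePt hn (hφ.1.trans hφ.2) hJ (ray_mem_cExt hω hφ.1 hφ.2 p τ), lmulL_apply]
  rw [e]
  exact (cR.clm_comp ((lmulL n VR).continuous.comp cs)).sub cP

theorem integrable_SL_comp_lmul (hT : T.IsBisectorial ω) (hn : 1 ≤ n) (hω : 0 < ω)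
    (hθ : θ < Real.pi / 2) (hf : f ∈ SHL0 n θ) {φ : ℝ} (hφ : φ ∈ Ioo ω θ) {J : Cl n}
    (hJ : J ∈ imagSphere n) (p : Bool × Bool) :
    Integrable fun τ => T.SL (slicePt J (ray p φ τ).re (ray p φ τ).im) ∘L
      lmul (slicePt J (ray p φ τ).re (ray p φ τ).im * (-J) *
        f (slicePt J (ray p φ τ).re (ray p φ τ).im)) := by
  have hφ' : φ ∈ Ioo ω (Real.pi / 2) := ⟨hφ.1, hφ.2.trans hθ⟩
  have hφ0 := hω.trans hφ.1
  have hω2 := hφ'.1.trans hφ'.2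
  obtain ⟨C, hC, hb⟩ := hT.exists_norm_SL_ray_le hω hφ'
  have hr := continuous_ray p φ
  have cf : Continuous fun τ => f (slicePt J (ray p φ τ).re (ray p φ τ).im) :=
    (continuous_slice hf.1 hn (hφ0.trans hφ.2) hθ hJ).comp_continuous hr
      (HoloDecay.ray_mem hθ hφ0 hφ.2 p)
  have cSL := hT.continuous_SL_ray hn hω hφ' hJ p
  have cq := continuous_mul_Cl (continuous_mul_Cl (continuous_slicePt J
    (Complex.continuous_re.comp hr) (Complex.continuous_im.comp hr)) (continuous_const (y := -J))) cf
  have hint := integrable_norm_slicePt_ray hf.2 hJ hφ0 hφ.2 p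
  refine integrable_comp_lmul cSL cq hint (C := C * (‖lmulL n ℝ‖ * ‖lmulL n ℝ‖)) fun τ => ?_
  have h1 := hb J hJ p τ
  rw [← norm_slicePt hJ (ray p φ τ)] at h1
  generalize slicePt J (ray p φ τ).re (ray p φ τ).im = s at *
  have h3 : ‖s * (-J) * f s‖ ≤ ‖lmulL n ℝ‖ * (‖lmulL n ℝ‖ * ‖s‖) * ‖f s‖ := by
    refine (norm_mul_le_lmulL _ _).trans ?_
    have := norm_mul_le_lmulL s (-J)
    rw [norm_neg, hJ.2.2, mul_one] at this
    gcongr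
  calc _ ≤ ‖T.SL s‖ * (‖lmulL n ℝ‖ * (‖lmulL n ℝ‖ * ‖s‖) * ‖f s‖) := by gcongr
    _ = (‖T.SL s‖ * ‖s‖) * (‖lmulL n ℝ‖ * ‖lmulL n ℝ‖) * ‖f s‖ := by ring
    _ ≤ C * (‖lmulL n ℝ‖ * ‖lmulL n ℝ‖) * ‖f s‖ := by gcongr

/-- Folding each curve and combining conjugate points gives `∑_A f_A(T) e_A`. Independence of `J`
comes from `SL_comp_lmul_sub`, independence of the angle from `intrinsicCalc_eq`. -/
theorem isOmegaCalculus (hT : T.IsBisectorial ω) (hn : 1 ≤ n) (hω : 0 < ω)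
    (hθ : θ < Real.pi / 2) (hf : f ∈ SHL0 n θ)
    (hd : IsLeftSliceDecomp (doubleSector n θ) f f₀ f₁) {φ₀ : ℝ} (hφ₀ : φ₀ ∈ Ioo ω θ) :
    T.IsOmegaCalculus ω θ f
      (∑ A, T.intrinsicCalc φ₀ (component f₀ f₁ A) ∘L lmul (basisVec A)) := by
  have hθ0 : 0 < θ := hω.trans (hφ₀.1.trans hφ₀.2)
  have hcomp := fun A => hd.holoDecay_component hf.2 hn hθ0 hθ A
  have hIoi : ∀ φ ∈ Ioo ω θ, ∀ J ∈ imagSphere n, ∀ ε b, IntegrableOn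
      (fun t => T.pathIntegrand J (boundaryCurve J φ (sg ε)) f (sg b * t)) (Ioi 0) :=
    fun φ hφ J hJ ε b => by
      rw [← integrable_exp_smul_iff]
      simp_rw [T.exp_smul_pathIntegrand J φ ε b f _ rfl]
      exact (hT.integrable_SL_comp_lmul hn hω hθ hf hφ hJ (ε, b)).smul (sg b)
  refine ⟨fun s v => ?_, fun φ hφ J hJ ε hε => ?_, fun φ hφ J hJ => ?_⟩
  · simp only [sum_apply, ContinuousLinearMap.comp_apply, map_sum, lmul_rmul,
      hT.isRightLinear_intrinsicCalc hn hω hθ hφ₀ (hcomp _) _ _]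
  · obtain ⟨b, rfl⟩ : ∃ b, ε = sg b := by
      rcases hε with rfl | rfl
      · exact ⟨true, rfl⟩
      · exact ⟨false, rfl⟩
    exact (integrable_of_integrableOn_Ioi (hIoi φ hφ J hJ b)).1
  · have hφ0 := hω.trans hφ.1
    have hφ2 := hφ.2.trans hθ
    have hcl : ∀ ε A, Integrable fun τ =>
        T.calcIntegrand (component f₀ f₁ A) (ray (ε, true) φ τ) := fun ε A =>
      hT.integrable_calcIntegrand hn hω hθ hφ (hcomp A) _
    -- Right composition with `e_A` as a continuous linear map, so that it commutes with the
    -- integral.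
    let c : Finset (Fin n) → (CMod n VR →L[ℝ] CMod n VR) →L[ℝ] (CMod n VR →L[ℝ] CMod n VR) :=
      fun A => (ContinuousLinearMap.compL ℝ (CMod n VR) (CMod n VR) (CMod n VR)).flip
        (lmul (basisVec A))
    have key : ∀ ε, ∫ t, T.pathIntegrand J (boundaryCurve J φ (sg ε)) f t =
        (2 : ℝ) • ∑ A, (∫ τ, T.calcIntegrand (component f₀ f₁ A) (ray (ε, true) φ τ)) ∘L
          lmul (basisVec A) := fun ε => by
      rw [(integrable_of_integrableOn_Ioi (hIoi φ hφ J hJ ε)).2, ← integral_exp_smul]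
      have e : ∀ τ, Real.exp τ • ∑ b, T.pathIntegrand J (boundaryCurve J φ (sg ε)) f
          (sg b * Real.exp τ) = (2 : ℝ) • ∑ A,
            c A (T.calcIntegrand (component f₀ f₁ A) (ray (ε, true) φ τ)) := fun τ => by
        have hr : ray (ε, false) φ τ = starRingEnd ℂ (ray (ε, true) φ τ) := by
          simp [ray, conj_pt]
        have hs := hT.SL_comp_lmul_sub hn (hφ.1.trans hφ2) hd hJ
          (ray_mem_cExt hω hφ.1 hφ2 (ε, true) τ)
          (IsLeftSliceDecomp.mem_sliceDomain_of_mem hn hθ0 hθ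
            (HoloDecay.ray_mem hθ hφ0 hφ.2 (ε, true) τ))
        rw [Finset.smul_sum, Fintype.sum_bool, T.exp_smul_pathIntegrand J φ ε true f τ rfl,
          T.exp_smul_pathIntegrand J φ ε false f τ rfl, hr, Complex.conj_re, Complex.conj_im,
          sg_true, sg_false, one_smul, neg_one_smul, ← sub_eq_add_neg]
        exact hs
      simp_rw [e]
      rw [integral_smul, integral_finsetSum _ fun A _ => (c A).integrable_comp (hcl ε A)]
      congr 1
      exact Finset.sum_congr rfl fun A _ => (c A).integral_comp_comm (hcl ε A)
    have k1 := key true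
    have k2 := key false
    rw [sg_true] at k1
    rw [sg_false] at k2
    rw [k1, k2, ← smul_add, smul_smul, ← Finset.sum_add_distrib, Finset.smul_sum]
    refine Finset.sum_congr rfl fun A _ => ?_
    rw [hT.intrinsicCalc_eq hn hω hθ hφ₀ hφ (hcomp A), intrinsicCalc, Fintype.sum_bool,
      ← ContinuousLinearMap.add_comp, ContinuousLinearMap.smul_comp]
    congr 1
    field_simp

end IsBisectorial

end ClosedOp

end CliffordCalculus

end

/-! ### The product rule -/

theorem mainTheorem2 {n : ℕ} (hn : 1 ≤ n)
    {VR : Type*} [NormedAddCommGroup VR] [NormedSpace ℝ VR] [CompleteSpace VR]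
    (T : CliffordCalculus.ClosedOp n VR) (ω θ : ℝ)
    (hω : ω ∈ Set.Ioo 0 (Real.pi / 2)) (hT : T.IsBisectorial ω)
    (hθ : θ ∈ Set.Ioo ω (Real.pi / 2))
    (g f : CliffordCalculus.Cl n → CliffordCalculus.Cl n)
    (hg : g ∈ CliffordCalculus.N0 n θ) (hf : f ∈ CliffordCalculus.SHL0 n θ) :
    (fun s => g s * f s) ∈ CliffordCalculus.SHL0 n θ ∧
      ∃ gT fT : CliffordCalculus.CMod n VR →L[ℝ] CliffordCalculus.CMod n VR,
        T.IsOmegaCalculus ω θ g gT ∧ T.IsOmegaCalculus ω θ f fT ∧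
          T.IsOmegaCalculus ω θ (fun s => g s * f s) (gT ∘L fT) := by
  open CliffordCalculus in
  have hθ0 : 0 < θ := hω.1.trans hθ.1
  have hgf := mul_mem_SHL0 hg hf hn hθ0 hθ.2
  obtain ⟨g₀, g₁, hgd⟩ := hg.1
  obtain ⟨f₀, f₁, hfd⟩ := hf.1
  have hg' : g ∈ SHL0 n θ := ⟨⟨_, _, hgd⟩, hg.2⟩
  obtain ⟨φ, hφ⟩ := exists_between hθ.1
  set gc := component (fun p => g₀ p • (1 : Cl n)) (fun p => g₁ p • 1) ∅ with hgc
  have hgh : HoloDecay θ gc := hgd.holoDecay_component hg.2 hn hθ0 hθ.2 ∅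
  refine ⟨hgf, T.intrinsicCalc φ gc,
    ∑ A, T.intrinsicCalc φ (component f₀ f₁ A) ∘L lmul (basisVec A), ?_,
    hT.isOmegaCalculus hn hω.1 hθ.2 hf hfd hφ, ?_⟩
  · have h := hT.isOmegaCalculus hn hω.1 hθ.2 hg' hgd hφ
    -- `g₀` and `g₁` are real, so all components of `g` at `e_A` with `A ≠ ∅` vanish and `g(T)`
    -- reduces to one intrinsic integral.
    rw [Finset.sum_eq_single ∅ (fun A _ hA => ?_) (by simp)] at h
    · have h1 : (lmul (basisVec ∅ : Cl n) : CMod n VR →L[ℝ] CMod n VR) = .id ℝ _ := lmul_one_eq_id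
      rwa [h1, ContinuousLinearMap.comp_id] at h
    · have h0 : component (fun p => g₀ p • (1 : Cl n)) (fun p => g₁ p • 1) A = fun _ => 0 := by
        ext z; simp [component, Cl.coeff_one, hA]
      have h1 : T.intrinsicCalc φ (fun _ => 0) = 0 := by
        simp [ClosedOp.intrinsicCalc, ClosedOp.calcIntegrand]
      rw [h0, h1, ContinuousLinearMap.zero_comp]
  · have h := hT.isOmegaCalculus hn hω.1 hθ.2 hgf (hgd.mul hfd hn hθ0 hθ.2) hφ
    -- The scalar factor of `g` is the same for every `A`, so the intrinsic product rule applies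
    -- term by term, with `e_A` remaining on the right.
    simp_rw [component_mul] at h
    convert h using 1
    ext1 v
    simp only [ContinuousLinearMap.comp_apply, sum_apply, map_sum]
    refine Finset.sum_congr rfl fun A _ => ?_
    rw [← hT.intrinsicCalc_comp hn hω.1 hθ.2 hφ hφ hgh
      (hfd.holoDecay_component hf.2 hn hθ0 hθ.2 A)]
    rfl
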